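/- **Setting.** Let $d,p\ge 1$ and $k\ge 0$ be integers, and let $\Omega\subset\mathbb R^d$ be a bounded Lipschitz domain which is triangulated by a hierarchy of conforming simplicial meshes $\mathcal T_0,\dots,\mathcal T_L$ (each facet of a cell is a facet of another cell or lies in $\partial\Omega$), each cell of $\mathcal T_{\ell-1}$ being a union of cells of $\mathcal T_\ell$. Let $h_\ell$ be the largest diameter of a cell of $\mathcal T_\ell$. The meshes are uniformly shape regular and quasi-uniform, and $h_\ell\ge c_{\rm ref}h_{\ell-1}$ with a constant $c_{\rm ref}>0$. Let $\mathcal F_\ell$ be the set of faces of $\mathcal T_\ell$, and let $\|\cdot\|_0$ be the norm of $L^2(\Omega)$. For functions on the boundaries of the cells (possibly with different values from the two sides of a face) put $$\|\mu\|_\ell^2=\sum_{T\in\mathcal T_\ell}\frac{|T|}{|\partial T|}\int_{\partial T}\mu^2\,d\sigma .$$ Let $M_\ell$ be the space of functions on the faces in $\mathcal F_\ell$ that are polynomial of degree at most $p$ on each face and vanish on the faces in $\partial\Omega$, let $\overline V^c_\ell=\{w\in H^1_0(\Omega): w|_T\in\mathcal P_1(T)\ \forall T\in\mathcal T_\ell\}$,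 and let $\gamma_\ell$ be the trace on the skeleton. On each level let $\tau_\ell\ge 0$, and for $T\in\mathcal T_\ell$ let $V_T$ and $\vec W_T$ be spaces of scalar and vector valued polynomials of degree at most $k$ such that for every $\lambda\in M_\ell$ there is a unique $(u_T,\vec q_T)\in V_T\times\vec W_T$ with $$\int_T\vec q_T\cdot\vec r\,dx-\int_T u_T\nabla\!\cdot\vec r\,dx=-\int_{\partial T}\lambda\,\vec r\cdot\vec\nu\,d\sigma,\qquad \int_{\partial T}(\vec q_T\cdot\vec\nu+\tau_\ell u_T)v\,d\sigma-\int_T\vec q_T\cdot\nabla v\,dx=\tau_\ell\int_{\partial T}\lambda v\,d\sigma$$ for all $\vec r\in\vec W_T$, $v\in V_T$. Define $\mathcal U_\ell\lambda$ and $\vec{\mathcal Q}_\ell\lambda$ on $\Omega$ by $\mathcal U_\ell\lambda|_T=u_T$, $\vec{\mathcal Q}_\ell\lambda|_T=\vec q_T$, and $$a_\ell(\lambda,\mu)=\int_\Omega\vec{\mathcal Q}_\ell\lambda\cdot\vec{\mathcal Q}_\ell\mu\,dx+\sum_{T\in\mathcal T_\ell}\int_{\partial T}\tau_\ell(\mathcal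 U_\ell\lambda-\lambda)(\mathcal U_\ell\mu-\mu)\,d\sigma .$$ Let $I_\ell\colon M_{\ell-1}\to M_\ell$ be linear, $\ell=1,\dots,L$. **Assumptions.** With constants independent of $\ell$: * (IA1) $\|I_\ell\lambda\|_\ell\lesssim\|\lambda\|_{\ell-1}$ for all $\lambda\in M_{\ell-1}$; * (IA2) $I_\ell\gamma_{\ell-1}w=\gamma_\ell w$ for all $w\in\overline V^c_{\ell-1}$; and on every level $\ell$, for all $\mu\in M_\ell$: * (LS1) $\|\mathcal U_\ell\mu-\mu\|_\ell\lesssim h_\ell\|\vec{\mathcal Q}_\ell\mu\|_0$; * (LS2) $\|\vec{\mathcal Q}_\ell\mu\|_0\lesssim h_\ell^{-1}\|\mu\|_\ell$ and $\|\mathcal U_\ell\mu\|_0\lesssim\|\mu\|_\ell$; * (LS3) $\|\vec{\mathcal Q}_\ell\mu+\nabla\mathcal U_\ell\mu\|_0\lesssim h_\ell^{-1}\|\mathcal U_\ell\mu-\mu\|_\ell$ (with the cellwise gradient); * (LS4) if $\mu=\gamma_\ell w$ with $w\in\overline V^c_\ell$, then $\vec{\mathcal Q}_\ell\mu=-\nabla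 w$ and $\mathcal U_\ell\mu=w$. **Claim.** There is a constant $C$, depending only on $d,p,k$, the shape regularity and quasi-uniformity constants, $c_{\rm ref}$ and the constants in (IA1), (LS1)–(LS3) (in particular not on $\ell$, $L$ or the mesh sizes), such that for all $1\le\ell\le L$ and $\lambda\in M_{\ell-1}$ $$\|\vec{\mathcal Q}_\ell I_\ell\lambda\|_0\le C\|\vec{\mathcal Q}_{\ell-1}\lambda\|_0,$$ $$\|\mathcal U_{\ell-1}\lambda-\mathcal U_\ell I_\ell\lambda\|_0\le C h_{\ell-1}\|\vec{\mathcal Q}_{\ell-1}\lambda\|_0\quad\text{and}\quad \|\mathcal U_{\ell-1}\lambda-\mathcal U_\ell I_\ell\lambda\|_0\le C h_\ell\|\vec{\mathcal Q}_{\ell-1}\lambda\|_0 .$$ There is exactly one linear $P_{\ell-1}\colon M_\ell\to M_{\ell-1}$ with $a_{\ell-1}(P_{\ell-1}\lambda,\mu)=a_\ell(\lambda,I_\ell\mu)$ for all $\lambda\in M_\ell$, $\mu\in M_{\ell-1}$. If in addition $\tau_\ell h_\ell\le c_\tau$, then, with a constant $C'$ depending only on the quantities above and on $c_\tau$, $$a_\ell(I_\ell\lambda,I_\ell\lambda)\le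 C'a_{\ell-1}(\lambda,\lambda)\quad\forall\lambda\in M_{\ell-1},\qquad a_{\ell-1}(P_{\ell-1}\lambda,P_{\ell-1}\lambda)\le C'a_\ell(\lambda,\lambda)\quad\forall\lambda\in M_\ell .$$ -/

import Mathlib

open MeasureTheory Filter Topology
open scoped ENNReal NNReal ContDiff Gradient

noncomputable section

namespace HDG

/-- The Euclidean space `ℝ^d`. -/
abbrev Pt (d : ℕ) := EuclideanSpace ℝ (Fin d)

/-- Real polynomials in `d` variables. -/
abbrev Poly (d : ℕ) := MvPolynomial (Fin d) ℝ

/-- Polynomials of total degree at most `p`. -/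
abbrev PolyDeg (d p : ℕ) : Submodule ℝ (Poly d) := MvPolynomial.restrictTotalDegree (Fin d) ℝ p

variable {d : ℕ}

/-- Value of a polynomial at a point. -/
def val (u : Poly d) (x : Pt d) : ℝ := MvPolynomial.eval (fun i => x i) u

/-- Value of a polynomial vector field at a point. -/
def vecVal (q : Fin d → Poly d) (x : Pt d) : Pt d := WithLp.toLp 2 (fun i => val (q i) x)

/-- Gradient of a polynomial. -/
def polyGrad (u : Poly d) : Fin d → Poly d := fun i => MvPolynomial.pderiv i u

/-- Divergence of a polynomial vector field. -/
def polyDiv (q : Fin d → Poly d) : Poly d := ∑ i, MvPolynomial.pderiv i (q i)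

/-! ### Domain, `L²` norm and `H¹₀` -/

/-- Bounded Lipschitz domain: near each boundary point, `Ω` is the strict epigraph, in some unit
direction `e`, of a Lipschitz function of the component orthogonal to `e`. -/
structure IsLipschitzDomain (Ω : Set (Pt d)) : Prop where
  isOpen : IsOpen Ω
  isConnected : IsConnected Ω
  isBounded : Bornology.IsBounded Ω
  graph : ∀ x ∈ frontier Ω, ∃ (e : Pt d) (φ : Pt d → ℝ) (K : ℝ≥0) (r : ℝ),
    ‖e‖ = 1 ∧ LipschitzWith K φ ∧ (∀ (y : Pt d) (t : ℝ), φ (y + t • e) = φ y) ∧ 0 < r ∧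
      ∀ y ∈ Metric.ball x r, (y ∈ Ω ↔ φ y < inner ℝ e y)

/-- The `L²(Ω)` norm of a scalar or vector valued function. -/
def l2norm {F : Type*} [NormedAddCommGroup F] (Ω : Set (Pt d)) (f : Pt d → F) : ℝ :=
  Real.sqrt (∫ x in Ω, ‖f x‖ ^ 2)

/-- `u ∈ H¹₀(Ω)`, the closure of the smooth functions with compact support in `Ω` with respect to
the `H¹(Ω)` norm; `g` is the weak gradient of `u`. -/
def MemH10 (Ω : Set (Pt d)) (u : Pt d → ℝ) : Prop :=
  MemLp u 2 (volume.restrict Ω) ∧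
  ∃ g : Pt d → Pt d, MemLp g 2 (volume.restrict Ω) ∧
  ∃ φ : ℕ → Pt d → ℝ,
    (∀ n, ContDiff ℝ ∞ (φ n) ∧ HasCompactSupport (φ n) ∧ tsupport (φ n) ⊆ Ω) ∧
    Tendsto (fun n => eLpNorm (fun x => φ n x - u x) 2 (volume.restrict Ω)) atTop (𝓝 0) ∧
    Tendsto (fun n => eLpNorm (fun x => ∇ (φ n) x - g x) 2 (volume.restrict Ω)) atTop (𝓝 0)

/-! ### Simplices, given by their sets of vertices -/

/-- The closed simplex with vertex set `T` (a cell if `T` has `d + 1` points, a face if `d`). -/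
abbrev hull (T : Finset (Pt d)) : Set (Pt d) := convexHull ℝ (T : Set (Pt d))

/-- The vertex sets of the faces (of codimension one) of the cell with vertex set `T`. -/
def facets (T : Finset (Pt d)) : Finset (Finset (Pt d)) := T.powersetCard d

/-- The surface measure `dσ` on faces: the `(d-1)`-dimensional Hausdorff measure, normalized to
agree with Lebesgue measure on hyperplanes. -/
abbrev surf (d : ℕ) : Measure (Pt d) := Measure.euclideanHausdorffMeasure (d - 1)

/-- `∫_{∂T} f dσ`, where `f` may take different values on different faces. -/
def bdryIntegral (T : Finset (Pt d)) (f : Finset (Pt d) → Pt d → ℝ) : ℝ :=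
  ∑ F ∈ facets T, ∫ x in hull F, f F x ∂(surf d)

/-- `|T| / |∂T|`. -/
def volRatio (T : Finset (Pt d)) : ℝ :=
  volume.real (hull T) / ∑ F ∈ facets T, (surf d).real (hull F)

/-- Arithmetic mean of a finite set of points. -/
def barycenter (S : Finset (Pt d)) : Pt d := (S.card : ℝ)⁻¹ • ∑ x ∈ S, x

/-- The outward unit normal of the cell `T` on its face `F`: the vector from the barycenter of `T`
to that of `F`, made orthogonal to `F` and normalized. -/
def outerNormal (T F : Finset (Pt d)) : Pt d :=
  let n := (vectorSpan ℝ (F : Set (Pt d)))ᗮ.starProjection (barycenter F - barycenter T)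
  ‖n‖⁻¹ • n

/-! ### Meshes -/

/-- A regular (conforming) subdivision of `Ω` into simplices. -/
structure SimplicialMesh (d : ℕ) (Ω : Set (Pt d)) where
  /-- the vertex sets of the cells -/
  cells : Finset (Finset (Pt d))
  card_eq : ∀ T ∈ cells, T.card = d + 1
  indep : ∀ T ∈ cells, AffineIndependent ℝ ((↑) : T → Pt d)
  cover : ⋃ T ∈ cells, hull T = closure Ω
  inter : ∀ T ∈ cells, ∀ T' ∈ cells,
    hull T ∩ hull T' = convexHull ℝ ((T : Set (Pt d)) ∩ (T' : Set (Pt d)))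
  facet : ∀ T ∈ cells, ∀ F ∈ facets T,
    (∃ T' ∈ cells, T' ≠ T ∧ F ∈ facets T') ∨ hull F ⊆ frontier Ω

namespace SimplicialMesh

variable {Ω : Set (Pt d)} (𝒯 : SimplicialMesh d Ω)

/-- `F` is a face of the mesh. -/
def IsFace (F : Finset (Pt d)) : Prop := ∃ T ∈ 𝒯.cells, F ∈ facets T

/-- The mesh size: the largest diameter of a cell. -/
def h : ℝ := sSup ((fun T : Finset (Pt d) => Metric.diam (hull T)) '' (𝒯.cells : Set (Finset (Pt d))))

/-- Shape regularity with constant `s`: each cell contains a ball of radius comparable to the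
diameter of the cell. -/
def ShapeRegular (s : ℝ) : Prop :=
  ∀ T ∈ 𝒯.cells, ∃ (c : Pt d) (r : ℝ),
    0 < r ∧ Metric.closedBall c r ⊆ hull T ∧ Metric.diam (hull T) ≤ s * r

/-- Quasi-uniformity with constant `s`: the diameters of all cells are comparable to `h`. -/
def QuasiUniform (s : ℝ) : Prop := ∀ T ∈ 𝒯.cells, 𝒯.h ≤ s * Metric.diam (hull T)

/-- The skeletal space `M`: `λ F` is the function on the face `F`, extended by zero off `F`.
It is polynomial of degree at most `p` on every face and vanishes on the faces in `∂Ω`. -/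
def M (p : ℕ) : Submodule ℝ (Finset (Pt d) → Pt d → ℝ) where
  carrier := {lam | (∀ F, 𝒯.IsFace F → ∃ P ∈ PolyDeg d p, lam F = (hull F).indicator (val P)) ∧
    (∀ F, 𝒯.IsFace F → hull F ⊆ frontier Ω → lam F = 0) ∧
    (∀ F, ¬ 𝒯.IsFace F → lam F = 0)}
  add_mem' := by
    rintro a b ⟨ha, ha', ha''⟩ ⟨hb, hb', hb''⟩
    refine ⟨fun F hF => ?_, fun F hF hF' => ?_, fun F hF => ?_⟩
    · obtain ⟨P, hP, hP'⟩ := ha F hF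
      obtain ⟨R, hR, hR'⟩ := hb F hF
      refine ⟨P + R, add_mem hP hR, ?_⟩
      funext x
      by_cases hx : x ∈ hull F <;> simp [hP', hR', hx, val]
    · simp [ha' F hF hF', hb' F hF hF']
    · simp [ha'' F hF, hb'' F hF]
  zero_mem' := by
    refine ⟨fun F _ => ⟨0, zero_mem _, ?_⟩, fun F _ _ => rfl, fun F _ => rfl⟩
    funext x
    by_cases hx : x ∈ hull F <;> simp [hx, val]
  smul_mem' := by
    rintro c a ⟨ha, ha', ha''⟩
    refine ⟨fun F hF => ?_, fun F hF hF' => ?_, fun F hF => ?_⟩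
    · obtain ⟨P, hP, hP'⟩ := ha F hF
      refine ⟨c • P, Submodule.smul_mem _ c hP, ?_⟩
      funext x
      by_cases hx : x ∈ hull F <;> simp [hP', hx, val]
    · simp [ha' F hF hF']
    · simp [ha'' F hF]

/-- The function on `Ω` which on each (open) cell `T` equals the polynomial `u T`. -/
def fn (u : Finset (Pt d) → Poly d) (x : Pt d) : ℝ :=
  ∑ T ∈ 𝒯.cells, (interior (hull T)).indicator (val (u T)) x

/-- The vector field on `Ω` which on each (open) cell `T` equals the polynomial field `q T`. -/
def vecFn (q : Finset (Pt d) → Fin d → Poly d) (x : Pt d) : Pt d :=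
  ∑ T ∈ 𝒯.cells, (interior (hull T)).indicator (vecVal (q T)) x

/-- The norm `‖f‖_ℓ`, that is the square root of `∑_T |T|/|∂T| ∫_{∂T} f² dσ`. The function
`f T F` is the trace on the face `F` from the side of the cell `T`. -/
def skelNorm (f : Finset (Pt d) → Finset (Pt d) → Pt d → ℝ) : ℝ :=
  Real.sqrt (∑ T ∈ 𝒯.cells, volRatio T * bdryIntegral T (fun F x => f T F x ^ 2))

/-- The conforming linear finite element space `V̄^c = {w ∈ H¹₀(Ω) : w|_T ∈ P₁(T) for all T}`. Its
elements are represented by the function which is affine on every closed cell. -/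
def ConformingP1 (w : Pt d → ℝ) : Prop :=
  MemH10 Ω w ∧ ∀ T ∈ 𝒯.cells, ∃ P ∈ PolyDeg d 1, ∀ x ∈ hull T, w x = val P x

open Classical in
/-- The trace `γ w` on the skeleton. -/
def trace (w : Pt d → ℝ) : Finset (Pt d) → Pt d → ℝ :=
  fun F => if 𝒯.IsFace F then (hull F).indicator w else 0

/-- `𝒯'` is a refinement of `𝒯`: each cell of `𝒯` is a union of cells of `𝒯'`. -/
def IsRefinedBy (𝒯' : SimplicialMesh d Ω) : Prop :=
  ∀ T ∈ 𝒯.cells, ∃ S ⊆ 𝒯'.cells, hull T = ⋃ T' ∈ S, hull T'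

end SimplicialMesh

/-- A hierarchy of meshes on the levels `0, …, L`, obtained by successive refinement. -/
structure MeshHierarchy (d : ℕ) (Ω : Set (Pt d)) (L : ℕ) where
  mesh : Fin (L + 1) → SimplicialMesh d Ω
  refined : ∀ ℓ : Fin L, (mesh ℓ.castSucc).IsRefinedBy (mesh ℓ.succ)

/-! ### HDG methods -/

/-- `(u, q)` solves the local problem on the cell `T` with local spaces `V`, `W`, penalty `τ` and
skeletal data `lam`. -/
structure IsLocalSolution (V : Submodule ℝ (Poly d)) (W : Submodule ℝ (Fin d → Poly d)) (τ : ℝ)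
    (T : Finset (Pt d)) (lam : Finset (Pt d) → Pt d → ℝ)
    (u : Poly d) (q : Fin d → Poly d) : Prop where
  mem_V : u ∈ V
  mem_W : q ∈ W
  primary : ∀ r ∈ W,
    (∫ x in hull T, inner ℝ (vecVal q x) (vecVal r x)) - ∫ x in hull T, val u x * val (polyDiv r) x
      = - bdryIntegral T (fun F x => lam F x * inner ℝ (vecVal r x) (outerNormal T F))
  flux : ∀ v ∈ V,
    bdryIntegral T (fun F x => (inner ℝ (vecVal q x) (outerNormal T F) + τ * val u x) * val v x)
      - ∫ x in hull T, inner ℝ (vecVal q x) (vecVal (polyGrad v) x)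
      = τ * bdryIntegral T (fun F x => lam F x * val v x)

/-- An HDG method on a mesh with skeletal polynomial degree `p`: local spaces `V_T`, `W_T` of
polynomials of degree at most `k`, a penalty coefficient `τ` (`τ = 0` gives hybridized mixed
methods), such that the local problems define a mapping `λ ↦ (u_T, q_T)`. -/
structure Method {Ω : Set (Pt d)} (𝒯 : SimplicialMesh d Ω) (p k : ℕ) where
  V : Finset (Pt d) → Submodule ℝ (Poly d)
  W : Finset (Pt d) → Submodule ℝ (Fin d → Poly d)
  τ : ℝ
  V_le : ∀ T ∈ 𝒯.cells, V T ≤ PolyDeg d k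
  W_le : ∀ T ∈ 𝒯.cells, ∀ q ∈ W T, ∀ i, q i ∈ PolyDeg d k
  τ_nonneg : 0 ≤ τ
  solvable : ∀ T ∈ 𝒯.cells, ∀ lam ∈ 𝒯.M p,
    ∃! uq : Poly d × (Fin d → Poly d), IsLocalSolution (V T) (W T) τ T lam uq.1 uq.2

namespace Method

variable {Ω : Set (Pt d)} {𝒯 : SimplicialMesh d Ω} {p k : ℕ} (S : Method 𝒯 p k)

open Classical in
/-- The local solution on the cell `T` (zero if `T` is not a cell). -/
def sol (lam : 𝒯.M p) (T : Finset (Pt d)) : Poly d × (Fin d → Poly d) :=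
  if hT : T ∈ 𝒯.cells then (S.solvable T hT lam lam.2).choose else 0

/-- The local solver `𝒰`, cell by cell. -/
def U (lam : 𝒯.M p) (T : Finset (Pt d)) : Poly d := (S.sol lam T).1

/-- The local solver `𝒬`, cell by cell. -/
def Q (lam : 𝒯.M p) (T : Finset (Pt d)) : Fin d → Poly d := (S.sol lam T).2

/-- `𝒰 λ - λ` on the face `F` from the side of the cell `T`. -/
def jump (lam : 𝒯.M p) (T F : Finset (Pt d)) (x : Pt d) : ℝ :=
  val (S.U lam T) x - (lam : Finset (Pt d) → Pt d → ℝ) F x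

/-- `‖𝒬 λ‖₀`. -/
def normQ (lam : 𝒯.M p) : ℝ := l2norm Ω (𝒯.vecFn (S.Q lam))

/-- The condensed bilinear form `a(λ, μ)`. -/
def a (lam mu : 𝒯.M p) : ℝ :=
  (∫ x in Ω, inner ℝ (𝒯.vecFn (S.Q lam) x) (𝒯.vecFn (S.Q mu) x)) +
    ∑ T ∈ 𝒯.cells, bdryIntegral T (fun F x => S.τ * S.jump lam T F x * S.jump mu T F x)

end Method

/-- The norm `‖λ‖_ℓ` of a skeletal function. -/
def normM {Ω : Set (Pt d)} {𝒯 : SimplicialMesh d Ω} {p : ℕ} (lam : 𝒯.M p) : ℝ :=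
  𝒯.skelNorm (fun _ F x => (lam : Finset (Pt d) → Pt d → ℝ) F x)

namespace Method

variable {Ω : Set (Pt d)} {𝒯 : SimplicialMesh d Ω} {p k : ℕ} (S : Method 𝒯 p k)

/-- `‖𝒰 μ - μ‖_ℓ ≤ c h ‖𝒬 μ‖₀`. -/
def LS1 (c : ℝ) : Prop := ∀ mu : 𝒯.M p, 𝒯.skelNorm (S.jump mu) ≤ c * 𝒯.h * S.normQ mu

/-- `‖𝒬 μ‖₀ ≤ c h⁻¹ ‖μ‖_ℓ` and `‖𝒰 μ‖₀ ≤ c ‖μ‖_ℓ`. -/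
def LS2 (c : ℝ) : Prop := ∀ mu : 𝒯.M p,
  S.normQ mu ≤ c * (𝒯.h)⁻¹ * normM mu ∧ l2norm Ω (𝒯.fn (S.U mu)) ≤ c * normM mu

/-- `‖𝒬 μ + ∇ 𝒰 μ‖₀ ≤ c h⁻¹ ‖𝒰 μ - μ‖_ℓ`, with the cellwise gradient. -/
def LS3 (c : ℝ) : Prop := ∀ mu : 𝒯.M p,
  l2norm Ω (𝒯.vecFn (fun T => S.Q mu T + polyGrad (S.U mu T)))
    ≤ c * (𝒯.h)⁻¹ * 𝒯.skelNorm (S.jump mu)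

/-- `𝒬 μ = -∇ w` and `𝒰 μ = w` if `μ = γ w` for a conforming linear finite element
function `w`. -/
def LS4 : Prop := ∀ w : Pt d → ℝ, 𝒯.ConformingP1 w → ∀ mu : 𝒯.M p,
  (mu : Finset (Pt d) → Pt d → ℝ) = 𝒯.trace w → ∀ T ∈ 𝒯.cells,
    (∀ x ∈ interior (hull T), vecVal (S.Q mu T) x = - ∇ w x) ∧
    (∀ x ∈ hull T, val (S.U mu T) x = w x)

end Method

section Injection

variable {Ω : Set (Pt d)} {𝒯c 𝒯f : SimplicialMesh d Ω} {p : ℕ}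

/-- `‖I λ‖_ℓ ≤ c ‖λ‖_{ℓ-1}`. -/
def IA1 (I : 𝒯c.M p →ₗ[ℝ] 𝒯f.M p) (c : ℝ) : Prop := ∀ lam : 𝒯c.M p, normM (I lam) ≤ c * normM lam

/-- `I γ_{ℓ-1} w = γ_ℓ w` for all conforming linear finite element functions `w` on the
coarse mesh. -/
def IA2 (I : 𝒯c.M p →ₗ[ℝ] 𝒯f.M p) : Prop := ∀ w : Pt d → ℝ, 𝒯c.ConformingP1 w → ∀ mu : 𝒯c.M p,
  (mu : Finset (Pt d) → Pt d → ℝ) = 𝒯c.trace w →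
    (I mu : Finset (Pt d) → Pt d → ℝ) = 𝒯f.trace w

/-- `P` is the Ritz quasi-projection: `a_{ℓ-1}(P λ, μ) = a_ℓ(λ, I μ)` for all `λ`, `μ`. -/
def IsRitz {k : ℕ} (Sc : Method 𝒯c p k) (Sf : Method 𝒯f p k) (I : 𝒯c.M p →ₗ[ℝ] 𝒯f.M p)
    (P : 𝒯f.M p →ₗ[ℝ] 𝒯c.M p) : Prop :=
  ∀ (lam : 𝒯f.M p) (mu : 𝒯c.M p), Sc.a (P lam) mu = Sf.a lam (I mu)

end Injection

end HDG

end

/-! The whole theorem rests on one approximation result, `exists_conforming_approximation`: every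
`λ` in `M` is close to the trace of a conforming piecewise linear `w`, with `‖λ - γw‖ ≤ C h ‖𝒬λ‖₀`.
Put `δ = λ - γw`. By (IA2) and (LS4), `γw` is carried to the trace of the same `w` on the fine mesh,
where `𝒬` is again `-∇w` and `𝒰` is again `w`. So `𝒰_{ℓ-1}λ - 𝒰_ℓ I λ` involves only `δ`, and
`‖∇w‖₀` is bounded by `‖𝒬_{ℓ-1}λ‖₀ + ‖𝒬_{ℓ-1}δ‖₀`. The `δ` terms are bounded by (LS2) and (IA1),
with `h_{ℓ-1}` and `h_ℓ` comparable. This is `exists_injection_estimate`.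

To build `w`, note that (LS1) and (LS3) bound both the cellwise gradient of `𝒰λ` and its distance to
`λ` on the faces; an inverse estimate makes this pointwise on each cell (`exists_cell_estimate`).
Since `λ` is single valued on faces, the values of `𝒰λ` from two cells sharing a face are close.
Choose one of these values at each interior vertex and zero at each boundary vertex, and interpolate
linearly. At a vertex `v` the cells must then be linked by chains of cells which share faces
containing `v` (`star_connected`), and a boundary vertex must lie on a boundary face, where `λ = 0`
(`exists_boundary_face`). Both hold because a Lipschitz domain is locally connected up to its
boundary and lies on one side of it, while sets of codimension two do not disconnect open sets:
almost every segment misses them. That the interpolant lies in `H¹₀` is shown by soft thresholding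
followed by mollification (`memH10_of_lipschitz`).

For the Ritz quasi-projection, `a(λ, λ) = 0` forces `𝒬λ = 0`, so the approximation is exact, `λ =
γw` with `∇w = 0` on cells, and `w = 0`. A definite form on a finite dimensional space represents
every functional. Finally `‖𝒬λ‖₀² ≤ a(λ, λ)`, and `τ h ≤ c_τ` gives the converse up to a constant,
whence the energy bound for `I`; the bound for `P` follows by duality and Cauchy–Schwarz. -/

noncomputable section

namespace HDG

variable {d : ℕ}

/-! ### Barycentric coordinates -/

/-- `T` is the vertex set of a nondegenerate `d`-simplex. -/
structure IsSimplex (T : Finset (Pt d)) : Prop where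
  card_eq : T.card = d + 1
  indep : AffineIndependent ℝ ((↑) : T → Pt d)

/-- The affine basis formed by the vertices of a simplex. -/
def IsSimplex.basis {T : Finset (Pt d)} (hT : IsSimplex T) : AffineBasis T ℝ (Pt d) where
  toFun := (↑)
  ind' := hT.indep
  tot' := by
    rw [hT.indep.affineSpan_eq_top_iff_card_eq_finrank_add_one]
    simp [hT.card_eq]

open Classical in
/-- The barycentric coordinate with respect to the vertex `v` of `T`, as an affine function. -/
def bary (T : Finset (Pt d)) (v : Pt d) : Pt d →ᵃ[ℝ] ℝ :=
  if h : IsSimplex T ∧ v ∈ T then h.1.basis.coord ⟨v, h.2⟩ else 0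

namespace IsSimplex

variable {T : Finset (Pt d)} (hT : IsSimplex T)
include hT

theorem bary_apply (v : T) (x : Pt d) : bary T v x = hT.basis.coord v x := by
  simp [bary, hT]

theorem bary_self {v : Pt d} (hv : v ∈ T) : bary T v v = 1 := by
  rw [hT.bary_apply ⟨v, hv⟩]
  exact hT.basis.coord_apply_eq ⟨v, hv⟩

theorem bary_ne {v w : Pt d} (hv : v ∈ T) (hw : w ∈ T) (h : v ≠ w) : bary T v w = 0 := by
  rw [hT.bary_apply ⟨v, hv⟩]
  exact hT.basis.coord_apply_ne (i := ⟨v, hv⟩) (j := ⟨w, hw⟩) (by simpa using h)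

theorem sum_bary (x : Pt d) : ∑ v ∈ T, bary T v x = 1 := by
  rw [← Finset.sum_coe_sort, ← hT.basis.sum_coord_apply_eq_one x]
  exact Finset.sum_congr rfl fun v _ => hT.bary_apply v x

theorem sum_bary_smul (x : Pt d) : ∑ v ∈ T, bary T v x • v = x := by
  rw [← Finset.sum_coe_sort]
  conv_rhs => rw [← hT.basis.linear_combination_coord_eq_self x]
  exact Finset.sum_congr rfl fun v _ => by rw [hT.bary_apply v x]; rfl

theorem range_basis : Set.range hT.basis = (T : Set (Pt d)) := by
  ext x
  constructor
  · rintro ⟨v, rfl⟩; exact v.2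
  · intro hx; exact ⟨⟨x, hx⟩, rfl⟩

theorem mem_hull_iff {x : Pt d} : x ∈ hull T ↔ ∀ v ∈ T, 0 ≤ bary T v x := by
  rw [hull, ← hT.range_basis, AffineBasis.convexHull_eq_nonneg_coord]
  constructor
  · intro h v hv
    rw [hT.bary_apply ⟨v, hv⟩]; exact h ⟨v, hv⟩
  · intro h v
    rw [← hT.bary_apply v]; exact h v v.2

theorem mem_interior_iff {x : Pt d} : x ∈ interior (hull T) ↔ ∀ v ∈ T, 0 < bary T v x := by
  rw [hull, ← hT.range_basis, AffineBasis.interior_convexHull]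
  constructor
  · intro h v hv
    rw [hT.bary_apply ⟨v, hv⟩]; exact h ⟨v, hv⟩
  · intro h v
    rw [← hT.bary_apply v]; exact h v v.2

theorem affineMap_apply (f : Pt d →ᵃ[ℝ] ℝ) (x : Pt d) : f x = ∑ v ∈ T, bary T v x * f v := by
  have h := Finset.map_affineCombination T (fun v => v) (fun v => bary T v x) (hT.sum_bary x) f
  rw [Finset.affineCombination_eq_linear_combination _ _ _ (hT.sum_bary x), hT.sum_bary_smul,
    Finset.affineCombination_eq_linear_combination _ _ _ (hT.sum_bary x)] at h
  simpa using h

theorem mem_hull_of_bary_eq_zero {S : Finset (Pt d)} {x : Pt d} (hx : x ∈ hull T)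
    (hS : S ⊆ T) (h : ∀ v ∈ T, v ∉ S → bary T v x = 0) : x ∈ hull S := by
  have h1 : ∑ v ∈ S, bary T v x = 1 := by
    rw [← hT.sum_bary x]
    exact Finset.sum_subset hS h
  have h2 : ∑ v ∈ S, bary T v x • v = x := by
    conv_rhs => rw [← hT.sum_bary_smul x]
    exact Finset.sum_subset hS fun v hv hv' => by rw [h v hv hv', zero_smul]
  rw [← h2]
  exact (convex_convexHull ℝ _).sum_mem (fun v hv => hT.mem_hull_iff.1 hx v (hS hv)) h1
    fun v hv => subset_convexHull ℝ _ hv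

theorem bary_eq_zero_of_mem_hull {S : Finset (Pt d)} {x v : Pt d} (hx : x ∈ hull S)
    (hS : S ⊆ T) (hv : v ∈ T) (hvS : v ∉ S) : bary T v x = 0 := by
  have : hull S ⊆ (bary T v) ⁻¹' {0} := by
    refine convexHull_min ?_ ((convex_singleton 0).affine_preimage _)
    intro w hw
    exact hT.bary_ne hv (hS hw) (fun h => hvS (h ▸ hw))
  exact this hx

theorem mem_of_mem_hull {S : Finset (Pt d)} {v : Pt d} (hS : S ⊆ T) (hv : v ∈ T)
    (hx : v ∈ hull S) : v ∈ S := by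
  by_contra h
  have := hT.bary_eq_zero_of_mem_hull hx hS hv h
  rw [hT.bary_self hv] at this
  exact one_ne_zero this

theorem interior_nonempty : (interior (hull T)).Nonempty := by
  rw [interior_convexHull_nonempty_iff_affineSpan_eq_top, ← hT.range_basis]
  exact hT.basis.tot

theorem closure_interior : closure (interior (hull T)) = hull T := by
  rw [(convex_convexHull ℝ _).closure_interior_eq_closure_of_nonempty_interior hT.interior_nonempty]
  exact (T.finite_toSet.isCompact_convexHull (𝕜 := ℝ)).isClosed.closure_eq

/-- A simplex is the closure of its interior, so an open set cannot merely touch it. This turns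
incidences of cells into overlaps of open sets. -/
theorem inter_interior_nonempty {U : Set (Pt d)} (hU : IsOpen U) (h : (U ∩ hull T).Nonempty) :
    (U ∩ interior (hull T)).Nonempty := by
  obtain ⟨x, hxU, hx⟩ := h
  rw [← hT.closure_interior] at hx
  exact mem_closure_iff.1 hx U hU hxU

end IsSimplex

theorem continuous_bary (T : Finset (Pt d)) (v : Pt d) : Continuous (bary T v) :=
  (bary T v).continuous_of_finiteDimensional

theorem isCompact_hull (S : Finset (Pt d)) : IsCompact (hull S) :=
  S.finite_toSet.isCompact_convexHull (𝕜 := ℝ)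

theorem isClosed_hull (S : Finset (Pt d)) : IsClosed (hull S) := (isCompact_hull S).isClosed

theorem hull_mono {S S' : Finset (Pt d)} (h : S ⊆ S') : hull S ⊆ hull S' :=
  convexHull_mono (by exact_mod_cast h)

theorem mem_hull_of_mem {S : Finset (Pt d)} {v : Pt d} (h : v ∈ S) : v ∈ hull S :=
  subset_convexHull ℝ _ h

theorem affineSpan_ne_top_of_card_le {S : Finset (Pt d)} (h : S.card ≤ d) :
    affineSpan ℝ (S : Set (Pt d)) ≠ ⊤ := by
  intro htop
  rcases S.eq_empty_or_nonempty with rfl | hne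
  · simp at htop
  · have h1 : vectorSpan ℝ (S : Set (Pt d)) = ⊤ := by
      rw [← direction_affineSpan, htop, AffineSubspace.direction_top]
    have hc : S.card = (S.card - 1) + 1 := by have := hne.card_pos; omega
    have h2 := finrank_vectorSpan_image_finset_le ℝ (id : Pt d → Pt d) S hc
    rw [Finset.image_id] at h2
    rw [h1, finrank_top, finrank_euclideanSpace_fin] at h2
    omega

theorem volume_affineSpan_eq_zero {S : Finset (Pt d)} (h : S.card ≤ d) :
    volume (affineSpan ℝ (S : Set (Pt d)) : Set (Pt d)) = 0 :=
  Measure.addHaar_affineSubspace _ _ (affineSpan_ne_top_of_card_le h)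

theorem interior_hull_eq_empty {S : Finset (Pt d)} (h : S.card ≤ d) : interior (hull S) = ∅ := by
  by_contra hne
  rw [← ne_eq, ← Set.nonempty_iff_ne_empty, interior_convexHull_nonempty_iff_affineSpan_eq_top] at hne
  exact affineSpan_ne_top_of_card_le h hne

theorem volume_frontier_hull (S : Finset (Pt d)) : volume (frontier (hull S)) = 0 :=
  (convex_convexHull ℝ _).addHaar_frontier _

/-! ### Lipschitz domains -/

namespace IsLipschitzDomain

variable {Ω : Set (Pt d)} (hΩ : IsLipschitzDomain Ω)
include hΩ

/-- Moving from `x` against the graph direction `e` leads strictly below the graph, into an open set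
disjoint from `Ω`. This excludes slits, so that `Ω` is recovered from the union of the closed cells
as the interior of its closure. -/
theorem exists_notMem_closure {x : Pt d} (hx : x ∈ frontier Ω) {ε : ℝ} (hε : 0 < ε) :
    ∃ y ∈ Metric.ball x ε, y ∉ closure Ω := by
  obtain ⟨e, φ, K, r, he, hφ, hinv, hr, hgr⟩ := hΩ.graph x hx
  set t := min (ε / 2) (r / 2) with ht
  have ht0 : 0 < t := by positivity
  have hdist : dist (x + (-t) • e) x = t := by
    rw [dist_eq_norm]; simp [norm_smul, he, abs_of_pos ht0]
  have hxr : x ∈ Metric.ball x r := Metric.mem_ball_self hr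
  have hxΩ : x ∉ Ω := by
    rw [frontier, hΩ.isOpen.interior_eq] at hx; exact hx.2
  have h1 : inner ℝ e x ≤ φ x := by
    by_contra h; exact hxΩ ((hgr x hxr).2 (not_le.1 h))
  refine ⟨x + (-t) • e, ?_, ?_⟩
  · rw [Metric.mem_ball, hdist]
    have : t ≤ ε / 2 := min_le_left _ _
    linarith
  · intro hcl
    have hopen : IsOpen (Metric.ball x r ∩ {y | inner ℝ e y < φ y}) :=
      Metric.isOpen_ball.inter
        (isOpen_lt (continuous_const.inner continuous_id) hφ.continuous)
    have hmem : x + (-t) • e ∈ Metric.ball x r ∩ {y | inner ℝ e y < φ y} := by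
      refine ⟨?_, ?_⟩
      · rw [Metric.mem_ball, hdist]
        have : t ≤ r / 2 := min_le_right _ _
        linarith
      · simp only [Set.mem_ofPred_eq]
        rw [hinv, inner_add_right, inner_smul_right, real_inner_self_eq_norm_sq, he]
        linarith
    obtain ⟨y, ⟨hy1, hy2⟩, hyΩ⟩ := mem_closure_iff.1 hcl _ hopen hmem
    exact absurd ((hgr y hy1).1 hyΩ) (not_lt.2 (le_of_lt hy2))

theorem interior_closure : interior (closure Ω) = Ω := by
  refine subset_antisymm ?_ (hΩ.isOpen.subset_interior_iff.2 subset_closure)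
  intro x hx
  by_contra hxΩ
  have hfr : x ∈ frontier Ω := by
    rw [frontier, hΩ.isOpen.interior_eq]; exact ⟨interior_subset hx, hxΩ⟩
  obtain ⟨ε, hε, hb⟩ := Metric.isOpen_iff.1 isOpen_interior x hx
  obtain ⟨y, hy, hyc⟩ := hΩ.exists_notMem_closure hfr hε
  exact hyc (interior_subset (hb hy))

/-- At a boundary point, two nearby points of the epigraph are joined by rising vertically from each
and crossing by a segment at a height which clears the graph. -/
theorem exists_local_connection {v : Pt d} (hv : v ∈ closure Ω) {ε : ℝ} (hε : 0 < ε) :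
    ∃ δ > 0, ∀ x ∈ Ω ∩ Metric.ball v δ, ∀ y ∈ Ω ∩ Metric.ball v δ,
      ∃ G : Set (Pt d), IsPreconnected G ∧ G ⊆ Ω ∩ Metric.ball v ε ∧ x ∈ G ∧ y ∈ G := by
  by_cases hvΩ : v ∈ Ω
  · obtain ⟨r, hr, hb⟩ := Metric.isOpen_iff.1 hΩ.isOpen v hvΩ
    refine ⟨min r ε, by positivity, fun x hx y hy => ⟨Metric.ball v (min r ε),
      (convex_ball _ _).isPreconnected, ?_, hx.2, hy.2⟩⟩
    exact Set.subset_inter ((Metric.ball_subset_ball (min_le_left _ _)).trans hb)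
      (Metric.ball_subset_ball (min_le_right _ _))
  have hfr : v ∈ frontier Ω := by
    rw [frontier, hΩ.isOpen.interior_eq]; exact ⟨hv, hvΩ⟩
  obtain ⟨e, φ, K, r, he, hφ, hinv, hr, hgr⟩ := hΩ.graph v hfr
  have h1 : φ v ≤ inner ℝ e v := by
    by_contra h
    have hopen : IsOpen (Metric.ball v r ∩ {y | inner ℝ e y < φ y}) :=
      Metric.isOpen_ball.inter
        (isOpen_lt (continuous_const.inner continuous_id) hφ.continuous)
    obtain ⟨y, ⟨hy1, hy2⟩, hyΩ⟩ := mem_closure_iff.1 hv _ hopen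
      ⟨Metric.mem_ball_self hr, not_le.1 h⟩
    exact absurd ((hgr y hy1).1 hyΩ) (not_lt.2 (le_of_lt hy2))
  set ρ := min r ε with hρ
  have hρ0 : 0 < ρ := by positivity
  have hK : (0 : ℝ) ≤ K := K.2
  -- Within `δ` of `v`, `φ` varies by at most `K δ` and the height by at most `δ`, so a rise of `(K
  -- + 2) δ` clears the graph; the path then stays within `(K + 3) δ < ρ` of `v`.
  set δ := ρ / (K + 4) with hδ
  have hδ0 : 0 < δ := by positivity
  have hδρ : (K + 4) * δ = ρ := by rw [hδ]; field_simp
  set t := (K + 2) * δ with ht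
  have ht0 : 0 < t := by positivity
  have up : ∀ z ∈ Metric.ball v δ, ∀ s, 0 ≤ s → s ≤ t → z + s • e ∈ Metric.ball v ρ := by
    intro z hz s hs hst
    rw [Metric.mem_ball, dist_eq_norm] at *
    have : z + s • e - v = (z - v) + s • e := by abel
    rw [this]
    calc _ ≤ ‖z - v‖ + ‖s • e‖ := norm_add_le _ _
      _ < δ + t := by
        rw [norm_smul, he, Real.norm_of_nonneg hs]; linarith
      _ ≤ ρ := by rw [← hδρ, ht]; nlinarith
  have up2 : ∀ z ∈ Metric.ball v ρ, φ z < inner ℝ e z → z ∈ Ω ∩ Metric.ball v ε := by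
    intro z hz h
    exact ⟨(hgr z (Metric.ball_subset_ball (min_le_left _ _) hz)).2 h,
      Metric.ball_subset_ball (min_le_right _ _) hz⟩
  have hinner : ∀ (z : Pt d) (s : ℝ), inner ℝ e (z + s • e) = inner ℝ e z + s := by
    intro z s
    rw [inner_add_right, inner_smul_right, real_inner_self_eq_norm_sq, he]; ring
  refine ⟨δ, hδ0, fun x hx y hy => ?_⟩
  have seg : ∀ z ∈ Ω ∩ Metric.ball v δ,
      segment ℝ z (z + t • e) ⊆ Ω ∩ Metric.ball v ε := by
    rintro z ⟨hzΩ, hz⟩ q hq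
    rw [segment_eq_image'] at hq
    obtain ⟨θ, hθ, rfl⟩ := hq
    have : z + θ • (z + t • e - z) = z + (θ * t) • e := by rw [add_sub_cancel_left, smul_smul]
    simp only [this]
    have hz' : z ∈ Metric.ball v r := by
      have := up z hz 0 le_rfl ht0.le
      rw [zero_smul, add_zero] at this
      exact Metric.ball_subset_ball (min_le_left _ _) this
    have hθt : 0 ≤ θ * t := mul_nonneg hθ.1 ht0.le
    refine up2 _ (up z hz _ hθt ?_) ?_
    · nlinarith [hθ.2]
    · rw [hinv, hinner]
      have := (hgr z hz').1 hzΩ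
      linarith
  have top : segment ℝ (x + t • e) (y + t • e) ⊆ Ω ∩ Metric.ball v ε := by
    intro q hq
    have hq' : q - t • e ∈ Metric.ball v δ := by
      have hc : segment ℝ x y ⊆ Metric.ball v δ := (convex_ball v δ).segment_subset hx.2 hy.2
      apply hc
      have := (mem_segment_translate ℝ (t • e) (x := q - t • e) (b := x) (c := y)).1
      apply this
      rwa [add_sub_cancel, add_comm (t • e) x, add_comm (t • e) y]
    have hqe : q = (q - t • e) + t • e := by abel
    rw [hqe]
    refine up2 _ (up _ hq' _ ht0.le le_rfl) ?_
    rw [hinv, hinner]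
    set z := q - t • e
    have h2 : φ z ≤ φ v + K * δ := by
      have h3 := hφ.dist_le_mul z v
      rw [Real.dist_eq] at h3
      have h4 : dist z v ≤ δ := (Metric.mem_ball.1 hq').le
      have := (abs_le.1 h3).2
      nlinarith
    have h3 : inner ℝ e v - δ < inner ℝ e z := by
      have h4 : |inner ℝ e (v - z)| ≤ ‖e‖ * ‖v - z‖ := abs_real_inner_le_norm _ _
      rw [he, one_mul, inner_sub_right] at h4
      have h5 : ‖v - z‖ < δ := by
        rw [← dist_eq_norm, dist_comm]; exact hq'
      have := (abs_le.1 h4).2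
      linarith
    rw [ht]
    nlinarith
  refine ⟨segment ℝ x (x + t • e) ∪ segment ℝ (x + t • e) (y + t • e) ∪ segment ℝ y (y + t • e),
    ?_, ?_, Or.inl (Or.inl (left_mem_segment ℝ _ _)), Or.inr (left_mem_segment ℝ _ _)⟩
  · refine IsPreconnected.union (y + t • e) (Or.inr (right_mem_segment ℝ _ _))
      (right_mem_segment ℝ _ _) ?_ (convex_segment _ _).isPreconnected
    exact IsPreconnected.union (x + t • e) (right_mem_segment ℝ _ _)
      (left_mem_segment ℝ _ _) (convex_segment _ _).isPreconnected (convex_segment _ _).isPreconnected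
  · exact Set.union_subset (Set.union_subset (seg x hx) top) (seg y hy)

end IsLipschitzDomain

/-! ### Overlaps of the cells of a mesh -/

namespace SimplicialMesh

variable {Ω : Set (Pt d)} (𝒯 : SimplicialMesh d Ω)

theorem isSimplex {T : Finset (Pt d)} (hT : T ∈ 𝒯.cells) : IsSimplex T :=
  ⟨𝒯.card_eq T hT, 𝒯.indep T hT⟩

open Classical in
theorem hull_inter_hull {T T' : Finset (Pt d)} (hT : T ∈ 𝒯.cells) (hT' : T' ∈ 𝒯.cells) :
    hull T ∩ hull T' = hull (T ∩ T') := by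
  rw [𝒯.inter T hT T' hT']; simp [hull]

open Classical in
theorem card_inter_le {T T' : Finset (Pt d)} (hT : T ∈ 𝒯.cells) (hT' : T' ∈ 𝒯.cells)
    (h : T ≠ T') : (T ∩ T').card ≤ d := by
  by_contra hc
  have h1 : T ∩ T' = T := Finset.eq_of_subset_of_card_le Finset.inter_subset_left
    (by rw [𝒯.card_eq T hT]; omega)
  have h2 : T ∩ T' = T' := Finset.eq_of_subset_of_card_le Finset.inter_subset_right
    (by rw [𝒯.card_eq T' hT']; omega)
  exact h (h1.symm.trans h2)

/-- By conformity two distinct cells meet in the hull of at most `d` common vertices, which has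
empty interior. -/
theorem eq_of_interior_inter {T T' : Finset (Pt d)} (hT : T ∈ 𝒯.cells) (hT' : T' ∈ 𝒯.cells)
    {U : Set (Pt d)} (hU : IsOpen U) (hne : U.Nonempty) (h1 : U ⊆ hull T) (h2 : U ⊆ hull T') :
    T = T' := by
  classical
  by_contra h
  have h3 : U ⊆ interior (hull (T ∩ T')) := by
    rw [hU.subset_interior_iff, ← 𝒯.hull_inter_hull hT hT']
    exact Set.subset_inter h1 h2
  rw [interior_hull_eq_empty (𝒯.card_inter_le hT hT' h)] at h3
  exact hne.not_subset_empty h3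

theorem eq_of_interior_inter_nonempty {T T' : Finset (Pt d)} (hT : T ∈ 𝒯.cells)
    (hT' : T' ∈ 𝒯.cells) (h : (interior (hull T) ∩ hull T').Nonempty) : T = T' :=
  𝒯.eq_of_interior_inter hT hT' (isOpen_interior.inter isOpen_interior)
    ((𝒯.isSimplex hT').inter_interior_nonempty isOpen_interior h)
    (Set.inter_subset_left.trans interior_subset) (Set.inter_subset_right.trans interior_subset)

theorem hull_subset_closure {T : Finset (Pt d)} (hT : T ∈ 𝒯.cells) : hull T ⊆ closure Ω := by
  rw [← 𝒯.cover]; exact Set.subset_biUnion_of_mem (u := fun T => hull T) hT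

theorem exists_cell {x : Pt d} (hx : x ∈ closure Ω) : ∃ T ∈ 𝒯.cells, x ∈ hull T := by
  rw [← 𝒯.cover] at hx
  simpa using hx

theorem interior_hull_subset (hΩ : IsLipschitzDomain Ω) {T : Finset (Pt d)} (hT : T ∈ 𝒯.cells) :
    interior (hull T) ⊆ Ω := by
  rw [← hΩ.interior_closure]
  exact interior_mono (𝒯.hull_subset_closure hT)

/-! ### The skeleton of codimension two and generic segments -/

/-- The union of the affine spans of the sets of at most `d - 1` vertices of a cell. -/
def skel2 : Set (Pt d) :=
  ⋃ T ∈ 𝒯.cells, ⋃ S ∈ T.powerset.filter (fun S => S.card + 1 ≤ d),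
    (affineSpan ℝ (S : Set (Pt d)) : Set (Pt d))

theorem mem_skel2 {T S : Finset (Pt d)} (hT : T ∈ 𝒯.cells) (hS : S ⊆ T) (hc : S.card + 1 ≤ d)
    {x : Pt d} (hx : x ∈ hull S) : x ∈ 𝒯.skel2 := by
  refine Set.mem_biUnion hT (Set.mem_biUnion (x := S) ?_ (convexHull_subset_affineSpan _ hx))
  rw [Finset.mem_coe, Finset.mem_filter, Finset.mem_powerset]
  exact ⟨hS, hc⟩

theorem exists_notMem_skel2 {U : Set (Pt d)} (hU : IsOpen U) (hne : U.Nonempty) :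
    ∃ y ∈ U, y ∉ 𝒯.skel2 := by
  have h0 : volume 𝒯.skel2 = 0 := by
    refine (measure_biUnion_null_iff 𝒯.cells.countable_toSet).2 fun T _ => ?_
    refine (measure_biUnion_null_iff (Finset.countable_toSet _)).2 fun S hS => ?_
    rw [Finset.mem_coe, Finset.mem_filter] at hS
    exact volume_affineSpan_eq_zero (by omega)
  by_contra! h
  exact (hU.measure_pos volume hne).ne' (measure_mono_null h h0)

/-- If the segment meets the span of `S` at a point other than `y`, then `x` lies in the span of `S
∪ {y}`. These sets have at most `d` points, so their spans form a null set, which `x` can avoid. -/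
theorem exists_generic_segment {y : Pt d} (hy : y ∉ 𝒯.skel2) {U : Set (Pt d)} (hU : IsOpen U)
    (hne : U.Nonempty) : ∃ x ∈ U, ∀ z ∈ segment ℝ x y, z ∉ 𝒯.skel2 := by
  classical
  set N : Set (Pt d) := ⋃ T ∈ 𝒯.cells, ⋃ S ∈ T.powerset.filter (fun S => S.card + 1 ≤ d),
    (affineSpan ℝ ((insert y S : Finset (Pt d)) : Set (Pt d)) : Set (Pt d)) with hN
  have h0 : volume N = 0 := by
    refine (measure_biUnion_null_iff 𝒯.cells.countable_toSet).2 fun T _ => ?_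
    refine (measure_biUnion_null_iff (Finset.countable_toSet _)).2 fun S hS => ?_
    rw [Finset.mem_coe, Finset.mem_filter] at hS
    exact volume_affineSpan_eq_zero ((Finset.card_insert_le _ _).trans hS.2)
  obtain ⟨x, hxU, hxN⟩ : ∃ x ∈ U, x ∉ N := by
    by_contra! h
    exact (hU.measure_pos volume hne).ne' (measure_mono_null h h0)
  refine ⟨x, hxU, fun z hz hzs => hxN ?_⟩
  have hzy : z ≠ y := fun h => hy (h ▸ hzs)
  simp only [skel2, Set.mem_iUnion, exists_prop] at hzs
  obtain ⟨T, hT, S, hS, hzS⟩ := hzs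
  refine Set.mem_biUnion hT (Set.mem_biUnion (x := S) hS ?_)
  rw [segment_symm, segment_eq_image_lineMap] at hz
  obtain ⟨θ, hθ, rfl⟩ := hz
  have hθ0 : θ ≠ 0 := by rintro rfl; simp at hzy
  have h1 : AffineMap.lineMap y x θ ∈ affineSpan ℝ ((insert y S : Finset (Pt d)) : Set (Pt d)) :=
    affineSpan_mono ℝ (by simp) hzS
  have h2 : y ∈ affineSpan ℝ ((insert y S : Finset (Pt d)) : Set (Pt d)) :=
    subset_affineSpan ℝ _ (by simp)
  have h3 := AffineMap.lineMap_mem θ⁻¹ h2 h1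
  have h4 : AffineMap.lineMap y (AffineMap.lineMap y x θ) θ⁻¹ = x := by
    simp [AffineMap.lineMap_apply, smul_smul, hθ0]
  rwa [h4] at h3

/-! ### Connectivity of the set of cells around a point -/

-- A generic segment in `O` from a cell of `A` to a cell of `B` must, by connectedness, pass through
-- both families at one point; but the families meet only in codimension two, which the segment
-- avoids.
open Classical in
theorem not_connected_of_convex {A B : Finset (Finset (Pt d))} (hA : A ⊆ 𝒯.cells)
    (hB : B ⊆ 𝒯.cells) (hAB : ∀ T ∈ A, ∀ T' ∈ B, (T ∩ T').card + 1 ≤ d) {O : Set (Pt d)}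
    (hO : IsOpen O) (hconv : Convex ℝ O) (hcov : O ⊆ (⋃ T ∈ A, hull T) ∪ ⋃ T ∈ B, hull T)
    (hOA : (O ∩ ⋃ T ∈ A, hull T).Nonempty) (hOB : (O ∩ ⋃ T ∈ B, hull T).Nonempty) : False := by
  have key : ∀ C ⊆ 𝒯.cells, (O ∩ ⋃ T ∈ C, hull T).Nonempty →
      ∃ T ∈ C, (O ∩ interior (hull T)).Nonempty := by
    rintro C hC ⟨x, hxO, hx⟩
    simp only [Set.mem_iUnion, exists_prop] at hx
    obtain ⟨T, hT, hxT⟩ := hx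
    exact ⟨T, hT, (𝒯.isSimplex (hC hT)).inter_interior_nonempty hO ⟨x, hxO, hxT⟩⟩
  obtain ⟨TA, hTA, hneA⟩ := key A hA hOA
  obtain ⟨TB, hTB, hneB⟩ := key B hB hOB
  obtain ⟨y, hy, hy2⟩ := 𝒯.exists_notMem_skel2 (hO.inter isOpen_interior) hneB
  obtain ⟨x, hx, hseg⟩ := 𝒯.exists_generic_segment hy2 (hO.inter isOpen_interior) hneA
  have hclosed : ∀ C : Finset (Finset (Pt d)), IsClosed (⋃ T ∈ C, hull T) := fun C =>
    C.finite_toSet.isClosed_biUnion fun T _ => isClosed_hull T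
  obtain ⟨z, hz, hzA, hzB⟩ := isPreconnected_closed_iff.1 (convex_segment x y).isPreconnected _ _
    (hclosed A) (hclosed B) ((hconv.segment_subset hx.1 hy.1).trans hcov)
    ⟨x, left_mem_segment ℝ _ _, Set.mem_biUnion hTA (interior_subset hx.2)⟩
    ⟨y, right_mem_segment ℝ _ _, Set.mem_biUnion hTB (interior_subset hy.2)⟩
  simp only [Set.mem_iUnion, exists_prop] at hzA hzB
  obtain ⟨T, hT, hzT⟩ := hzA
  obtain ⟨T', hT', hzT'⟩ := hzB
  have hz' : z ∈ hull (T ∩ T') := by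
    rw [← 𝒯.hull_inter_hull (hA hT) (hB hT')]; exact ⟨hzT, hzT'⟩
  exact hseg z hz (𝒯.mem_skel2 (hA hT) Finset.inter_subset_left (hAB T hT T' hT') hz')

-- Reduction to the convex case: connectedness of `G` provides a point common to both families, and
-- a small ball around it is convex.
open Classical in
theorem not_connected {A B : Finset (Finset (Pt d))} (hA : A ⊆ 𝒯.cells)
    (hB : B ⊆ 𝒯.cells) (hAB : ∀ T ∈ A, ∀ T' ∈ B, (T ∩ T').card + 1 ≤ d) {O G : Set (Pt d)}
    (hO : IsOpen O) (hG : IsPreconnected G) (hGO : G ⊆ O)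
    (hcov : O ⊆ (⋃ T ∈ A, hull T) ∪ ⋃ T ∈ B, hull T)
    (hGA : (G ∩ ⋃ T ∈ A, hull T).Nonempty) (hGB : (G ∩ ⋃ T ∈ B, hull T).Nonempty) : False := by
  have hclosed : ∀ C : Finset (Finset (Pt d)), IsClosed (⋃ T ∈ C, hull T) := fun C =>
    C.finite_toSet.isClosed_biUnion fun T _ => isClosed_hull T
  obtain ⟨z, hz, hzA, hzB⟩ := isPreconnected_closed_iff.1 hG _ _
    (hclosed A) (hclosed B) (hGO.trans hcov) hGA hGB
  obtain ⟨r, hr, hb⟩ := Metric.isOpen_iff.1 hO z (hGO hz)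
  exact 𝒯.not_connected_of_convex hA hB hAB Metric.isOpen_ball (convex_ball z r) (hb.trans hcov)
    ⟨z, Metric.mem_ball_self hr, hzA⟩ ⟨z, Metric.mem_ball_self hr, hzB⟩

/-- The finitely many hulls which miss `v` have a closed union. -/
theorem _root_.HDG.exists_ball_avoiding (C : Finset (Finset (Pt d))) (v : Pt d) :
    ∃ ε > 0, ∀ S ∈ C, (Metric.ball v ε ∩ hull S).Nonempty → v ∈ hull S := by
  classical
  have hcl : IsClosed (⋃ S ∈ C.filter (fun S => v ∉ hull S), hull S) :=
    (Finset.finite_toSet _).isClosed_biUnion fun T _ => isClosed_hull T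
  have hv : v ∈ (⋃ S ∈ C.filter (fun S => v ∉ hull S), hull S)ᶜ := by
    simp
  obtain ⟨ε, hε, hb⟩ := Metric.isOpen_iff.1 hcl.isOpen_compl v hv
  refine ⟨ε, hε, fun S hS hne => ?_⟩
  by_contra h
  obtain ⟨x, hx, hxS⟩ := hne
  refine hb hx (Set.mem_biUnion (x := S) ?_ hxS)
  simp [hS, h]

-- Connectedness of the star of `v` through faces, as an induction principle. If `P` failed for some
-- cell at `v`, the cells at `v` with `P` and those without would cover `Ω` near `v` and meet only
-- in codimension two, although points of `Ω` near `v` can be joined inside `Ω` near `v`.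
open Classical in
theorem star_connected (hΩ : IsLipschitzDomain Ω) {v : Pt d} (P : Finset (Pt d) → Prop)
    (hP : ∀ T ∈ 𝒯.cells, ∀ T' ∈ 𝒯.cells, v ∈ hull T → v ∈ hull T' → (T ∩ T').card = d →
      P T → P T')
    {T₀ : Finset (Pt d)} (hT₀ : T₀ ∈ 𝒯.cells) (hv₀ : v ∈ hull T₀) (h₀ : P T₀)
    {T : Finset (Pt d)} (hT : T ∈ 𝒯.cells) (hv : v ∈ hull T) : P T := by
  by_contra hPT
  obtain ⟨ε, hε, hav⟩ := exists_ball_avoiding 𝒯.cells v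
  obtain ⟨δ, hδ, hcon⟩ := hΩ.exists_local_connection (𝒯.hull_subset_closure hT hv) hε
  set A := 𝒯.cells.filter (fun T => v ∈ hull T ∧ P T) with hA
  set B := 𝒯.cells.filter (fun T => v ∈ hull T ∧ ¬ P T) with hB
  have hpt : ∀ T ∈ 𝒯.cells, v ∈ hull T → ∃ x ∈ Ω ∩ Metric.ball v δ, x ∈ hull T := by
    intro T hT hv
    obtain ⟨x, hx, hxT⟩ := (𝒯.isSimplex hT).inter_interior_nonempty Metric.isOpen_ball
      ⟨v, Metric.mem_ball_self hδ, hv⟩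
    exact ⟨x, ⟨𝒯.interior_hull_subset hΩ hT hxT, hx⟩, interior_subset hxT⟩
  obtain ⟨x, hx, hxT⟩ := hpt T₀ hT₀ hv₀
  obtain ⟨y, hy, hyT⟩ := hpt T hT hv
  obtain ⟨G, hG, hGO, hxG, hyG⟩ := hcon x hx y hy
  refine 𝒯.not_connected (A := A) (B := B) (Finset.filter_subset _ _) (Finset.filter_subset _ _) ?_
    (hΩ.isOpen.inter Metric.isOpen_ball) hG hGO ?_
    ⟨x, hxG, Set.mem_biUnion (x := T₀) (by simp [hA, hT₀, hv₀, h₀]) hxT⟩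
    ⟨y, hyG, Set.mem_biUnion (x := T) (by simp [hB, hT, hv, hPT]) hyT⟩
  · intro T hTA T' hTB
    simp only [hA, hB, Finset.mem_filter] at hTA hTB
    have hne : T ≠ T' := by rintro rfl; exact hTB.2.2 hTA.2.2
    have h1 := 𝒯.card_inter_le hTA.1 hTB.1 hne
    have h2 : (T ∩ T').card ≠ d := fun h =>
      hTB.2.2 (hP T hTA.1 T' hTB.1 hTA.2.1 hTB.2.1 h hTA.2.2)
    omega
  · rintro z ⟨hzΩ, hzb⟩
    obtain ⟨T, hT, hzT⟩ := 𝒯.exists_cell (subset_closure hzΩ)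
    have hvT := hav T hT ⟨z, hzb, hzT⟩
    by_cases hPT : P T
    · exact Or.inl (Set.mem_biUnion (x := T) (by simp [hA, hT, hvT, hPT]) hzT)
    · exact Or.inr (Set.mem_biUnion (x := T) (by simp [hB, hT, hvT, hPT]) hzT)

/-! ### Boundary faces -/

/-- A second vanishing coordinate would place `x` in the hull of `d - 1` vertices. -/
theorem _root_.HDG.IsSimplex.pos_of_notMem_skel2 {T : Finset (Pt d)} (hT : T ∈ 𝒯.cells)
    {a : Pt d} (ha : a ∈ T) {x : Pt d} (hx : x ∈ hull (T.erase a)) (hxs : x ∉ 𝒯.skel2)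
    {v : Pt d} (hv : v ∈ T) (hva : v ≠ a) : 0 < bary T v x := by
  have hS := 𝒯.isSimplex hT
  have hxT : x ∈ hull T := hull_mono (Finset.erase_subset _ _) hx
  refine lt_of_le_of_ne (hS.mem_hull_iff.1 hxT v hv) fun h => hxs ?_
  have hsub : (T.erase a).erase v ⊆ T :=
    (Finset.erase_subset _ _).trans (Finset.erase_subset _ _)
  refine 𝒯.mem_skel2 hT hsub ?_ (hS.mem_hull_of_bary_eq_zero hxT hsub ?_)
  · rw [Finset.card_erase_of_mem (Finset.mem_erase.2 ⟨hva, hv⟩), Finset.card_erase_of_mem ha,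
      hS.card_eq]
    have : 1 < T.card := Finset.one_lt_card.2 ⟨v, hv, a, ha, hva⟩
    rw [hS.card_eq] at this
    omega
  · intro w hw hw'
    simp only [Finset.mem_erase, not_and, ne_eq] at hw'
    by_cases hwv : w = v
    · rw [hwv, ← h]
    · by_cases hwa : w = a
      · subst hwa
        exact hS.bary_eq_zero_of_mem_hull hx (Finset.erase_subset _ _) hw (by simp)
      · exact absurd hw (hw' hwv hwa)

theorem _root_.HDG.mem_facets_iff {T F : Finset (Pt d)} (hT : IsSimplex T) :
    F ∈ facets T ↔ ∃ a ∈ T, F = T.erase a := by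
  rw [facets, Finset.mem_powersetCard]
  constructor
  · rintro ⟨hF, hc⟩
    have : (T \ F).card = 1 := by
      rw [Finset.card_sdiff_of_subset hF, hT.card_eq, hc]; omega
    obtain ⟨a, ha⟩ := Finset.card_eq_one.1 this
    have ha' : a ∈ T \ F := by rw [ha]; simp
    rw [Finset.mem_sdiff] at ha'
    refine ⟨a, ha'.1, ?_⟩
    rw [Finset.erase_eq, ← ha, Finset.sdiff_sdiff_eq_self hF]
  · rintro ⟨a, ha, rfl⟩
    exact ⟨Finset.erase_subset _ _, by rw [Finset.card_erase_of_mem ha, hT.card_eq]; simp⟩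

/-- Two cells which share a face lie on opposite sides of it. -/
theorem union_mem_nhds {T T' F : Finset (Pt d)} (hT : T ∈ 𝒯.cells) (hT' : T' ∈ 𝒯.cells)
    (hne : T' ≠ T) (hF : F ∈ facets T) (hF' : F ∈ facets T') {z : Pt d} (hz : z ∈ hull F)
    (hzs : z ∉ 𝒯.skel2) : hull T ∪ hull T' ∈ 𝓝 z := by
  have hS := 𝒯.isSimplex hT
  have hS' := 𝒯.isSimplex hT'
  obtain ⟨a, ha, rfl⟩ := (mem_facets_iff hS).1 hF
  obtain ⟨a', ha', hE⟩ := (mem_facets_iff hS').1 hF'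
  -- Near `z` all coordinates except that of the opposite vertex stay positive, so the sign of this
  -- one decides membership.
  have loc : ∀ (T : Finset (Pt d)) (a : Pt d), T ∈ 𝒯.cells → a ∈ T → z ∈ hull (T.erase a) →
      ∀ᶠ y in 𝓝 z, (y ∈ hull T ↔ 0 ≤ bary T a y) := by
    intro T a hT ha hz
    have : ∀ᶠ y in 𝓝 z, ∀ v ∈ T.erase a, 0 < bary T v y := by
      rw [Filter.eventually_all_finset]
      intro v hv
      rw [Finset.mem_erase] at hv
      exact (continuous_bary T v).continuousAt.eventually_const_lt
        (IsSimplex.pos_of_notMem_skel2 𝒯 hT ha hz hzs hv.2 hv.1)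
    filter_upwards [this] with y hy
    rw [(𝒯.isSimplex hT).mem_hull_iff]
    refine ⟨fun h => h a ha, fun h v hv => ?_⟩
    by_cases hva : v = a
    · rwa [hva]
    · exact (hy v (Finset.mem_erase.2 ⟨hva, hv⟩)).le
  -- Both affine functions vanish on the common face, so they are proportional.
  have hc : ∀ y, bary T' a' y = bary T a y * bary T' a' a := by
    intro y
    rw [hS.affineMap_apply (bary T' a') y]
    refine Finset.sum_eq_single a ?_ (fun h => absurd ha h)
    intro v hv hva
    have : v ∈ T'.erase a' := by rw [← hE]; exact Finset.mem_erase.2 ⟨hva, hv⟩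
    rw [Finset.mem_erase] at this
    rw [hS'.bary_ne ha' this.2 this.1.symm, mul_zero]
  have e1 := loc T a hT ha hz
  have e2 := loc T' a' hT' ha' (hE ▸ hz)
  -- A zero factor would make the coordinate of `a'` vanish identically; a positive one would make
  -- the two cells coincide near `z` and hence overlap.
  have hκ : bary T' a' a < 0 := by
    by_contra hκ
    rw [not_lt] at hκ
    rcases hκ.eq_or_lt with h0 | hpos
    · have := hc a'
      rw [← h0, mul_zero, hS'.bary_self ha'] at this
      exact one_ne_zero this
    · have hsame : ∀ᶠ y in 𝓝 z, (y ∈ hull T ↔ y ∈ hull T') := by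
        filter_upwards [e1, e2] with y h1 h2
        rw [h1, h2, hc y, mul_nonneg_iff_of_pos_right hpos]
      obtain ⟨U, hU, hUo, hzU⟩ := eventually_nhds_iff.1 hsame
      have hzT : z ∈ hull T := hull_mono (Finset.erase_subset _ _) hz
      have := hS.inter_interior_nonempty hUo ⟨z, hzU, hzT⟩
      exact hne (𝒯.eq_of_interior_inter hT hT' (hUo.inter isOpen_interior) this
        (Set.inter_subset_right.trans interior_subset)
        fun y hy => (hU y hy.1).1 (interior_subset hy.2)).symm
  filter_upwards [e1, e2] with y h1 h2
  rcases le_total 0 (bary T a y) with h | h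
  · exact Or.inl (h1.2 h)
  · exact Or.inr (h2.2 (by rw [hc]; exact mul_nonneg_of_nonpos_of_nonpos h hκ.le))

/-- If no boundary face contained `x`, each point of `closure Ω` near `x` outside the codimension
two skeleton would be in `Ω`, being interior to a cell or to the union of two cells sharing a face.
A generic segment near `x` from `Ω` to the exterior would then be split into two disjoint open
pieces. -/
theorem exists_boundary_face (hΩ : IsLipschitzDomain Ω) {x : Pt d} (hx : x ∈ frontier Ω) :
    ∃ T ∈ 𝒯.cells, ∃ F ∈ facets T, x ∈ hull F ∧ hull F ⊆ frontier Ω := by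
  classical
  by_contra! hcon
  obtain ⟨ε, hε, hav⟩ := exists_ball_avoiding (𝒯.cells.biUnion facets) x
  have claim : ∀ z ∈ Metric.ball x ε, z ∈ closure Ω → z ∉ 𝒯.skel2 → z ∈ Ω := by
    intro z hz hzc hzs
    obtain ⟨T, hT, hzT⟩ := 𝒯.exists_cell hzc
    have hS := 𝒯.isSimplex hT
    by_cases hpos : ∀ v ∈ T, 0 < bary T v z
    · exact 𝒯.interior_hull_subset hΩ hT (hS.mem_interior_iff.2 hpos)
    push Not at hpos
    obtain ⟨a, ha, ha0⟩ := hpos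
    have ha0 : bary T a z = 0 := le_antisymm ha0 (hS.mem_hull_iff.1 hzT a ha)
    have hF : T.erase a ∈ facets T := (mem_facets_iff hS).2 ⟨a, ha, rfl⟩
    have hzF : z ∈ hull (T.erase a) := by
      refine hS.mem_hull_of_bary_eq_zero hzT (Finset.erase_subset _ _) fun v hv hv' => ?_
      have : v = a := by
        by_contra h; exact hv' (Finset.mem_erase.2 ⟨h, hv⟩)
      rw [this, ha0]
    have hxF := hav _ (Finset.mem_biUnion.2 ⟨T, hT, hF⟩) ⟨z, hz, hzF⟩
    rcases 𝒯.facet T hT _ hF with ⟨T', hT', hne, hF'⟩ | hfr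
    · have := 𝒯.union_mem_nhds hT hT' hne hF hF' hzF hzs
      rw [← hΩ.interior_closure, mem_interior_iff_mem_nhds]
      exact Filter.mem_of_superset this
        (Set.union_subset (𝒯.hull_subset_closure hT) (𝒯.hull_subset_closure hT'))
    · exact absurd hfr (hcon T hT _ hF hxF)
  obtain ⟨y₀, hy₀, hy₀c⟩ := hΩ.exists_notMem_closure hx hε
  obtain ⟨y, ⟨hyb, hyc⟩, hys⟩ := 𝒯.exists_notMem_skel2
    (Metric.isOpen_ball.inter isClosed_closure.isOpen_compl) ⟨y₀, hy₀, hy₀c⟩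
  obtain ⟨a, ⟨hab, haΩ⟩, hseg⟩ := 𝒯.exists_generic_segment hys
    (Metric.isOpen_ball.inter hΩ.isOpen)
    (mem_closure_iff.1 (frontier_subset_closure hx) _ Metric.isOpen_ball (Metric.mem_ball_self hε))
  obtain ⟨z, hz, hz1, hz2⟩ := (convex_segment a y).isPreconnected Ω (closure Ω)ᶜ hΩ.isOpen
    isClosed_closure.isOpen_compl (fun z hz => by
      by_cases hzc : z ∈ closure Ω
      · exact Or.inl (claim z ((convex_ball x ε).segment_subset hab hyb hz) hzc (hseg z hz))
      · exact Or.inr hzc)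
    ⟨a, left_mem_segment ℝ _ _, haΩ⟩ ⟨y, right_mem_segment ℝ _ _, hyc⟩
  exact hz2 (subset_closure hz1)

end SimplicialMesh

/-! ### Charts of faces and the surface measure -/

/-- An isometric parametrization `y ↦ p + A y` of the hyperplane through a face. -/
structure FaceChart (F : Finset (Pt d)) where
  p : Pt d
  A : EuclideanSpace ℝ (Fin (d - 1)) →ₗᵢ[ℝ] Pt d
  mem_span : ∀ y, p + A y ∈ affineSpan ℝ (F : Set (Pt d))
  surj : ∀ x ∈ hull F, ∃ y, p + A y = x

namespace FaceChart

variable {F : Finset (Pt d)} (χ : FaceChart F)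

/-- The parametrization. -/
def map (y : EuclideanSpace ℝ (Fin (d - 1))) : Pt d := χ.p + χ.A y

theorem isometry : Isometry χ.map := by
  intro y z
  simp [map, edist_add_left]

theorem hull_subset_range : hull F ⊆ Set.range χ.map := χ.surj

theorem continuous : Continuous χ.map := χ.isometry.continuous

/-- The parameter domain of the face. -/
def dom : Set (EuclideanSpace ℝ (Fin (d - 1))) := χ.map ⁻¹' hull F

theorem isClosed_dom : IsClosed χ.dom := (isClosed_hull F).preimage χ.continuous

theorem convex_dom : Convex ℝ χ.dom := by
  intro y hy z hz a b ha hb hab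
  have := convex_convexHull ℝ (F : Set (Pt d)) hy hz ha hb hab
  change χ.map (a • y + b • z) ∈ hull F
  convert this using 1
  simp only [map, map_add, map_smul, smul_add]
  have : χ.p = a • χ.p + b • χ.p := by rw [← add_smul, hab, one_smul]
  conv_lhs => rw [this]
  abel

/-- Isometries preserve the normalized Hausdorff measure, and on the parameter space it is Lebesgue
measure; surface integrals thus become ordinary ones in dimension `d - 1`. -/
theorem surf_hull : surf d (hull F) = volume χ.dom := by
  rw [dom, ← EuclideanSpace.euclideanHausdorffMeasure_eq_volume,
    χ.isometry.euclideanHausdorffMeasure_preimage, Set.inter_eq_left.2 χ.hull_subset_range]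

theorem setIntegral_hull (f : Pt d → ℝ) :
    ∫ x in hull F, f x ∂(surf d) = ∫ y in χ.dom, f (χ.map y) := by
  have h1 : (surf d).restrict (hull F) =
      (Measure.map χ.map (volume : Measure (EuclideanSpace ℝ (Fin (d - 1))))).restrict (hull F) := by
    rw [← EuclideanSpace.euclideanHausdorffMeasure_eq_volume,
      χ.isometry.map_euclideanHausdorffMeasure,
      Measure.restrict_restrict_of_subset χ.hull_subset_range]
  rw [h1, χ.isometry.isClosedEmbedding.measurableEmbedding.setIntegral_map]
  rfl

theorem exists_dom_subset_closedBall {D : ℝ} (hD : Metric.diam (hull F) ≤ D) (hne : (hull F).Nonempty) :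
    ∃ y, χ.dom ⊆ Metric.closedBall y D := by
  obtain ⟨x, hx⟩ := hne
  obtain ⟨y, rfl⟩ := χ.hull_subset_range hx
  refine ⟨y, fun z hz => ?_⟩
  rw [Metric.mem_closedBall, ← χ.isometry.dist_eq]
  exact (Metric.dist_le_diam_of_mem (isCompact_hull F).isBounded hz hx).trans hD

theorem isCompact_dom : IsCompact χ.dom :=
  χ.isometry.isClosedEmbedding.isCompact_preimage (isCompact_hull F)

end FaceChart

theorem IsSimplex.exists_chart {T : Finset (Pt d)} (hT : IsSimplex T) (hd : 1 ≤ d) {F : Finset (Pt d)}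
    (hF : F ∈ facets T) : Nonempty (FaceChart F) := by
  rw [facets, Finset.mem_powersetCard] at hF
  obtain ⟨hFT, hc⟩ := hF
  have hcard : Fintype.card F = (d - 1) + 1 := by rw [Fintype.card_coe, hc]; omega
  have hind : AffineIndependent ℝ ((↑) : F → Pt d) := hT.indep.mono hFT
  have hfin := hind.finrank_vectorSpan hcard
  have hrange : Set.range ((↑) : F → Pt d) = (F : Set (Pt d)) := by simp
  rw [hrange] at hfin
  have hne : F.Nonempty := by rw [← Finset.card_pos, hc]; omega
  obtain ⟨p, hp⟩ := hne
  have hpF : p ∈ (F : Set (Pt d)) := hp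
  set e := ((stdOrthonormalBasis ℝ (vectorSpan ℝ (F : Set (Pt d)))).reindex (finCongr hfin)).repr
  refine ⟨⟨p, (vectorSpan ℝ (F : Set (Pt d))).subtypeₗᵢ.comp e.symm.toLinearIsometry, ?_, ?_⟩⟩
  · intro y
    rw [add_comm, ← vadd_eq_add]
    refine AffineSubspace.vadd_mem_of_mem_direction ?_ (subset_affineSpan ℝ _ hpF)
    rw [direction_affineSpan]
    exact (e.symm y).2
  · intro x hx
    have hx' : x ∈ affineSpan ℝ (F : Set (Pt d)) := convexHull_subset_affineSpan _ hx
    have hv : x - p ∈ vectorSpan ℝ (F : Set (Pt d)) := by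
      rw [← direction_affineSpan]
      exact AffineSubspace.vsub_mem_direction hx' (subset_affineSpan ℝ _ hpF)
    refine ⟨e ⟨x - p, hv⟩, ?_⟩
    simp

theorem IsSimplex.bary_eq_zero_of_mem_span {T : Finset (Pt d)} (hT : IsSimplex T) {a : Pt d}
    (ha : a ∈ T) {x : Pt d} (hx : x ∈ affineSpan ℝ ((T.erase a : Finset (Pt d)) : Set (Pt d))) :
    bary T a x = 0 := by
  refine affineSpan_induction (p := fun x => bary T a x = 0) hx ?_ ?_
  · intro w hw
    rw [Finset.mem_coe, Finset.mem_erase] at hw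
    exact hT.bary_ne ha hw.2 hw.1.symm
  · intro c u v w hu hv hw
    rw [AffineMap.map_vadd, map_smul, AffineMap.linearMap_vsub, hu, hv, hw]
    simp

/-- A face of a simplex containing a ball of radius `r` contains a disc of radius `r`. -/
theorem IsSimplex.exists_disc {T : Finset (Pt d)} (hT : IsSimplex T) (hd : 1 ≤ d) {F : Finset (Pt d)}
    (hF : F ∈ facets T) (χ : FaceChart F) {c : Pt d} {r : ℝ} (hr : 0 < r)
    (hb : Metric.closedBall c r ⊆ hull T) : ∃ y, Metric.closedBall y r ⊆ χ.dom := by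
  obtain ⟨a, ha, rfl⟩ := (mem_facets_iff hT).1 hF
  set s := bary T a c with hs
  have hpos : ∀ v ∈ T, 0 < bary T v c := by
    rw [← hT.mem_interior_iff]
    exact interior_mono hb (by
      rw [mem_interior_iff_mem_nhds]; exact Metric.closedBall_mem_nhds c hr)
  have hs1 : s < 1 := by
    have h1 : 1 < T.card := by rw [hT.card_eq]; omega
    obtain ⟨v, hv, hva⟩ := Finset.exists_mem_ne h1 a
    have := hT.sum_bary c
    have h2 : ∑ v ∈ T.erase a, bary T v c + bary T a c = ∑ v ∈ T, bary T v c :=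
      Finset.sum_erase_add _ _ ha
    have h3 : 0 < ∑ v ∈ T.erase a, bary T v c :=
      Finset.sum_pos (fun w hw => hpos w (Finset.mem_of_mem_erase hw))
        ⟨v, Finset.mem_erase.2 ⟨hva, hv⟩⟩
    linarith
  have hs0 : 0 < 1 - s := by linarith
  have hlin : ∀ w, (bary T a).linear (χ.A w) = 0 := by
    intro w
    have h1 : χ.A w = (χ.p + χ.A w) -ᵥ (χ.p + χ.A 0) := by simp
    rw [h1, AffineMap.linearMap_vsub, hT.bary_eq_zero_of_mem_span ha (χ.mem_span w),
      hT.bary_eq_zero_of_mem_span ha (χ.mem_span 0)]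
    simp
  -- Central projection from the opposite vertex `a`: dilation by `(1 - s)⁻¹` carries the slice of
  -- the simplex at level `s`, the one through `c`, onto the face. A disc of radius `(1 - s) r`
  -- about `c` in this slice lies in the ball and is enlarged to radius `r`.
  set Q : EuclideanSpace ℝ (Fin (d - 1)) → Pt d := fun u =>
    AffineMap.lineMap a (c + (1 - s) • χ.A u) (1 - s)⁻¹ with hQ
  have hQmem : ∀ u, ‖u‖ ≤ r → Q u ∈ hull (T.erase a) := by
    intro u hu
    have hin : c + (1 - s) • χ.A u ∈ hull T := by
      apply hb
      rw [Metric.mem_closedBall, dist_eq_norm, add_sub_cancel_left, norm_smul,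
        Real.norm_of_nonneg hs0.le, LinearIsometry.norm_map]
      have : 0 < s := hpos a ha
      have := norm_nonneg u
      nlinarith
    have hbq : ∀ v, bary T v (Q u) =
        (1 - s)⁻¹ * (bary T v (c + (1 - s) • χ.A u) - bary T v a) + bary T v a := by
      intro v
      rw [hQ, AffineMap.apply_lineMap, AffineMap.lineMap_apply]; simp
    have ha0 : bary T a (Q u) = 0 := by
      have h1 : bary T a (c + (1 - s) • χ.A u) = s := by
        rw [add_comm c, ← vadd_eq_add, AffineMap.map_vadd, map_smul, hlin]
        simp [hs]
      rw [hbq, hT.bary_self ha, h1]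
      field_simp
      ring
    refine hT.mem_hull_of_bary_eq_zero (hT.mem_hull_iff.2 fun v hv => ?_) (Finset.erase_subset _ _)
      fun v hv hva => ?_
    · by_cases hva : v = a
      · rw [hva, ha0]
      · rw [hbq, hT.bary_ne hv ha hva, sub_zero, add_zero]
        exact mul_nonneg (inv_nonneg.2 hs0.le) (hT.mem_hull_iff.1 hin v hv)
    · have : v = a := by
        by_contra h; exact hva (Finset.mem_erase.2 ⟨h, hv⟩)
      rw [this, ha0]
  obtain ⟨y, hy⟩ := χ.surj _ (hQmem 0 (by simpa using hr.le))
  refine ⟨y, fun z hz => ?_⟩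
  change χ.map z ∈ hull (T.erase a)
  have h1 : χ.map z = Q (z - y) := by
    have h2 : χ.map z = (χ.p + χ.A y) + χ.A (z - y) := by
      rw [FaceChart.map, map_sub]; abel
    rw [h2, hy]
    simp only [hQ, AffineMap.lineMap_apply, vsub_eq_sub, vadd_eq_add, map_zero, add_zero,
      smul_sub, smul_add, smul_smul, inv_mul_cancel₀ hs0.ne', one_smul]
    abel
  rw [h1]
  exact hQmem _ (by rw [← dist_eq_norm]; exact hz)

/-! ### Volumes and surface areas of simplices -/

/-- The volume of the unit ball. -/
def ballVol (n : ℕ) : ℝ := volume.real (Metric.ball (0 : EuclideanSpace ℝ (Fin n)) 1)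

theorem ballVol_pos (n : ℕ) : 0 < ballVol n :=
  ENNReal.toReal_pos (Metric.measure_ball_pos volume _ one_pos).ne' measure_ball_lt_top.ne

theorem volume_real_closedBall {n : ℕ} (x : EuclideanSpace ℝ (Fin n)) {r : ℝ} (hr : 0 ≤ r) :
    volume.real (Metric.closedBall x r) = r ^ n * ballVol n := by
  rw [Measure.real, Measure.addHaar_closedBall _ _ hr, ENNReal.toReal_mul,
    ENNReal.toReal_ofReal (by positivity), finrank_euclideanSpace_fin]
  rfl

theorem IsSimplex.hull_nonempty {T : Finset (Pt d)} (hT : IsSimplex T) : (hull T).Nonempty :=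
  hT.interior_nonempty.mono interior_subset

theorem IsSimplex.facet_nonempty {T F : Finset (Pt d)} (hF : F ∈ facets T) (hd : 1 ≤ d) :
    F.Nonempty := by
  rw [facets, Finset.mem_powersetCard] at hF
  rw [← Finset.card_pos]; omega

theorem facet_subset {T F : Finset (Pt d)} (hF : F ∈ facets T) : F ⊆ T :=
  (Finset.mem_powersetCard.1 hF).1

theorem IsSimplex.card_facets {T : Finset (Pt d)} (hT : IsSimplex T) : (facets T).card = d + 1 := by
  rw [facets, Finset.card_powersetCard, hT.card_eq]; simp

theorem surf_hull_lt_top {T : Finset (Pt d)} (hT : IsSimplex T) (hd : 1 ≤ d) {F : Finset (Pt d)}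
    (hF : F ∈ facets T) : surf d (hull F) < ⊤ := by
  obtain ⟨χ⟩ := hT.exists_chart hd hF
  rw [χ.surf_hull]
  exact χ.isCompact_dom.measure_lt_top

theorem surf_real_le {T : Finset (Pt d)} (hT : IsSimplex T) (hd : 1 ≤ d) {F : Finset (Pt d)}
    (hF : F ∈ facets T) :
    (surf d).real (hull F) ≤ Metric.diam (hull T) ^ (d - 1) * ballVol (d - 1) := by
  obtain ⟨χ⟩ := hT.exists_chart hd hF
  obtain ⟨y, hy⟩ := χ.exists_dom_subset_closedBall
    (Metric.diam_mono (hull_mono (facet_subset hF)) (isCompact_hull T).isBounded)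
    (convexHull_nonempty_iff.2 (by exact_mod_cast IsSimplex.facet_nonempty hF hd))
  rw [← volume_real_closedBall y Metric.diam_nonneg, Measure.real, Measure.real, χ.surf_hull]
  exact ENNReal.toReal_mono measure_closedBall_lt_top.ne (measure_mono hy)

theorem le_surf_real {T : Finset (Pt d)} (hT : IsSimplex T) (hd : 1 ≤ d) {F : Finset (Pt d)}
    (hF : F ∈ facets T) {c : Pt d} {r : ℝ} (hr : 0 < r) (hb : Metric.closedBall c r ⊆ hull T) :
    r ^ (d - 1) * ballVol (d - 1) ≤ (surf d).real (hull F) := by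
  obtain ⟨χ⟩ := hT.exists_chart hd hF
  obtain ⟨y, hy⟩ := hT.exists_disc hd hF χ hr hb
  rw [← volume_real_closedBall y hr.le, Measure.real, Measure.real, χ.surf_hull]
  exact ENNReal.toReal_mono χ.isCompact_dom.measure_lt_top.ne (measure_mono hy)

theorem volume_real_hull_le (T : Finset (Pt d)) (hT : IsSimplex T) :
    volume.real (hull T) ≤ Metric.diam (hull T) ^ d * ballVol d := by
  obtain ⟨x, hx⟩ := hT.hull_nonempty
  rw [← volume_real_closedBall x Metric.diam_nonneg]
  exact ENNReal.toReal_mono measure_closedBall_lt_top.ne (measure_mono fun z hz =>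
    Metric.dist_le_diam_of_mem (isCompact_hull T).isBounded hz hx)

theorem le_volume_real_hull {T : Finset (Pt d)} {c : Pt d} {r : ℝ} (hr : 0 < r)
    (hb : Metric.closedBall c r ⊆ hull T) : r ^ d * ballVol d ≤ volume.real (hull T) := by
  rw [← volume_real_closedBall c hr.le]
  exact ENNReal.toReal_mono (isCompact_hull T).measure_lt_top.ne (measure_mono hb)

theorem IsSimplex.exists_closedBall {T : Finset (Pt d)} (hT : IsSimplex T) :
    ∃ (c : Pt d) (r : ℝ), 0 < r ∧ Metric.closedBall c r ⊆ hull T := by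
  obtain ⟨c, hc⟩ := hT.interior_nonempty
  obtain ⟨r, hr, hb⟩ := Metric.nhds_basis_closedBall.mem_iff.1 (mem_interior_iff_mem_nhds.1 hc)
  exact ⟨c, r, hr, hb⟩

theorem IsSimplex.volume_pos {T : Finset (Pt d)} (hT : IsSimplex T) : 0 < volume.real (hull T) := by
  obtain ⟨c, r, hr, hb⟩ := hT.exists_closedBall
  exact lt_of_lt_of_le (mul_pos (pow_pos hr _) (ballVol_pos d)) (le_volume_real_hull hr hb)

theorem IsSimplex.surf_pos {T : Finset (Pt d)} (hT : IsSimplex T) (hd : 1 ≤ d) {F : Finset (Pt d)}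
    (hF : F ∈ facets T) : 0 < (surf d).real (hull F) := by
  obtain ⟨c, r, hr, hb⟩ := hT.exists_closedBall
  exact lt_of_lt_of_le (mul_pos (pow_pos hr _) (ballVol_pos (d - 1))) (le_surf_real hT hd hF hr hb)

theorem IsSimplex.facets_nonempty {T : Finset (Pt d)} (hT : IsSimplex T) : (facets T).Nonempty := by
  rw [← Finset.card_pos, hT.card_facets]; omega

theorem IsSimplex.sum_surf_pos {T : Finset (Pt d)} (hT : IsSimplex T) (hd : 1 ≤ d) :
    0 < ∑ F ∈ facets T, (surf d).real (hull F) :=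
  Finset.sum_pos (fun _ hF => hT.surf_pos hd hF) hT.facets_nonempty

theorem IsSimplex.volRatio_pos {T : Finset (Pt d)} (hT : IsSimplex T) (hd : 1 ≤ d) :
    0 < volRatio T := div_pos hT.volume_pos (hT.sum_surf_pos hd)

theorem integrableOn_face {T : Finset (Pt d)} (hT : IsSimplex T) (hd : 1 ≤ d) {F : Finset (Pt d)}
    (hF : F ∈ facets T) {f : Pt d → ℝ} (hf : ContinuousOn f (hull F)) :
    IntegrableOn f (hull F) (surf d) := by
  obtain ⟨C, hC⟩ := (isCompact_hull F).exists_bound_of_continuousOn hf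
  exact IntegrableOn.of_bound (surf_hull_lt_top hT hd hF)
    (hf.aestronglyMeasurable (isClosed_hull F).measurableSet) C
    ((ae_restrict_iff' (isClosed_hull F).measurableSet).2 (Eventually.of_forall hC))

/-- In a chart the integrand vanishes almost everywhere, hence by continuity on the interior of the
parameter domain; that domain is convex and contains a disc, so its interior is dense in it. -/
theorem eq_zero_of_face_integral_eq_zero {T : Finset (Pt d)} (hT : IsSimplex T) (hd : 1 ≤ d)
    {F : Finset (Pt d)} (hF : F ∈ facets T) {f : Pt d → ℝ} (hf : ContinuousOn f (hull F))
    (h0 : ∀ x ∈ hull F, 0 ≤ f x) (h : ∫ x in hull F, f x ∂(surf d) = 0) {x : Pt d}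
    (hx : x ∈ hull F) : f x = 0 := by
  obtain ⟨χ⟩ := hT.exists_chart hd hF
  obtain ⟨c, r, hr, hb⟩ := hT.exists_closedBall
  obtain ⟨y, hy⟩ := hT.exists_disc hd hF χ hr hb
  have hc : ContinuousOn (f ∘ χ.map) χ.dom :=
    hf.comp χ.continuous.continuousOn fun _ h => h
  rw [χ.setIntegral_hull, setIntegral_eq_zero_iff_of_nonneg_ae
    ((ae_restrict_iff' χ.isClosed_dom.measurableSet).2 (Eventually.of_forall fun y hy => h0 _ hy))
    (hc.integrableOn_compact χ.isCompact_dom)] at h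
  have h1 : Set.EqOn (f ∘ χ.map) 0 (interior χ.dom) :=
    Measure.eqOn_open_of_ae_eq (μ := volume)
      (ae_restrict_of_ae_restrict_of_subset interior_subset h)
      isOpen_interior (hc.mono interior_subset) continuousOn_const
  have hne : (interior χ.dom).Nonempty :=
    ⟨y, mem_interior_iff_mem_nhds.2 (Filter.mem_of_superset (Metric.closedBall_mem_nhds y hr) hy)⟩
  have h2 : Set.EqOn (f ∘ χ.map) 0 χ.dom := h1.of_subset_closure hc continuousOn_const
    interior_subset (by
      rw [χ.convex_dom.closure_interior_eq_closure_of_nonempty_interior hne]; exact subset_closure)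
  obtain ⟨z, rfl⟩ := χ.hull_subset_range hx
  exact h2 hx

/-! ### Polynomials as functions -/

theorem val_add (u v : Poly d) (x : Pt d) : val (u + v) x = val u x + val v x := by simp [val]
theorem val_smul (c : ℝ) (u : Poly d) (x : Pt d) : val (c • u) x = c * val u x := by simp [val]

theorem continuous_val (u : Poly d) : Continuous (val u) :=
  (MvPolynomial.continuous_eval u).comp (PiLp.continuous_ofLp 2 _)

theorem continuous_vecVal (q : Fin d → Poly d) : Continuous (vecVal q) :=
  (PiLp.continuous_toLp 2 _).comp (continuous_pi fun i => continuous_val (q i))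

theorem vecVal_add (q r : Fin d → Poly d) (x : Pt d) :
    vecVal (q + r) x = vecVal q x + vecVal r x := by
  ext i; simp [vecVal, val_add]

theorem vecVal_smul (c : ℝ) (q : Fin d → Poly d) (x : Pt d) :
    vecVal (c • q) x = c • vecVal q x := by
  ext i; simp [vecVal, val_smul]

theorem polyGrad_add (u v : Poly d) : polyGrad (u + v) = polyGrad u + polyGrad v := by
  funext i; simp [polyGrad]

theorem hasGradientAt_val (u : Poly d) (x : Pt d) :
    HasGradientAt (val u) (vecVal (polyGrad u) x) x := by
  rw [hasGradientAt_iff_hasFDerivAt]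
  induction u using MvPolynomial.induction_on with
  | C a =>
    have h1 : val (MvPolynomial.C a : Poly d) = fun _ => a := by funext y; simp [val]
    have h2 : vecVal (polyGrad (MvPolynomial.C a : Poly d)) x = 0 := by
      ext i; simp [vecVal, polyGrad, val]
    rw [h1, h2, map_zero]
    exact hasFDerivAt_const a x
  | add p q hp hq =>
    have h1 : val (p + q) = val p + val q := by funext y; simp [val_add]
    rw [h1, polyGrad_add, vecVal_add, map_add]
    exact hp.add hq
  | mul_X p i hp =>
    have h1 : val (p * MvPolynomial.X i) = fun y => val p y * y i := by funext y; simp [val]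
    have h2 : HasFDerivAt (fun y : Pt d => y i) (EuclideanSpace.proj (𝕜 := ℝ) i) x :=
      PiLp.hasFDerivAt_apply 2 x i
    rw [h1]
    refine (hp.mul h2).congr_fderiv ?_
    ext w
    have h3 : vecVal (polyGrad (p * MvPolynomial.X i)) x =
        val p x • EuclideanSpace.single i 1 + x i • vecVal (polyGrad p) x := by
      ext j
      by_cases hij : j = i
      · subst hij
        simp [vecVal, polyGrad, val, mul_comm]
      · simp [vecVal, polyGrad, val, hij, mul_comm]
    rw [h3]
    simp [EuclideanSpace.inner_single_left]

theorem polyDeg_induction {k : ℕ} {P : Poly d → Prop} (hadd : ∀ u v, P u → P v → P (u + v))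
    (hmon : ∀ (s : Fin d →₀ ℕ) (c : ℝ), (s.sum fun _ e => e) ≤ k → P (MvPolynomial.monomial s c))
    {u : Poly d} (hu : u ∈ PolyDeg d k) : P u := by
  rw [MvPolynomial.mem_restrictTotalDegree] at hu
  rw [u.as_sum]
  refine Finset.sum_induction _ P hadd ?_ fun s hs => hmon s _ ((MvPolynomial.le_totalDegree hs).trans hu)
  -- The base case `P 0`, obtained from the zero monomial.
  have := hmon 0 0 (by simp)
  simpa using this

theorem pderiv_mem_polyDeg {k : ℕ} {u : Poly d} (hu : u ∈ PolyDeg d k) (i : Fin d) :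
    MvPolynomial.pderiv i u ∈ PolyDeg d k := by
  refine polyDeg_induction (P := fun u => MvPolynomial.pderiv i u ∈ PolyDeg d k) ?_ ?_ hu
  · intro u v hu hv; rw [map_add]; exact add_mem hu hv
  · intro s c hs
    rw [MvPolynomial.pderiv_monomial, MvPolynomial.mem_restrictTotalDegree]
    refine (MvPolynomial.totalDegree_monomial_le _ _).trans (le_trans ?_ hs)
    change ((s - Finsupp.single i 1).degree) ≤ s.degree
    exact Finsupp.degree_mono tsub_le_self

/-- Transports estimates from the unit ball to an arbitrary ball within the same polynomial space.
-/
theorem exists_comp_affine {k : ℕ} {u : Poly d} (hu : u ∈ PolyDeg d k) (c : Pt d) (r : ℝ) :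
    ∃ v ∈ PolyDeg d k, ∀ x, val v x = val u (c + r • x) := by
  refine polyDeg_induction (P := fun u => ∃ v ∈ PolyDeg d k, ∀ x, val v x = val u (c + r • x))
    ?_ ?_ hu
  · rintro u v ⟨u', hu', h1⟩ ⟨v', hv', h2⟩
    exact ⟨u' + v', add_mem hu' hv', fun x => by rw [val_add, val_add, h1, h2]⟩
  · intro s a hs
    refine ⟨MvPolynomial.C a * ∏ i ∈ s.support,
      (MvPolynomial.C (c i) + MvPolynomial.C r * MvPolynomial.X i) ^ s i, ?_, fun x => ?_⟩
    · rw [MvPolynomial.mem_restrictTotalDegree]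
      refine (MvPolynomial.totalDegree_mul _ _).trans ?_
      rw [MvPolynomial.totalDegree_C, zero_add]
      refine (MvPolynomial.totalDegree_finsetProd _ _).trans (le_trans ?_ hs)
      refine Finset.sum_le_sum fun i _ => (MvPolynomial.totalDegree_pow _ _).trans ?_
      have : (MvPolynomial.C (c i) + MvPolynomial.C r * MvPolynomial.X i : Poly d).totalDegree ≤ 1 := by
        refine (MvPolynomial.totalDegree_add _ _).trans (max_le (by simp) ?_)
        refine (MvPolynomial.totalDegree_mul _ _).trans ?_
        simp
      nlinarith
    · simp [val, MvPolynomial.eval_monomial, Finsupp.prod]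

theorem exists_affineMap_of_mem_polyDeg_one {u : Poly d} (hu : u ∈ PolyDeg d 1) :
    ∃ f : Pt d →ᵃ[ℝ] ℝ, ∀ x, val u x = f x := by
  refine polyDeg_induction (P := fun u => ∃ f : Pt d →ᵃ[ℝ] ℝ, ∀ x, val u x = f x) ?_ ?_ hu
  · rintro u v ⟨f, hf⟩ ⟨g, hg⟩
    exact ⟨f + g, fun x => by rw [val_add, hf, hg]; rfl⟩
  · intro s c hs
    change s.degree ≤ 1 at hs
    rcases Nat.le_one_iff_eq_zero_or_eq_one.1 hs with h | h
    · rw [Finsupp.degree_eq_zero_iff] at h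
      subst h
      exact ⟨AffineMap.const ℝ _ c, fun x => by simp [val]⟩
    · obtain ⟨i, rfl⟩ : ∃ i, s = Finsupp.single i 1 := by
        have hne : s ≠ 0 := by rintro rfl; simp at h
        obtain ⟨i, hi⟩ := Finsupp.ne_iff.1 hne
        have h1 : 1 ≤ s i := Nat.one_le_iff_ne_zero.2 hi
        have h2 : Finsupp.single i 1 ≤ s := Finsupp.single_le_iff.2 h1
        have h3 : (s - Finsupp.single i 1).degree + (Finsupp.single i 1).degree = s.degree := by
          rw [← map_add, tsub_add_cancel_of_le h2]
        rw [h, Finsupp.degree_single] at h3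
        have h4 : s - Finsupp.single i 1 = 0 := by
          rw [← Finsupp.degree_eq_zero_iff]; omega
        exact ⟨i, le_antisymm (tsub_eq_zero_iff_le.1 h4) h2⟩
      refine ⟨(c • (EuclideanSpace.proj (𝕜 := ℝ) i : Pt d →L[ℝ] ℝ).toLinearMap).toAffineMap,
        fun x => ?_⟩
      simp [val, MvPolynomial.eval_monomial]

theorem exists_poly_of_affineMap (f : Pt d →ᵃ[ℝ] ℝ) : ∃ u ∈ PolyDeg d 1, ∀ x, val u x = f x := by
  refine ⟨MvPolynomial.C (f 0) + ∑ i, MvPolynomial.C (f.linear (EuclideanSpace.single i 1)) *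
    MvPolynomial.X i, ?_, fun x => ?_⟩
  · rw [MvPolynomial.mem_restrictTotalDegree]
    refine (MvPolynomial.totalDegree_add _ _).trans (max_le (by simp) ?_)
    refine MvPolynomial.totalDegree_finsetSum_le fun i _ => ?_
    refine (MvPolynomial.totalDegree_mul _ _).trans ?_
    simp
  · have h1 : x = ∑ i, x i • EuclideanSpace.single i (1 : ℝ) := by
      ext j; simp [Finset.sum_apply, Pi.single_apply]
    have h2 : f x = f.linear x + f 0 := by
      have := f.map_vadd 0 x
      simpa using this
    rw [h2]
    conv_rhs => rw [h1, map_sum]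
    simp [val, add_comm, mul_comm]

/-! ### Norm equivalence and inverse estimates for polynomials -/

/-- The linear map `A v ↦ B v` on the finite dimensional range of `A` is continuous. It is used with
`A` the `L²` class on the unit ball and `B` the restriction to a ball of another radius with the
supremum norm. -/
theorem exists_bound_of_injective {V X Y : Type*} [AddCommGroup V] [Module ℝ V]
    [FiniteDimensional ℝ V] [NormedAddCommGroup X] [NormedSpace ℝ X] [NormedAddCommGroup Y]
    [NormedSpace ℝ Y] (A : V →ₗ[ℝ] X) (B : V →ₗ[ℝ] Y) (hA : Function.Injective A) :
    ∃ C > 0, ∀ v, ‖B v‖ ≤ C * ‖A v‖ := by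
  let e := LinearEquiv.ofInjective A hA
  let g : LinearMap.range A →L[ℝ] Y := (B ∘ₗ e.symm.toLinearMap).toContinuousLinearMap
  refine ⟨‖g‖ + 1, by positivity, fun v => ?_⟩
  have h1 : g (e v) = B v := by simp [g]
  have h2 : ‖e v‖ = ‖A v‖ := rfl
  rw [← h1, ← h2]
  exact (g.le_opNorm _).trans (by nlinarith [norm_nonneg (e v)])

theorem memLp_of_continuous {K : Set (Pt d)} (hK : IsCompact K) {F : Type*} [NormedAddCommGroup F]
    [SecondCountableTopology F] {f : Pt d → F} (hf : ContinuousOn f K) :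
    MemLp f 2 (volume.restrict K) := by
  obtain ⟨C, hC⟩ := hK.exists_bound_of_continuousOn hf
  have : IsFiniteMeasure (volume.restrict K) := ⟨by simpa using hK.measure_lt_top⟩
  exact MemLp.of_bound (hf.aestronglyMeasurable hK.measurableSet) C
    ((ae_restrict_iff' hK.measurableSet).2 (Eventually.of_forall hC))

/-- A polynomial as an element of `L²` of the unit ball. -/
def polyL2 (d k : ℕ) :
    PolyDeg d k →ₗ[ℝ] Lp ℝ 2 (volume.restrict (Metric.closedBall (0 : Pt d) 1)) where
  toFun u := (memLp_of_continuous (isCompact_closedBall (0 : Pt d) 1)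
    (continuous_val (u : Poly d)).continuousOn).toLp _
  map_add' u v := by
    rw [← MemLp.toLp_add]
    exact MemLp.toLp_congr _ _ (Eventually.of_forall fun x => val_add _ _ x)
  map_smul' a u := by
    rw [RingHom.id_apply, ← MemLp.toLp_const_smul]
    exact MemLp.toLp_congr _ _ (Eventually.of_forall fun x => val_smul _ _ x)

theorem coeFn_polyL2 {k : ℕ} (u : PolyDeg d k) :
    polyL2 d k u =ᵐ[volume.restrict (Metric.closedBall (0 : Pt d) 1)] val (u : Poly d) :=
  MemLp.coeFn_toLp (memLp_of_continuous (isCompact_closedBall (0 : Pt d) 1)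
    (continuous_val (u : Poly d)).continuousOn)

theorem norm_polyL2_sq {k : ℕ} (u : PolyDeg d k) :
    ‖polyL2 d k u‖ ^ 2 = ∫ x in Metric.closedBall (0 : Pt d) 1, val (u : Poly d) x ^ 2 := by
  rw [← real_inner_self_eq_norm_sq, L2.inner_def]
  refine integral_congr_ae ?_
  filter_upwards [coeFn_polyL2 u] with x hx
  rw [hx]
  simp [sq]

/-- The ball contains a cube, and a polynomial which vanishes on a product of infinite sets is zero.
-/
theorem eq_zero_of_val_eq_zero_on_ball {u : Poly d} {r : ℝ} (hr : 0 < r)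
    (h : ∀ x ∈ Metric.ball (0 : Pt d) r, val u x = 0) : u = 0 := by
  have hpre : (fun x : Fin d → ℝ => (WithLp.toLp 2 x : Pt d)) ⁻¹' Metric.ball 0 r ∈ 𝓝 0 :=
    (PiLp.continuous_toLp 2 (fun _ : Fin d => ℝ)).continuousAt (Metric.ball_mem_nhds _ hr)
  obtain ⟨ε, hε, hb⟩ := Metric.mem_nhds_iff.1 hpre
  refine MvPolynomial.funext_set (fun _ => Metric.ball (0 : ℝ) ε)
    (fun _ => infinite_of_mem_nhds 0 (Metric.ball_mem_nhds _ hε)) fun x hx => ?_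
  have hx' : x ∈ Metric.ball (0 : Fin d → ℝ) ε := by
    rw [ball_pi _ hε]; exact hx
  rw [map_zero]
  exact h _ (hb hx')

theorem polyL2_injective (d k : ℕ) : Function.Injective (polyL2 d k) := by
  rw [injective_iff_map_eq_zero]
  intro u hu
  have h0 := coeFn_polyL2 u
  rw [hu] at h0
  have h1 : Set.EqOn (val (u : Poly d)) 0 (Metric.ball 0 1) :=
    Measure.eqOn_open_of_ae_eq (μ := volume)
      (ae_restrict_of_ae_restrict_of_subset Metric.ball_subset_closedBall
        (h0.symm.trans (Lp.coeFn_zero _ _ _)))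
      Metric.isOpen_ball (continuous_val _).continuousOn continuousOn_const
  ext1
  exact eq_zero_of_val_eq_zero_on_ball one_pos h1

/-- A polynomial as a continuous function on a ball. -/
def polyC (d k : ℕ) (s : ℝ) : PolyDeg d k →ₗ[ℝ] C(Metric.closedBall (0 : Pt d) s, ℝ) where
  toFun u := ⟨fun x => val (u : Poly d) x, (continuous_val _).comp continuous_subtype_val⟩
  map_add' u v := by ext x; simp [val_add]
  map_smul' a u := by ext x; simp [val_smul]

open scoped Pointwise in
/-- The value of a polynomial on a ball is controlled by its `L²` norm on a smaller ball. -/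
theorem exists_inverse_estimate (d k : ℕ) (s : ℝ) :
    ∃ C > 0, ∀ u ∈ PolyDeg d k, ∀ (c : Pt d) (r : ℝ), 0 < r → ∀ x ∈ Metric.closedBall c (s * r),
      val u x ^ 2 * r ^ d ≤ C * ∫ y in Metric.closedBall c r, val u y ^ 2 := by
  set K := Metric.closedBall (0 : Pt d) 1 with hK
  obtain ⟨C, hC, hCb⟩ := exists_bound_of_injective (polyL2 d k) (polyC d k s)
    (polyL2_injective d k)
  refine ⟨C ^ 2, by positivity, fun u hu c r hr x hx => ?_⟩
  obtain ⟨v, hv, hval⟩ := exists_comp_affine hu c r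
  have hx' : r⁻¹ • (x - c) ∈ Metric.closedBall (0 : Pt d) s := by
    rw [mem_closedBall_zero_iff, norm_smul, Real.norm_of_nonneg (inv_nonneg.2 hr.le),
      inv_mul_le_iff₀ hr, mul_comm r, ← dist_eq_norm]
    exact hx
  have h1 : val v (r⁻¹ • (x - c)) = val u x := by
    rw [hval, smul_smul, mul_inv_cancel₀ hr.ne', one_smul, add_sub_cancel]
  have h2 : |val u x| ≤ C * ‖polyL2 d k ⟨v, hv⟩‖ := by
    rw [← h1, ← Real.norm_eq_abs]
    exact ((polyC d k s ⟨v, hv⟩).norm_coe_le_norm ⟨_, hx'⟩).trans (hCb _)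
  have h3 : val u x ^ 2 ≤ C ^ 2 * ∫ y in K, val v y ^ 2 := by
    rw [← norm_polyL2_sq ⟨v, hv⟩, ← mul_pow, ← sq_abs]
    exact pow_le_pow_left₀ (abs_nonneg _) h2 2
  -- Substitution `z = c + r y` with Jacobian `r ^ d`.
  have h4 : (∫ y in K, val v y ^ 2) * r ^ d = ∫ y in Metric.closedBall c r, val u y ^ 2 := by
    simp_rw [hval]
    rw [Measure.setIntegral_comp_smul_of_pos volume (fun z => val u (c + z) ^ 2) K hr, finrank_euclideanSpace_fin]
    have e2 : r • K = (fun z => c + z) ⁻¹' Metric.closedBall c r := by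
      rw [hK, smul_unitClosedBall, Real.norm_of_nonneg hr.le]
      ext z; simp
    rw [e2, MeasurePreserving.setIntegral_preimage_emb (measurePreserving_add_left volume c)
      (MeasurableEquiv.addLeft c).measurableEmbedding (fun z => val u z ^ 2)]
    rw [smul_eq_mul]
    field_simp
  rw [← h4]
  nlinarith [pow_pos hr d]

theorem norm_vecVal_sq (q : Fin d → Poly d) (x : Pt d) : ‖vecVal q x‖ ^ 2 = ∑ i, val (q i) x ^ 2 := by
  rw [EuclideanSpace.norm_sq_eq]
  simp [vecVal]

/-- Oscillation of a polynomial on a cell. -/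
theorem exists_osc_estimate (d k : ℕ) (s : ℝ) :
    ∃ C > 0, ∀ u ∈ PolyDeg d k, ∀ (T : Finset (Pt d)) (c : Pt d) (r : ℝ), 0 < r →
      Metric.closedBall c r ⊆ hull T → Metric.diam (hull T) ≤ s * r →
      ∀ x ∈ hull T, ∀ y ∈ hull T, (val u x - val u y) ^ 2 * r ^ d ≤
        C * Metric.diam (hull T) ^ 2 * ∫ z in hull T, ‖vecVal (polyGrad u) z‖ ^ 2 := by
  obtain ⟨C, hC, hCb⟩ := exists_inverse_estimate d k s
  refine ⟨C, hC, fun u hu T c r hr hb hdiam x hx y hy => ?_⟩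
  have hcT : c ∈ hull T := hb (Metric.mem_closedBall_self hr.le)
  set J := ∫ z in hull T, ‖vecVal (polyGrad u) z‖ ^ 2 with hJ
  have hJ0 : 0 ≤ J := integral_nonneg fun _ => by positivity
  -- The cell lies in the ball of radius `s r` about `c`, so the inverse estimate, applied to each
  -- partial derivative, bounds the gradient on the whole cell; the mean value inequality on the
  -- convex cell then bounds the oscillation.
  have hg : ∀ z ∈ hull T, ‖vecVal (polyGrad u) z‖ ^ 2 * r ^ d ≤ C * J := by
    intro z hz
    have hz' : z ∈ Metric.closedBall c (s * r) :=
      (Metric.dist_le_diam_of_mem (isCompact_hull T).isBounded hz hcT).trans hdiam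
    rw [norm_vecVal_sq, Finset.sum_mul]
    calc _ ≤ ∑ i, C * ∫ y in Metric.closedBall c r, val (polyGrad u i) y ^ 2 :=
          Finset.sum_le_sum fun i _ => hCb _ (pderiv_mem_polyDeg hu i) c r hr z hz'
      _ = C * ∫ y in Metric.closedBall c r, ‖vecVal (polyGrad u) y‖ ^ 2 := by
          rw [← Finset.mul_sum, ← integral_finsetSum]
          · simp_rw [norm_vecVal_sq]
          · intro i _
            exact ((continuous_val _).pow 2).continuousOn.integrableOn_compact
              (isCompact_closedBall _ _)
      _ ≤ C * J := by
          refine mul_le_mul_of_nonneg_left (setIntegral_mono_set ?_ ?_ hb.eventuallyLE) hC.le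
          · exact ((continuous_vecVal _).norm.pow 2).continuousOn.integrableOn_compact
              (isCompact_hull T)
          · exact Eventually.of_forall fun _ => by positivity
  have hb2 : ∀ z ∈ hull T, ‖vecVal (polyGrad u) z‖ ≤ Real.sqrt (C * J / r ^ d) := by
    intro z hz
    refine Real.le_sqrt_of_sq_le ?_
    rw [le_div_iff₀ (pow_pos hr d)]
    exact hg z hz
  have hmv := (convex_convexHull ℝ (T : Set (Pt d))).norm_image_sub_le_of_norm_hasFDerivWithin_le
    (f := val u) (fun z _ => (hasGradientAt_val u z).hasFDerivAt.hasFDerivWithinAt)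
    (fun z hz => by simpa using hb2 z hz) hy hx
  have h1 : |val u x - val u y| ≤ Real.sqrt (C * J / r ^ d) * Metric.diam (hull T) := by
    rw [← Real.norm_eq_abs]
    refine hmv.trans (mul_le_mul_of_nonneg_left ?_ (Real.sqrt_nonneg _))
    rw [← dist_eq_norm]
    exact Metric.dist_le_diam_of_mem (isCompact_hull T).isBounded hx hy
  have h2 := pow_le_pow_left₀ (abs_nonneg _) h1 2
  rw [sq_abs, mul_pow, Real.sq_sqrt (by positivity)] at h2
  calc _ ≤ C * J / r ^ d * Metric.diam (hull T) ^ 2 * r ^ d :=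
        mul_le_mul_of_nonneg_right h2 (by positivity)
    _ = _ := by field_simp

/-! ### Integrals over the cells and their boundaries -/

theorem integrableOn_hull {T : Finset (Pt d)} {f : Pt d → ℝ} (hf : ContinuousOn f (hull T)) :
    IntegrableOn f (hull T) := hf.integrableOn_compact (isCompact_hull T)

/-- `f F` is continuous on every face `F` of the cell `T`. -/
def BdryCont (T : Finset (Pt d)) (f : Finset (Pt d) → Pt d → ℝ) : Prop :=
  ∀ F ∈ facets T, ContinuousOn (f F) (hull F)

theorem bdryIntegral_congr {T : Finset (Pt d)} {f g : Finset (Pt d) → Pt d → ℝ}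
    (h : ∀ F ∈ facets T, ∀ x ∈ hull F, f F x = g F x) : bdryIntegral T f = bdryIntegral T g :=
  Finset.sum_congr rfl fun F hF => setIntegral_congr_fun (isClosed_hull F).measurableSet (h F hF)

theorem bdryIntegral_comb {T : Finset (Pt d)} (hT : IsSimplex T) (hd : 1 ≤ d)
    {f g : Finset (Pt d) → Pt d → ℝ} (hf : BdryCont T f) (hg : BdryCont T g) (a b : ℝ) :
    bdryIntegral T (fun F x => a * f F x + b * g F x) = a * bdryIntegral T f + b * bdryIntegral T g := by
  simp only [bdryIntegral, Finset.mul_sum, ← Finset.sum_add_distrib]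
  refine Finset.sum_congr rfl fun F hF => ?_
  rw [integral_add ((integrableOn_face hT hd hF (hf F hF)).const_mul a)
    ((integrableOn_face hT hd hF (hg F hF)).const_mul b), integral_const_mul, integral_const_mul]

theorem bdryIntegral_eq_comb {T : Finset (Pt d)} (hT : IsSimplex T) (hd : 1 ≤ d)
    {f g h : Finset (Pt d) → Pt d → ℝ} (hf : BdryCont T f) (hg : BdryCont T g) {a b : ℝ}
    (hh : ∀ F ∈ facets T, ∀ x ∈ hull F, h F x = a * f F x + b * g F x) :
    bdryIntegral T h = a * bdryIntegral T f + b * bdryIntegral T g := by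
  rw [← bdryIntegral_comb hT hd hf hg, bdryIntegral_congr hh]

theorem bdryIntegral_const_mul (T : Finset (Pt d)) (f : Finset (Pt d) → Pt d → ℝ) (a : ℝ) :
    bdryIntegral T (fun F x => a * f F x) = a * bdryIntegral T f := by
  simp only [bdryIntegral, Finset.mul_sum]
  exact Finset.sum_congr rfl fun F _ => integral_const_mul _ _

theorem bdryIntegral_nonneg {T : Finset (Pt d)} {f : Finset (Pt d) → Pt d → ℝ}
    (h : ∀ F ∈ facets T, ∀ x ∈ hull F, 0 ≤ f F x) : 0 ≤ bdryIntegral T f :=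
  Finset.sum_nonneg fun F hF => setIntegral_nonneg (isClosed_hull F).measurableSet (h F hF)

theorem bdryIntegral_mono {T : Finset (Pt d)} (hT : IsSimplex T) (hd : 1 ≤ d)
    {f g : Finset (Pt d) → Pt d → ℝ} (hf : BdryCont T f) (hg : BdryCont T g)
    (h : ∀ F ∈ facets T, ∀ x ∈ hull F, f F x ≤ g F x) : bdryIntegral T f ≤ bdryIntegral T g :=
  Finset.sum_le_sum fun F hF => setIntegral_mono_on (integrableOn_face hT hd hF (hf F hF))
    (integrableOn_face hT hd hF (hg F hF)) (isClosed_hull F).measurableSet (h F hF)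

/-! ### `L²` norms -/

theorem l2norm_nonneg {F : Type*} [NormedAddCommGroup F] (Ω : Set (Pt d)) (f : Pt d → F) :
    0 ≤ l2norm Ω f := Real.sqrt_nonneg _

theorem l2norm_eq_toReal {F : Type*} [NormedAddCommGroup F] {Ω : Set (Pt d)} {f : Pt d → F}
    (hf : MemLp f 2 (volume.restrict Ω)) :
    l2norm Ω f = (eLpNorm f 2 (volume.restrict Ω)).toReal := by
  rw [hf.eLpNorm_eq_integral_rpow_norm (by norm_num) (by norm_num),
    ENNReal.toReal_ofReal (by positivity), l2norm, Real.sqrt_eq_rpow]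
  norm_num

theorem l2norm_congr {F : Type*} [NormedAddCommGroup F] {Ω : Set (Pt d)} {f g : Pt d → F}
    (h : f =ᵐ[volume.restrict Ω] g) : l2norm Ω f = l2norm Ω g := by
  rw [l2norm, l2norm]
  congr 1
  exact integral_congr_ae (h.mono fun x hx => by simp only [hx])

theorem l2norm_neg {F : Type*} [NormedAddCommGroup F] (Ω : Set (Pt d)) (f : Pt d → F) :
    l2norm Ω (-f) = l2norm Ω f := by simp [l2norm]

theorem l2norm_add_le {F : Type*} [NormedAddCommGroup F] {Ω : Set (Pt d)} {f g : Pt d → F}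
    (hf : MemLp f 2 (volume.restrict Ω)) (hg : MemLp g 2 (volume.restrict Ω)) :
    l2norm Ω (f + g) ≤ l2norm Ω f + l2norm Ω g := by
  rw [l2norm_eq_toReal hf, l2norm_eq_toReal hg, l2norm_eq_toReal (hf.add hg),
    ← ENNReal.toReal_add hf.2.ne hg.2.ne]
  exact ENNReal.toReal_mono (ENNReal.add_ne_top.2 ⟨hf.2.ne, hg.2.ne⟩)
    (eLpNorm_add_le hf.1 hg.1 (by norm_num))

theorem l2norm_sub_le {F : Type*} [NormedAddCommGroup F] {Ω : Set (Pt d)} {f g : Pt d → F}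
    (hf : MemLp f 2 (volume.restrict Ω)) (hg : MemLp g 2 (volume.restrict Ω)) :
    l2norm Ω (f - g) ≤ l2norm Ω f + l2norm Ω g := by
  rw [sub_eq_add_neg, ← l2norm_neg Ω g]
  exact l2norm_add_le hf hg.neg

/-! ### Cellwise defined functions and the skeletal norm -/

namespace SimplicialMesh

variable {Ω : Set (Pt d)} (𝒯 : SimplicialMesh d Ω)

/-- The boundaries of the cells are null sets, being boundaries of convex sets. Identities in
`L²(Ω)` can therefore be checked cell by cell. -/
theorem ae_mem_interior : ∀ᵐ x ∂(volume.restrict Ω), ∃ T ∈ 𝒯.cells, x ∈ interior (hull T) := by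
  have h0 : ∀ᵐ x ∂(volume : Measure (Pt d)), ∀ T ∈ 𝒯.cells, x ∉ frontier (hull T) := by
    refine (ae_ball_iff 𝒯.cells.countable_toSet).2 fun T _ => ?_
    exact measure_eq_zero_iff_ae_notMem.1 (volume_frontier_hull T)
  by_cases hΩ : NullMeasurableSet Ω
  · refine (ae_restrict_iff'₀ hΩ).2 (h0.mono fun x hx hxΩ => ?_)
    obtain ⟨T, hT, hxT⟩ := 𝒯.exists_cell (subset_closure hxΩ)
    refine ⟨T, hT, ?_⟩
    by_contra h
    refine hx T hT ?_
    rw [frontier, (isClosed_hull T).closure_eq]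
    exact ⟨hxT, h⟩
  · have h1 : ∀ᵐ x ∂(volume.restrict Ω), x ∈ closure Ω :=
      ae_mono (Measure.restrict_mono subset_closure le_rfl)
        (ae_restrict_mem isClosed_closure.measurableSet)
    filter_upwards [ae_restrict_of_ae h0, h1] with x hx hxΩ
    obtain ⟨T, hT, hxT⟩ := 𝒯.exists_cell hxΩ
    refine ⟨T, hT, ?_⟩
    by_contra h
    refine hx T hT ?_
    rw [frontier, (isClosed_hull T).closure_eq]
    exact ⟨hxT, h⟩

theorem eq_of_mem_interior {T T' : Finset (Pt d)} (hT : T ∈ 𝒯.cells) (hT' : T' ∈ 𝒯.cells)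
    {x : Pt d} (hx : x ∈ interior (hull T)) (hx' : x ∈ hull T') : T = T' :=
  𝒯.eq_of_interior_inter_nonempty hT hT' ⟨x, hx, hx'⟩

theorem fn_eq (u : Finset (Pt d) → Poly d) {T : Finset (Pt d)} (hT : T ∈ 𝒯.cells) {x : Pt d}
    (hx : x ∈ interior (hull T)) : 𝒯.fn u x = val (u T) x := by
  rw [fn, Finset.sum_eq_single_of_mem T hT, Set.indicator_of_mem hx]
  intro T' hT' hne
  refine Set.indicator_of_notMem (fun h => hne ?_) _
  exact 𝒯.eq_of_mem_interior hT' hT h (interior_subset hx)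

theorem vecFn_eq (q : Finset (Pt d) → Fin d → Poly d) {T : Finset (Pt d)} (hT : T ∈ 𝒯.cells)
    {x : Pt d} (hx : x ∈ interior (hull T)) : 𝒯.vecFn q x = vecVal (q T) x := by
  rw [vecFn, Finset.sum_eq_single_of_mem T hT, Set.indicator_of_mem hx]
  intro T' hT' hne
  refine Set.indicator_of_notMem (fun h => hne ?_) _
  exact 𝒯.eq_of_mem_interior hT' hT h (interior_subset hx)

theorem memLp_fn (u : Finset (Pt d) → Poly d) : MemLp (𝒯.fn u) 2 (volume.restrict Ω) := by
  have : 𝒯.fn u = ∑ T ∈ 𝒯.cells, (interior (hull T)).indicator (val (u T)) := by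
    funext x; simp [fn, Finset.sum_apply]
  rw [this]
  refine memLp_finsetSum' _ fun T _ => MemLp.restrict _ ?_
  rw [memLp_indicator_iff_restrict isOpen_interior.measurableSet]
  exact (memLp_of_continuous (isCompact_hull T) (continuous_val (u T)).continuousOn).mono_measure
    (Measure.restrict_mono interior_subset le_rfl)

theorem memLp_vecFn (q : Finset (Pt d) → Fin d → Poly d) :
    MemLp (𝒯.vecFn q) 2 (volume.restrict Ω) := by
  have : 𝒯.vecFn q = ∑ T ∈ 𝒯.cells, (interior (hull T)).indicator (vecVal (q T)) := by
    funext x; simp [vecFn, Finset.sum_apply]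
  rw [this]
  refine memLp_finsetSum' _ fun T _ => MemLp.restrict _ ?_
  rw [memLp_indicator_iff_restrict isOpen_interior.measurableSet]
  exact (memLp_of_continuous (isCompact_hull T) (continuous_vecVal (q T)).continuousOn).mono_measure
    (Measure.restrict_mono interior_subset le_rfl)

theorem integral_eq_sum (hΩ : IsLipschitzDomain Ω) {f : Pt d → ℝ} {g : Finset (Pt d) → Pt d → ℝ}
    (hg : ∀ T ∈ 𝒯.cells, Continuous (g T))
    (h : ∀ T ∈ 𝒯.cells, ∀ x ∈ interior (hull T), f x = g T x) :
    ∫ x in Ω, f x = ∑ T ∈ 𝒯.cells, ∫ x in hull T, g T x := by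
  have hae : Ω =ᵐ[volume] ⋃ T ∈ 𝒯.cells, interior (hull T) := by
    refine Filter.EventuallyLE.antisymm ?_ ?_
    · have := (ae_restrict_iff' hΩ.isOpen.measurableSet).1 𝒯.ae_mem_interior
      filter_upwards [this] with x hx hxΩ
      obtain ⟨T, hT, hxT⟩ := hx hxΩ
      exact Set.mem_biUnion hT hxT
    · have hsub : (⋃ T ∈ 𝒯.cells, interior (hull T)) ⊆ Ω :=
        Set.iUnion₂_subset fun T hT => 𝒯.interior_hull_subset hΩ hT
      exact hsub.eventuallyLE
  rw [setIntegral_congr_set hae, integral_biUnion_finset 𝒯.cells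
    (fun T _ => isOpen_interior.measurableSet)]
  · refine Finset.sum_congr rfl fun T hT => ?_
    rw [setIntegral_congr_fun isOpen_interior.measurableSet (h T hT)]
    refine setIntegral_congr_set ?_
    exact interior_ae_eq_of_null_frontier (volume_frontier_hull T)
  · intro T hT T' hT' hne
    refine Set.disjoint_left.2 fun x hx hx' => hne ?_
    exact 𝒯.eq_of_mem_interior hT hT' hx (interior_subset hx')
  · intro T hT
    refine IntegrableOn.congr_fun ?_ (fun x hx => (h T hT x hx).symm) isOpen_interior.measurableSet
    exact (integrableOn_hull (hg T hT).continuousOn).mono_set interior_subset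

theorem l2norm_vecFn_sq (hΩ : IsLipschitzDomain Ω) (q : Finset (Pt d) → Fin d → Poly d) :
    l2norm Ω (𝒯.vecFn q) ^ 2 = ∑ T ∈ 𝒯.cells, ∫ x in hull T, ‖vecVal (q T) x‖ ^ 2 := by
  rw [l2norm, Real.sq_sqrt (integral_nonneg fun _ => by positivity)]
  refine 𝒯.integral_eq_sum hΩ (fun T _ => (continuous_vecVal _).norm.pow 2) fun T hT x hx => ?_
  rw [𝒯.vecFn_eq q hT hx]

theorem skelNorm_nonneg (f : Finset (Pt d) → Finset (Pt d) → Pt d → ℝ) : 0 ≤ 𝒯.skelNorm f :=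
  Real.sqrt_nonneg _

theorem cell_term_nonneg (hd : 1 ≤ d) {T : Finset (Pt d)} (hT : T ∈ 𝒯.cells)
    (f : Finset (Pt d) → Pt d → ℝ) : 0 ≤ volRatio T * bdryIntegral T (fun F x => f F x ^ 2) :=
  mul_nonneg ((𝒯.isSimplex hT).volRatio_pos hd).le (bdryIntegral_nonneg fun _ _ _ _ => sq_nonneg _)

theorem skelNorm_sq (hd : 1 ≤ d) (f : Finset (Pt d) → Finset (Pt d) → Pt d → ℝ) :
    𝒯.skelNorm f ^ 2 = ∑ T ∈ 𝒯.cells, volRatio T * bdryIntegral T (fun F x => f T F x ^ 2) :=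
  Real.sq_sqrt (Finset.sum_nonneg fun _ hT => 𝒯.cell_term_nonneg hd hT _)

theorem isFace {T F : Finset (Pt d)} (hT : T ∈ 𝒯.cells) (hF : F ∈ facets T) : 𝒯.IsFace F :=
  ⟨T, hT, hF⟩

theorem M_continuousOn {p : ℕ} (lam : 𝒯.M p) {T F : Finset (Pt d)} (hT : T ∈ 𝒯.cells)
    (hF : F ∈ facets T) : ContinuousOn ((lam : Finset (Pt d) → Pt d → ℝ) F) (hull F) := by
  obtain ⟨P, -, hP⟩ := lam.2.1 F (𝒯.isFace hT hF)
  rw [hP]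
  exact (continuous_val P).continuousOn.congr fun x hx => Set.indicator_of_mem hx _

theorem M_eq_zero_of_frontier {p : ℕ} (lam : 𝒯.M p) {F : Finset (Pt d)} (hF : 𝒯.IsFace F)
    (h : hull F ⊆ frontier Ω) : (lam : Finset (Pt d) → Pt d → ℝ) F = 0 := lam.2.2.1 F hF h

end SimplicialMesh

/-! ### Linearity of the local solvers -/

theorem IsLocalSolution.comb {V : Submodule ℝ (Poly d)} {W : Submodule ℝ (Fin d → Poly d)} {τ : ℝ}
    {T : Finset (Pt d)} (hT : IsSimplex T) (hd : 1 ≤ d) {l₁ l₂ : Finset (Pt d) → Pt d → ℝ}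
    (hl₁ : BdryCont T l₁) (hl₂ : BdryCont T l₂)
    {u₁ u₂ : Poly d} {q₁ q₂ : Fin d → Poly d} (h₁ : IsLocalSolution V W τ T l₁ u₁ q₁)
    (h₂ : IsLocalSolution V W τ T l₂ u₂ q₂) (a b : ℝ) :
    IsLocalSolution V W τ T (a • l₁ + b • l₂) (a • u₁ + b • u₂) (a • q₁ + b • q₂) := by
  have cv : ∀ u : Poly d, ∀ s, ContinuousOn (val u) s := fun u s => (continuous_val u).continuousOn
  have ci : ∀ (q : Fin d → Poly d) (n : Pt d) s, ContinuousOn (fun x => inner ℝ (vecVal q x) n) s :=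
    fun q n s => ((continuous_vecVal q).inner continuous_const).continuousOn
  refine ⟨add_mem (V.smul_mem a h₁.mem_V) (V.smul_mem b h₂.mem_V),
    add_mem (W.smul_mem a h₁.mem_W) (W.smul_mem b h₂.mem_W), fun r hr => ?_, fun v hv => ?_⟩
  · have e1 : ∫ x in hull T, inner ℝ (vecVal (a • q₁ + b • q₂) x) (vecVal r x) =
        a * (∫ x in hull T, inner ℝ (vecVal q₁ x) (vecVal r x)) +
        b * ∫ x in hull T, inner ℝ (vecVal q₂ x) (vecVal r x) := by
      rw [← integral_const_mul, ← integral_const_mul, ← integral_add]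
      · simp_rw [vecVal_add, vecVal_smul, inner_add_left, real_inner_smul_left]
      · exact (integrableOn_hull ((continuous_vecVal _).inner
          (continuous_vecVal _)).continuousOn).const_mul a
      · exact (integrableOn_hull ((continuous_vecVal _).inner
          (continuous_vecVal _)).continuousOn).const_mul b
    have e2 : ∫ x in hull T, val (a • u₁ + b • u₂) x * val (polyDiv r) x =
        a * (∫ x in hull T, val u₁ x * val (polyDiv r) x) +
        b * ∫ x in hull T, val u₂ x * val (polyDiv r) x := by
      rw [← integral_const_mul, ← integral_const_mul, ← integral_add]
      · simp_rw [val_add, val_smul, add_mul, mul_assoc]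
      · exact (integrableOn_hull ((cv _ _).mul (cv _ _))).const_mul a
      · exact (integrableOn_hull ((cv _ _).mul (cv _ _))).const_mul b
    have e3 : bdryIntegral T (fun F x => (a • l₁ + b • l₂) F x *
          inner ℝ (vecVal r x) (outerNormal T F)) =
        a * bdryIntegral T (fun F x => l₁ F x * inner ℝ (vecVal r x) (outerNormal T F)) +
        b * bdryIntegral T (fun F x => l₂ F x * inner ℝ (vecVal r x) (outerNormal T F)) := by
      refine bdryIntegral_eq_comb hT hd
        (fun F hF => (hl₁ F hF).mul (ci r _ _))
        (fun F hF => (hl₂ F hF).mul (ci r _ _)) fun F _ x _ => ?_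
      simp only [Pi.add_apply, Pi.mul_apply, Pi.smul_apply, smul_eq_mul]
      ring
    rw [e1, e2, e3]
    linear_combination a * h₁.primary r hr + b * h₂.primary r hr
  · have e1 : ∫ x in hull T, inner ℝ (vecVal (a • q₁ + b • q₂) x) (vecVal (polyGrad v) x) =
        a * (∫ x in hull T, inner ℝ (vecVal q₁ x) (vecVal (polyGrad v) x)) +
        b * ∫ x in hull T, inner ℝ (vecVal q₂ x) (vecVal (polyGrad v) x) := by
      rw [← integral_const_mul, ← integral_const_mul, ← integral_add]
      · simp_rw [vecVal_add, vecVal_smul, inner_add_left, real_inner_smul_left]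
      · exact (integrableOn_hull ((continuous_vecVal _).inner
          (continuous_vecVal _)).continuousOn).const_mul a
      · exact (integrableOn_hull ((continuous_vecVal _).inner
          (continuous_vecVal _)).continuousOn).const_mul b
    have e2 : bdryIntegral T (fun F x => (inner ℝ (vecVal (a • q₁ + b • q₂) x) (outerNormal T F) +
          τ * val (a • u₁ + b • u₂) x) * val v x) =
        a * bdryIntegral T (fun F x =>
          (inner ℝ (vecVal q₁ x) (outerNormal T F) + τ * val u₁ x) * val v x) +
        b * bdryIntegral T (fun F x =>
          (inner ℝ (vecVal q₂ x) (outerNormal T F) + τ * val u₂ x) * val v x) := by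
      refine bdryIntegral_eq_comb hT hd
        (fun F hF => ((ci q₁ _ _).add (continuousOn_const.mul (cv _ _))).mul (cv _ _))
        (fun F hF => ((ci q₂ _ _).add (continuousOn_const.mul (cv _ _))).mul (cv _ _)) fun F _ x _ => ?_
      simp only [vecVal_add, vecVal_smul, inner_add_left, real_inner_smul_left, val_add, val_smul,
        Pi.add_apply, Pi.mul_apply]
      ring
    have e3 : bdryIntegral T (fun F x => (a • l₁ + b • l₂) F x * val v x) =
        a * bdryIntegral T (fun F x => l₁ F x * val v x) +
        b * bdryIntegral T (fun F x => l₂ F x * val v x) := by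
      refine bdryIntegral_eq_comb hT hd
        (fun F hF => (hl₁ F hF).mul (cv _ _))
        (fun F hF => (hl₂ F hF).mul (cv _ _)) fun F _ x _ => ?_
      simp only [Pi.add_apply, Pi.mul_apply, Pi.smul_apply, smul_eq_mul]
      ring
    rw [e1, e2, e3]
    linear_combination a * h₁.flux v hv + b * h₂.flux v hv

namespace Method

variable {Ω : Set (Pt d)} {𝒯 : SimplicialMesh d Ω} {p k : ℕ} (S : Method 𝒯 p k)

theorem isLocalSolution {T : Finset (Pt d)} (hT : T ∈ 𝒯.cells) (lam : 𝒯.M p) :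
    IsLocalSolution (S.V T) (S.W T) S.τ T lam (S.U lam T) (S.Q lam T) := by
  have := (S.solvable T hT lam lam.2).choose_spec.1
  simpa [U, Q, sol, hT] using this

theorem eq_of_isLocalSolution {T : Finset (Pt d)} (hT : T ∈ 𝒯.cells) (lam : 𝒯.M p)
    {u : Poly d} {q : Fin d → Poly d} (h : IsLocalSolution (S.V T) (S.W T) S.τ T lam u q) :
    u = S.U lam T ∧ q = S.Q lam T := by
  have := (S.solvable T hT lam lam.2).unique (y₁ := (u, q)) (y₂ := (S.U lam T, S.Q lam T)) h
    (S.isLocalSolution hT lam)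
  exact Prod.mk.inj this

/-- The local solution is chosen separately for each `λ`; linearity holds because the combination
solves the problem with the combined data and solutions are unique. -/
theorem comb (hd : 1 ≤ d) {T : Finset (Pt d)} (hT : T ∈ 𝒯.cells) (lam mu : 𝒯.M p) (a b : ℝ) :
    a • S.U lam T + b • S.U mu T = S.U (a • lam + b • mu) T ∧
      a • S.Q lam T + b • S.Q mu T = S.Q (a • lam + b • mu) T :=
  S.eq_of_isLocalSolution hT _ (by
    have := (S.isLocalSolution hT lam).comb (𝒯.isSimplex hT) hd
      (fun F hF => 𝒯.M_continuousOn lam hT hF) (fun F hF => 𝒯.M_continuousOn mu hT hF)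
      (S.isLocalSolution hT mu) a b
    simpa using this)

theorem U_comb (hd : 1 ≤ d) {T : Finset (Pt d)} (hT : T ∈ 𝒯.cells) (lam mu : 𝒯.M p) (a b : ℝ)
    (x : Pt d) :
    val (S.U (a • lam + b • mu) T) x = a * val (S.U lam T) x + b * val (S.U mu T) x := by
  rw [← (S.comb hd hT lam mu a b).1, val_add, val_smul, val_smul]

theorem Q_comb (hd : 1 ≤ d) {T : Finset (Pt d)} (hT : T ∈ 𝒯.cells) (lam mu : 𝒯.M p) (a b : ℝ)
    (x : Pt d) :
    vecVal (S.Q (a • lam + b • mu) T) x = a • vecVal (S.Q lam T) x + b • vecVal (S.Q mu T) x := by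
  rw [← (S.comb hd hT lam mu a b).2, vecVal_add, vecVal_smul, vecVal_smul]

theorem jump_comb (hd : 1 ≤ d) {T : Finset (Pt d)} (hT : T ∈ 𝒯.cells) (lam mu : 𝒯.M p) (a b : ℝ)
    (F : Finset (Pt d)) (x : Pt d) :
    S.jump (a • lam + b • mu) T F x = a * S.jump lam T F x + b * S.jump mu T F x := by
  simp only [jump, S.U_comb hd hT]
  simp
  ring

theorem jump_continuousOn (lam : 𝒯.M p) {T F : Finset (Pt d)} (hT : T ∈ 𝒯.cells)
    (hF : F ∈ facets T) : ContinuousOn (S.jump lam T F) (hull F) :=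
  (continuous_val _).continuousOn.sub (𝒯.M_continuousOn lam hT hF)

theorem normQ_nonneg (lam : 𝒯.M p) : 0 ≤ S.normQ lam := l2norm_nonneg _ _

theorem normQ_sq (hΩ : IsLipschitzDomain Ω) (lam : 𝒯.M p) :
    S.normQ lam ^ 2 = ∑ T ∈ 𝒯.cells, ∫ x in hull T, ‖vecVal (S.Q lam T) x‖ ^ 2 :=
  𝒯.l2norm_vecFn_sq hΩ _

theorem a_eq (hΩ : IsLipschitzDomain Ω) (lam mu : 𝒯.M p) :
    S.a lam mu = ∑ T ∈ 𝒯.cells,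
      ((∫ x in hull T, inner ℝ (vecVal (S.Q lam T) x) (vecVal (S.Q mu T) x)) +
        bdryIntegral T (fun F x => S.τ * S.jump lam T F x * S.jump mu T F x)) := by
  rw [a, Finset.sum_add_distrib]
  congr 1
  refine 𝒯.integral_eq_sum hΩ (fun T _ => (continuous_vecVal _).inner (continuous_vecVal _))
    fun T hT x hx => ?_
  rw [𝒯.vecFn_eq _ hT hx, 𝒯.vecFn_eq _ hT hx]

theorem a_symm (lam mu : 𝒯.M p) : S.a lam mu = S.a mu lam := by
  rw [a, a]
  congr 1
  · simp_rw [real_inner_comm]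
  · refine Finset.sum_congr rfl fun T _ => bdryIntegral_congr fun F _ x _ => by ring

theorem a_comb (hd : 1 ≤ d) (hΩ : IsLipschitzDomain Ω) (lam₁ lam₂ mu : 𝒯.M p) (s t : ℝ) :
    S.a (s • lam₁ + t • lam₂) mu = s * S.a lam₁ mu + t * S.a lam₂ mu := by
  rw [S.a_eq hΩ, S.a_eq hΩ, S.a_eq hΩ, Finset.mul_sum, Finset.mul_sum, ← Finset.sum_add_distrib]
  refine Finset.sum_congr rfl fun T hT => ?_
  have e1 : ∫ x in hull T, inner ℝ (vecVal (S.Q (s • lam₁ + t • lam₂) T) x) (vecVal (S.Q mu T) x) =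
      s * (∫ x in hull T, inner ℝ (vecVal (S.Q lam₁ T) x) (vecVal (S.Q mu T) x)) +
      t * ∫ x in hull T, inner ℝ (vecVal (S.Q lam₂ T) x) (vecVal (S.Q mu T) x) := by
    rw [← integral_const_mul, ← integral_const_mul, ← integral_add]
    · simp_rw [S.Q_comb hd hT, inner_add_left, real_inner_smul_left]
    · exact (integrableOn_hull ((continuous_vecVal _).inner
          (continuous_vecVal _)).continuousOn).const_mul s
    · exact (integrableOn_hull ((continuous_vecVal _).inner
          (continuous_vecVal _)).continuousOn).const_mul t
  have e2 : bdryIntegral T (fun F x =>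
        S.τ * S.jump (s • lam₁ + t • lam₂) T F x * S.jump mu T F x) =
      s * bdryIntegral T (fun F x => S.τ * S.jump lam₁ T F x * S.jump mu T F x) +
      t * bdryIntegral T (fun F x => S.τ * S.jump lam₂ T F x * S.jump mu T F x) := by
    refine bdryIntegral_eq_comb (𝒯.isSimplex hT) hd
      (fun F hF => (continuousOn_const.mul (S.jump_continuousOn lam₁ hT hF)).mul
        (S.jump_continuousOn mu hT hF))
      (fun F hF => (continuousOn_const.mul (S.jump_continuousOn lam₂ hT hF)).mul
        (S.jump_continuousOn mu hT hF)) fun F _ x _ => ?_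
    simp only [S.jump_comb hd hT, Pi.mul_apply]
    ring
  rw [e1, e2]
  ring

/-- The condensed bilinear form as a bilinear map. -/
def aForm (hd : 1 ≤ d) (hΩ : IsLipschitzDomain Ω) : LinearMap.BilinForm ℝ (𝒯.M p) :=
  LinearMap.mk₂ ℝ S.a
    (fun l₁ l₂ m => by simpa using S.a_comb hd hΩ l₁ l₂ m 1 1)
    (fun c l m => by simpa using S.a_comb hd hΩ l l m c 0)
    (fun m l₁ l₂ => by
      rw [S.a_symm m, S.a_symm m, S.a_symm m]; simpa using S.a_comb hd hΩ l₁ l₂ m 1 1)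
    (fun c m l => by
      rw [S.a_symm m, S.a_symm m]; simpa using S.a_comb hd hΩ l l m c 0)

theorem a_self (hΩ : IsLipschitzDomain Ω) (lam : 𝒯.M p) :
    S.a lam lam = S.normQ lam ^ 2 +
      S.τ * ∑ T ∈ 𝒯.cells, bdryIntegral T (fun F x => S.jump lam T F x ^ 2) := by
  rw [S.normQ_sq hΩ, S.a_eq hΩ, Finset.sum_add_distrib, Finset.mul_sum]
  congr 1
  · simp_rw [real_inner_self_eq_norm_sq]
  · refine Finset.sum_congr rfl fun T _ => ?_
    rw [← bdryIntegral_const_mul]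
    exact bdryIntegral_congr fun F _ x _ => by ring

theorem normQ_sq_le_a (hΩ : IsLipschitzDomain Ω) (lam : 𝒯.M p) :
    S.normQ lam ^ 2 ≤ S.a lam lam := by
  rw [S.a_self hΩ]
  have : 0 ≤ S.τ * ∑ T ∈ 𝒯.cells, bdryIntegral T (fun F x => S.jump lam T F x ^ 2) :=
    mul_nonneg S.τ_nonneg (Finset.sum_nonneg fun T _ =>
      bdryIntegral_nonneg fun _ _ _ _ => sq_nonneg _)
  linarith

/-- Cauchy–Schwarz for a symmetric positive semidefinite form. -/
theorem a_sq_le (hd : 1 ≤ d) (hΩ : IsLipschitzDomain Ω) (lam mu : 𝒯.M p) :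
    S.a lam mu ^ 2 ≤ S.a lam lam * S.a mu mu :=
  LinearMap.BilinForm.apply_sq_le_of_symm (S.aForm hd hΩ)
    (fun l => (sq_nonneg _).trans (S.normQ_sq_le_a hΩ l)) ⟨fun l m => S.a_symm l m⟩ lam mu

theorem vecFn_Q_add (hd : 1 ≤ d) (lam mu : 𝒯.M p) :
    𝒯.vecFn (S.Q (lam + mu)) =ᵐ[volume.restrict Ω] 𝒯.vecFn (S.Q lam) + 𝒯.vecFn (S.Q mu) := by
  filter_upwards [𝒯.ae_mem_interior] with x ⟨T, hT, hx⟩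
  have := S.Q_comb hd hT lam mu 1 1 x
  simp only [one_smul] at this
  rw [Pi.add_apply, 𝒯.vecFn_eq _ hT hx, 𝒯.vecFn_eq _ hT hx, 𝒯.vecFn_eq _ hT hx, this]

theorem fn_U_add (hd : 1 ≤ d) (lam mu : 𝒯.M p) :
    𝒯.fn (S.U (lam + mu)) =ᵐ[volume.restrict Ω] 𝒯.fn (S.U lam) + 𝒯.fn (S.U mu) := by
  filter_upwards [𝒯.ae_mem_interior] with x ⟨T, hT, hx⟩
  have := S.U_comb hd hT lam mu 1 1 x
  simp only [one_smul, one_mul] at this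
  rw [Pi.add_apply, 𝒯.fn_eq _ hT hx, 𝒯.fn_eq _ hT hx, 𝒯.fn_eq _ hT hx, this]

theorem normQ_add_le (hd : 1 ≤ d) (lam mu : 𝒯.M p) :
    S.normQ (lam + mu) ≤ S.normQ lam + S.normQ mu := by
  rw [normQ, l2norm_congr (S.vecFn_Q_add hd lam mu)]
  exact l2norm_add_le (𝒯.memLp_vecFn _) (𝒯.memLp_vecFn _)

theorem normQ_neg (hd : 1 ≤ d) (lam : 𝒯.M p) : S.normQ (-lam) = S.normQ lam := by
  have : 𝒯.vecFn (S.Q (-lam)) =ᵐ[volume.restrict Ω] -𝒯.vecFn (S.Q lam) := by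
    filter_upwards [𝒯.ae_mem_interior] with x ⟨T, hT, hx⟩
    have h1 : -lam = (-1 : ℝ) • lam + (0 : ℝ) • lam := by module
    have := S.Q_comb hd hT lam lam (-1) 0 x
    rw [← h1] at this
    simp only [neg_smul, one_smul, zero_smul, add_zero] at this
    rw [Pi.neg_apply, 𝒯.vecFn_eq _ hT hx, 𝒯.vecFn_eq _ hT hx, this]
  rw [normQ, l2norm_congr this, l2norm_neg, normQ]

end Method

theorem normM_nonneg {Ω : Set (Pt d)} {𝒯 : SimplicialMesh d Ω} {p : ℕ} (lam : 𝒯.M p) :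
    0 ≤ normM lam := Real.sqrt_nonneg _

/-! ### A criterion for membership in `H¹₀` -/

theorem tendsto_eLpNorm_of_bounded {α F : Type*} [MeasurableSpace α] {μ : Measure α}
    [IsFiniteMeasure μ] [NormedAddCommGroup F] {f : ℕ → α → F} {C : ℝ}
    (hf : ∀ n, AEStronglyMeasurable (f n) μ) (hC : ∀ n x, ‖f n x‖ ≤ C)
    (h : ∀ᵐ x ∂μ, Tendsto (fun n => f n x) atTop (𝓝 0)) :
    Tendsto (fun n => eLpNorm (f n) 2 μ) atTop (𝓝 0) := by
  have h1 : Tendsto (fun n => ∫⁻ x, ‖f n x‖ₑ ^ (2 : ℝ) ∂μ) atTop (𝓝 (∫⁻ _, 0 ∂μ)) := by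
    refine tendsto_lintegral_of_dominated_convergence' (fun _ => ENNReal.ofReal C ^ (2 : ℝ))
      (fun n => (hf n).enorm.pow_const _) (fun n => Eventually.of_forall fun x => ?_) ?_ ?_
    · refine ENNReal.rpow_le_rpow ?_ (by norm_num)
      rw [← ofReal_norm]
      exact ENNReal.ofReal_le_ofReal (hC n x)
    · rw [lintegral_const]
      exact ENNReal.mul_ne_top (ENNReal.rpow_ne_top_of_nonneg (by norm_num) ENNReal.ofReal_ne_top)
        (measure_ne_top _ _)
    · filter_upwards [h] with x hx
      have h2 := (ENNReal.continuous_rpow_const (y := (2 : ℝ))).continuousAt.tendsto.comp hx.enorm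
      simpa [Function.comp_def] using h2
  have h2 := (ENNReal.continuous_rpow_const (y := (1 / 2 : ℝ))).continuousAt.tendsto.comp h1
  have h3 : ∀ n, eLpNorm (f n) 2 μ = (∫⁻ x, ‖f n x‖ₑ ^ (2 : ℝ) ∂μ) ^ (1 / 2 : ℝ) := fun n => by
    rw [eLpNorm_eq_lintegral_rpow_enorm_toReal (by norm_num) (by norm_num)]; simp
  simp_rw [h3]
  simpa [Function.comp_def] using h2

/-- Soft thresholding. -/
def soft (ε s : ℝ) : ℝ := s - max (-ε) (min ε s)

theorem soft_lipschitz (ε : ℝ) : LipschitzWith 2 (soft ε) := by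
  have h : LipschitzWith 1 (fun s : ℝ => max (-ε) (min ε s)) := by
    simpa using (LipschitzWith.id.const_min ε).const_max (-ε)
  have h2 := (LipschitzWith.id (α := ℝ)).sub h
  rwa [one_add_one_eq_two] at h2

theorem soft_of_abs_le {ε s : ℝ} (h : |s| ≤ ε) : soft ε s = 0 := by
  rw [abs_le] at h
  rw [soft, min_eq_right h.2, max_eq_right h.1, sub_self]

theorem soft_of_lt {ε s : ℝ} (hε : 0 ≤ ε) (h : ε ≤ s) : soft ε s = s - ε := by
  rw [soft, min_eq_left h, max_eq_right (by linarith)]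

theorem soft_of_lt_neg {ε s : ℝ} (hε : 0 ≤ ε) (h : s ≤ -ε) : soft ε s = s + ε := by
  rw [soft, min_eq_right (by linarith), max_eq_left h]; ring

theorem abs_soft_sub_le {ε : ℝ} (hε : 0 ≤ ε) (s : ℝ) : |soft ε s - s| ≤ ε := by
  have h1 : -ε ≤ max (-ε) (min ε s) := le_max_left _ _
  have h2 : max (-ε) (min ε s) ≤ ε := max_le (by linarith) (min_le_left _ _)
  rw [soft, abs_le]
  constructor <;> linarith

/-- A mollifier of radius `r` (for positive `r`). -/
def moll (d : ℕ) (r : ℝ) (hr : 0 < r) : ContDiffBump (0 : Pt d) :=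
  ⟨r / 2, r, by positivity, by linarith⟩

/-- Mollification. -/
def smooth (r : ℝ) (hr : 0 < r) (g : Pt d → ℝ) : Pt d → ℝ :=
  convolution ((moll d r hr).normed volume) g (ContinuousLinearMap.lsmul ℝ ℝ) volume

theorem contDiff_smooth {r : ℝ} (hr : 0 < r) {g : Pt d → ℝ} (hg : Continuous g) :
    ContDiff ℝ ∞ (smooth r hr g) :=
  (moll d r hr).hasCompactSupport_normed.contDiff_convolution_left _
    (moll d r hr).contDiff_normed hg.locallyIntegrable

theorem smooth_apply {r : ℝ} (hr : 0 < r) (g : Pt d → ℝ) (x : Pt d) :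
    smooth r hr g x = ∫ t, (moll d r hr).normed volume t * g (x - t) := by
  rw [smooth, convolution_def]; rfl

theorem abs_smooth_sub_le {r : ℝ} (hr : 0 < r) {g : Pt d → ℝ} (hg : Continuous g) {x : Pt d} {ε : ℝ}
    (h : ∀ y ∈ Metric.ball x r, |g y - g x| ≤ ε) : |smooth r hr g x - g x| ≤ ε :=
  (moll d r hr).dist_normed_convolution_le (μ := volume) hg.aestronglyMeasurable h

theorem smooth_eq_zero {r : ℝ} (hr : 0 < r) {g : Pt d → ℝ} {x : Pt d}
    (h : ∀ y ∈ Metric.ball x r, g y = 0) : smooth r hr g x = 0 := by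
  have hx : g x = 0 := h x (Metric.mem_ball_self hr)
  have := (moll d r hr).normed_convolution_eq_right (μ := volume) (g := g) (x₀ := x)
    (fun y hy => by rw [h y hy, hx])
  rw [hx] at this
  exact this

theorem integrable_moll_mul {r : ℝ} (hr : 0 < r) {g : Pt d → ℝ} (hg : Continuous g) (x : Pt d) :
    Integrable (fun t => (moll d r hr).normed volume t * g (x - t)) := by
  refine Continuous.integrable_of_hasCompactSupport
    ((moll d r hr).continuous_normed.mul (hg.comp (continuous_const.sub continuous_id))) ?_
  exact (moll d r hr).hasCompactSupport_normed.mul_right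

theorem smooth_sub {r : ℝ} (hr : 0 < r) {g : Pt d → ℝ} (hg : Continuous g) (x y : Pt d) :
    smooth r hr g x - smooth r hr g y =
      ∫ t, (moll d r hr).normed volume t * (g (x - t) - g (y - t)) := by
  rw [smooth_apply, smooth_apply, ← integral_sub (integrable_moll_mul hr hg x)
    (integrable_moll_mul hr hg y)]
  simp_rw [mul_sub]

theorem smooth_lipschitz {r : ℝ} (hr : 0 < r) {g : Pt d → ℝ} {K : ℝ≥0} (hg : LipschitzWith K g) :
    LipschitzWith K (smooth r hr g) := by
  refine LipschitzWith.of_dist_le_mul fun x y => ?_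
  rw [Real.dist_eq, smooth_sub hr hg.continuous]
  have h1 : ∫ t, (moll d r hr).normed volume t * (K * dist x y) = K * dist x y := by
    rw [integral_mul_const, (moll d r hr).integral_normed, one_mul]
  rw [← Real.norm_eq_abs]
  conv_rhs => rw [← h1]
  refine norm_integral_le_of_norm_le ((moll d r hr).integrable_normed.mul_const _)
    (Eventually.of_forall fun t => ?_)
  rw [norm_mul, Real.norm_of_nonneg ((moll d r hr).nonneg_normed t)]
  refine mul_le_mul_of_nonneg_left ?_ ((moll d r hr).nonneg_normed t)
  have := hg.dist_le_mul (x - t) (y - t)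
  rwa [dist_sub_right, Real.dist_eq] at this

/-- Mollification does not change the increments of functions which are affine near a point. -/
theorem smooth_sub_of_affine {r : ℝ} (hr : 0 < r) {g : Pt d → ℝ} (hg : Continuous g)
    (f : Pt d →ᵃ[ℝ] ℝ) {x z : Pt d} (hx : ∀ y ∈ Metric.ball x r, g y = f y)
    (hz : ∀ y ∈ Metric.ball z r, g y = f y) :
    smooth r hr g z - smooth r hr g x = f z - f x := by
  have h1 : ∀ t, (moll d r hr).normed volume t * (g (z - t) - g (x - t)) =
      (moll d r hr).normed volume t * (f z - f x) := by
    intro t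
    by_cases ht : t ∈ Metric.ball (0 : Pt d) r
    · rw [mem_ball_zero_iff] at ht
      rw [hx (x - t) (by rw [Metric.mem_ball, dist_eq_norm]; simpa using ht),
        hz (z - t) (by rw [Metric.mem_ball, dist_eq_norm]; simpa using ht)]
      have h2 : ∀ a b : Pt d, f a - f b = f.linear (a - b) := fun a b => (f.linearMap_vsub a b).symm
      rw [h2, h2, sub_sub_sub_cancel_right]
    · have : t ∉ Function.support ((moll d r hr).normed (volume : Measure (Pt d))) := by
        rw [(moll d r hr).support_normed_eq]; exact ht
      rw [Function.notMem_support.1 this, zero_mul, zero_mul]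
  rw [smooth_sub hr hg]
  simp_rw [h1]
  rw [integral_mul_const, (moll d r hr).integral_normed, one_mul]

/-- Near a point where `w` is affine, and either nonzero or locally zero, soft thresholding with
a small parameter only changes `w` by a constant. -/
theorem eventually_soft_eq {w : Pt d → ℝ} (hw : Continuous w) {x : Pt d}
    (hx : w x ≠ 0 ∨ ∀ᶠ y in 𝓝 x, w y = 0) :
    ∃ U ∈ 𝓝 x, ∃ ε₀ > 0, ∀ ε, 0 ≤ ε → ε ≤ ε₀ → ∃ c : ℝ, ∀ y ∈ U, soft ε (w y) = w y + c := by
  rcases hx with hx | hx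
  · rcases lt_or_gt_of_ne hx with h | h
    · refine ⟨{y | w y < w x / 2}, hw.continuousAt.eventually_lt_const (by linarith), -(w x / 2),
        by linarith, fun ε h0 h1 => ⟨ε, fun y hy => soft_of_lt_neg h0 ?_⟩⟩
      have : w y < w x / 2 := hy
      linarith
    · refine ⟨{y | w x / 2 < w y}, hw.continuousAt.eventually_const_lt (by linarith), w x / 2,
        by linarith, fun ε h0 h1 => ⟨-ε, fun y hy => ?_⟩⟩
      have : w x / 2 < w y := hy
      rw [soft_of_lt h0 (by linarith)]; ring
  · refine ⟨{y | w y = 0}, hx, 1, one_pos, fun ε h0 _ => ⟨0, fun y hy => ?_⟩⟩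
    have : w y = 0 := hy
    rw [this, soft_of_abs_le (by simpa using h0), add_zero]

theorem norm_gradient_le {f : Pt d → ℝ} {K : ℝ≥0} (hf : LipschitzWith K f) (x : Pt d) :
    ‖∇ f x‖ ≤ K := by
  rw [gradient, LinearIsometryEquiv.norm_map]
  exact norm_fderiv_le_of_lipschitz ℝ hf

theorem measurable_gradient (f : Pt d → ℝ) : Measurable (∇ f) :=
  (InnerProductSpace.toDual ℝ (Pt d)).symm.continuous.measurable.comp (measurable_fderiv ℝ f)

/-- Soft thresholding moves the support of `w` into the interior of `Ω`, and mollification makes the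
result smooth. At almost every point the approximants eventually differ from `w` only by a constant
near that point, so their gradients there equal `∇ w`; the Lipschitz bounds allow dominated
convergence. The alternative in `haff` excludes points where the thresholding would change the slope
for every parameter. -/
theorem memH10_of_lipschitz {Ω : Set (Pt d)} (hb : Bornology.IsBounded Ω)
    {w : Pt d → ℝ} {K : ℝ≥0} (hw : LipschitzWith K w) (h0 : ∀ x ∉ Ω, w x = 0)
    (haff : ∀ᵐ x ∂(volume.restrict Ω), (∃ f : Pt d →ᵃ[ℝ] ℝ, ∀ᶠ y in 𝓝 x, w y = f y) ∧
      (w x ≠ 0 ∨ ∀ᶠ y in 𝓝 x, w y = 0)) : MemH10 Ω w := by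
  have : IsFiniteMeasure (volume.restrict Ω) := ⟨by simpa using hb.measure_lt_top⟩
  have hwc := hw.continuous
  obtain ⟨B, hB⟩ : ∃ B, ∀ x, ‖w x‖ ≤ B := by
    obtain ⟨B, hB⟩ := (hb.isCompact_closure).exists_bound_of_continuousOn hwc.continuousOn
    refine ⟨max B 0, fun x => ?_⟩
    by_cases hx : x ∈ Ω
    · exact (hB x (subset_closure hx)).trans (le_max_left _ _)
    · rw [h0 x hx, norm_zero]; exact le_max_right _ _
  set ε : ℕ → ℝ := fun n => 1 / ((n : ℝ) + 1) with hε
  have hε0 : ∀ n, 0 < ε n := fun n => by positivity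
  have hε1 : Tendsto ε atTop (𝓝 0) := tendsto_one_div_add_atTop_nhds_zero_nat
  -- With `K r n ≤ ε n / 2`, mollification moves the `2K`-Lipschitz function `g n` by at most `ε n`,
  -- and vanishes wherever `|w| < ε n / 2`.
  set r : ℕ → ℝ := fun n => ε n / (2 * (K + 1)) with hr
  have hr0 : ∀ n, 0 < r n := fun n => by have := hε0 n; positivity
  have hr1 : Tendsto r atTop (𝓝 0) := by simpa using hε1.div_const (2 * ((K : ℝ) + 1))
  have hrε : ∀ n, K * r n ≤ ε n / 2 := fun n => by
    have h1 : r n * (2 * (K + 1)) = ε n := div_mul_cancel₀ _ (by positivity)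
    have := hr0 n
    nlinarith
  set g : ℕ → Pt d → ℝ := fun n x => soft (ε n) (w x) with hg
  have hgl : ∀ n, LipschitzWith (2 * K) (g n) := fun n => (soft_lipschitz _).comp hw
  have hgc : ∀ n, Continuous (g n) := fun n => (hgl n).continuous
  set φ : ℕ → Pt d → ℝ := fun n => smooth (r n) (hr0 n) (g n) with hφ
  have hφw : ∀ n x, ‖φ n x - w x‖ ≤ 2 * ε n := by
    intro n x
    have h1 : |φ n x - g n x| ≤ ε n := by
      refine abs_smooth_sub_le (hr0 n) (hgc n) fun y hy => ?_
      have h2 := (hgl n).dist_le_mul y x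
      rw [Real.dist_eq] at h2
      have h3 : dist y x ≤ r n := (Metric.mem_ball.1 hy).le
      have h4 := hrε n
      have h5 : (0 : ℝ) ≤ K := K.2
      push_cast at h2
      nlinarith
    have h2 := abs_soft_sub_le (hε0 n).le (w x)
    calc ‖φ n x - w x‖ = |(φ n x - g n x) + (g n x - w x)| := by rw [Real.norm_eq_abs]; ring_nf
      _ ≤ |φ n x - g n x| + |g n x - w x| := abs_add_le _ _
      _ ≤ 2 * ε n := by linarith
  have hsupp : ∀ n, tsupport (φ n) ⊆ {x | ε n / 2 ≤ |w x|} := by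
    intro n
    refine closure_minimal ?_ (isClosed_le continuous_const hwc.abs)
    intro x hx
    by_contra hlt
    rw [Set.mem_ofPred_eq, not_le] at hlt
    refine hx (smooth_eq_zero (hr0 n) fun y hy => soft_of_abs_le ?_)
    have h2 := hw.dist_le_mul y x
    rw [Real.dist_eq] at h2
    have h3 : dist y x ≤ r n := (Metric.mem_ball.1 hy).le
    have h4 := hrε n
    have h5 : (0 : ℝ) ≤ K := K.2
    have h6 : |w y| ≤ |w y - w x| + |w x| := by
      simpa using abs_add_le (w y - w x) (w x)
    nlinarith
  have hsuppΩ : ∀ n, tsupport (φ n) ⊆ Ω := by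
    intro n x hx
    by_contra hxΩ
    have := hsupp n hx
    rw [Set.mem_ofPred_eq, h0 x hxΩ, abs_zero] at this
    have := hε0 n
    linarith
  have hφd : ∀ n, ContDiff ℝ ∞ (φ n) := fun n => contDiff_smooth (hr0 n) (hgc n)
  refine ⟨MemLp.of_bound hwc.aestronglyMeasurable B (Eventually.of_forall hB), ∇ w,
    MemLp.of_bound (measurable_gradient w).aestronglyMeasurable K
      (Eventually.of_forall (norm_gradient_le hw)), φ, fun n => ⟨hφd n, ?_, hsuppΩ n⟩, ?_, ?_⟩
  · exact Metric.isCompact_of_isClosed_isBounded (isClosed_tsupport _) (hb.subset (hsuppΩ n))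
  · refine tendsto_eLpNorm_of_bounded (C := 2)
      (fun n => ((hφd n).continuous.sub hwc).aestronglyMeasurable) (fun n x => ?_)
      (Eventually.of_forall fun x => ?_)
    · refine (hφw n x).trans ?_
      have : ε n ≤ 1 := by
        rw [hε]; simp only; rw [div_le_one (by positivity)]; linarith [Nat.cast_nonneg (α := ℝ) n]
      linarith
    · exact squeeze_zero_norm (fun n => hφw n x) (by simpa using hε1.const_mul 2)
  · refine tendsto_eLpNorm_of_bounded (C := 3 * K)
      (fun n => ((measurable_gradient _).sub (measurable_gradient w)).aestronglyMeasurable)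
      (fun n x => ?_) ?_
    · have h1 := norm_gradient_le (smooth_lipschitz (hr0 n) (hgl n)) x
      have h2 := norm_gradient_le hw x
      push_cast at h1
      calc _ ≤ ‖∇ (φ n) x‖ + ‖∇ w x‖ := norm_sub_le _ _
        _ ≤ 3 * K := by linarith
    · filter_upwards [haff] with x hx
      obtain ⟨⟨f, hf⟩, hx⟩ := hx
      obtain ⟨U, hU, ε₀, hε₀, hs⟩ := eventually_soft_eq hwc hx
      obtain ⟨δ, hδ, hball⟩ := Metric.mem_nhds_iff.1 (Filter.inter_mem hU hf)
      refine tendsto_const_nhds.congr' ?_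
      have e1 : ∀ᶠ n in atTop, ε n < ε₀ := hε1.eventually_lt_const hε₀
      have e2 : ∀ᶠ n in atTop, r n < δ / 2 := hr1.eventually_lt_const (by positivity)
      filter_upwards [e1, e2] with n h1 h2
      obtain ⟨c, hc⟩ := hs (ε n) (hε0 n).le h1.le
      have hgf : ∀ y ∈ Metric.ball x δ, g n y = (f + AffineMap.const ℝ (Pt d) c) y := by
        intro y hy
        have h3 := hball hy
        rw [hg]; simp only
        rw [hc y h3.1]
        have h4 : w y = f y := h3.2
        rw [h4]; rfl
      -- On the ball of radius `δ` the thresholded function is affine with the slope of `w`; as `r n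
      -- < δ / 2`, mollification preserves its increments on the half ball.
      have hev : φ n =ᶠ[𝓝 x] fun z => w z + (φ n x - w x) := by
        filter_upwards [Metric.ball_mem_nhds x (half_pos hδ)] with z hz
        have hz' := Metric.mem_ball.1 hz
        have := smooth_sub_of_affine (hr0 n) (hgc n) (f + AffineMap.const ℝ (Pt d) c) (x := x) (z := z)
          (fun y hy => hgf y (Metric.ball_subset_ball (by linarith) hy))
          (fun y hy => hgf y (by
            have := Metric.mem_ball.1 hy
            have := dist_triangle y z x
            rw [Metric.mem_ball]; linarith))
        have h5 : w z = f z := (hball (Metric.ball_subset_ball (by linarith) hz)).2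
        have h6 : w x = f x := (hball (Metric.mem_ball_self hδ)).2
        have h7 : φ n z - φ n x = f z - f x := by
          refine this.trans ?_
          simp
        rw [h5, h6]; linarith
      rw [gradient, gradient, hev.fderiv_eq, fderiv_add_const, sub_self]

/-! ### Piecewise linear interpolation -/

/-- The affine function on the simplex `T` with the vertex values `g`. -/
def linInterp (T : Finset (Pt d)) (g : Pt d → ℝ) : Pt d →ᵃ[ℝ] ℝ := ∑ v ∈ T, g v • bary T v

theorem linInterp_apply (T : Finset (Pt d)) (g : Pt d → ℝ) (x : Pt d) :
    linInterp T g x = ∑ v ∈ T, bary T v x * g v := by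
  have h : ∀ s : Finset (Pt d), (∑ v ∈ s, g v • bary T v : Pt d →ᵃ[ℝ] ℝ) x =
      ∑ v ∈ s, bary T v x * g v := by
    classical
    intro s
    induction s using Finset.induction_on with
    | empty => simp
    | insert a s ha ih =>
      rw [Finset.sum_insert ha, Finset.sum_insert ha, ← ih, AffineMap.coe_add, Pi.add_apply,
        AffineMap.coe_smul, Pi.smul_apply, smul_eq_mul, mul_comm]
  exact h T

theorem IsSimplex.linInterp_vertex {T : Finset (Pt d)} (hT : IsSimplex T) (g : Pt d → ℝ) {v : Pt d}
    (hv : v ∈ T) : linInterp T g v = g v := by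
  rw [linInterp_apply, Finset.sum_eq_single v, hT.bary_self hv, one_mul]
  · intro w hw hwv; rw [hT.bary_ne hw hv hwv, zero_mul]
  · intro h; exact absurd hv h

theorem affineMap_eqOn_hull {S : Finset (Pt d)} {f g : Pt d →ᵃ[ℝ] ℝ} (h : ∀ v ∈ S, f v = g v)
    {x : Pt d} (hx : x ∈ hull S) : f x = g x := by
  have : hull S ⊆ (f - g) ⁻¹' {0} := by
    refine convexHull_min ?_ ((convex_singleton 0).affine_preimage _)
    intro v hv
    have := h v hv
    simp [this]
  have h2 : f x - g x = 0 := this hx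
  linarith

theorem affineMap_eq_add (f : Pt d →ᵃ[ℝ] ℝ) (x y : Pt d) : f x - f y = f.linear (x - y) :=
  (f.linearMap_vsub x y).symm

theorem exists_lipschitz_affineMap (f : Pt d →ᵃ[ℝ] ℝ) : ∃ K : ℝ≥0, ∀ x y, |f x - f y| ≤ K * dist x y := by
  refine ⟨‖LinearMap.toContinuousLinearMap f.linear‖₊, fun x y => ?_⟩
  rw [affineMap_eq_add, dist_eq_norm]
  exact (LinearMap.toContinuousLinearMap f.linear).le_opNorm (x - y)

theorem volume_zero_affineMap (f : Pt d →ᵃ[ℝ] ℝ) (hf : ∃ x, f x ≠ 0) :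
    volume {x | f x = 0} = 0 := by
  let s : AffineSubspace ℝ (Pt d) :=
    { carrier := {x | f x = 0}
      smul_vsub_vadd_mem' := fun c p q r hp hq hr => by
        have hp : f p = 0 := hp
        have hq : f q = 0 := hq
        have hr : f r = 0 := hr
        change f (c • (p -ᵥ q) +ᵥ r) = 0
        rw [AffineMap.map_vadd, map_smul, AffineMap.linearMap_vsub, hp, hq, hr]; simp }
  have hs : s ≠ ⊤ := by
    intro h
    obtain ⟨x, hx⟩ := hf
    have : x ∈ s := by rw [h]; trivial
    exact hx this
  exact Measure.addHaar_affineSubspace volume s hs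

/-- A function which is Lipschitz with constant `K` at every point is Lipschitz. -/
theorem lipschitzWith_of_pointwise {w : Pt d → ℝ} {K : ℝ≥0}
    (h : ∀ x, ∀ᶠ y in 𝓝 x, |w y - w x| ≤ K * dist y x) : LipschitzWith K w := by
  have hc : Continuous w := by
    refine continuous_iff_continuousAt.2 fun x => ?_
    rw [ContinuousAt, tendsto_iff_dist_tendsto_zero]
    refine squeeze_zero' (Eventually.of_forall fun _ => dist_nonneg) (h x) ?_
    have : Tendsto (fun y => (K : ℝ) * dist y x) (𝓝 x) (𝓝 (K * dist x x)) :=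
      (continuous_const.mul (continuous_id.dist continuous_const)).continuousAt
    simpa using this
  have key : ∀ x y, w y - w x ≤ K * dist y x := by
    intro x y
    set γ : ℝ → Pt d := fun t => x + t • (y - x) with hγ
    have hγc : Continuous γ := by fun_prop
    have hγd : ∀ s t, dist (γ s) (γ t) = |s - t| * dist y x := by
      intro s t
      rw [dist_eq_norm, dist_eq_norm, hγ]
      simp only [add_sub_add_left_eq_sub, ← sub_smul, norm_smul, Real.norm_eq_abs]
    -- Along the segment from `x` to `y` the right slopes are at most `K * dist y x`, so the
    -- increment is dominated by the linear function with this slope.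
    have := image_le_of_liminf_slope_right_le_deriv_boundary (f := fun t => w (γ t) - w x) (a := 0)
      (b := 1) (B := fun t => (K * dist y x) * t) (B' := fun _ => K * dist y x)
      ((hc.comp hγc).sub continuous_const).continuousOn (by simp [hγ])
      (by fun_prop)
      (fun t _ => by simpa using ((hasDerivAt_id t).const_mul ((K : ℝ) * dist y x)).hasDerivWithinAt)
      (fun t ht ρ hρ => by
        have h1 : ∀ᶠ s in 𝓝[>] t, |w (γ s) - w (γ t)| ≤ K * dist (γ s) (γ t) :=
          (hγc.continuousAt.eventually (h (γ t))).filter_mono nhdsWithin_le_nhds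
        refine Filter.Eventually.frequently ?_
        filter_upwards [h1, self_mem_nhdsWithin] with s hs hst
        have hst : t < s := hst
        refine lt_of_le_of_lt ?_ hρ
        rw [slope_def_field, div_le_iff₀ (by linarith)]
        rw [hγd, abs_of_pos (by linarith : 0 < s - t)] at hs
        have := (abs_le.1 hs).2
        linarith)
      (Set.right_mem_Icc.2 zero_le_one)
    simpa [hγ] using this
  refine LipschitzWith.of_dist_le_mul fun x y => ?_
  rw [Real.dist_eq, abs_le]
  have h1 := key x y
  have h2 := key y x
  rw [dist_comm] at h1
  constructor <;> linarith

namespace SimplicialMesh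

variable {Ω : Set (Pt d)} (𝒯 : SimplicialMesh d Ω)

open Classical in
/-- The piecewise linear function with the vertex values `g`, extended by zero. -/
def interp (g : Pt d → ℝ) (x : Pt d) : ℝ :=
  if h : ∃ T ∈ 𝒯.cells, x ∈ hull T then linInterp h.choose g x else 0

/-- The arbitrary choice of a cell in `interp` is harmless: two cells meet in the hull of their
common vertices, where both affine interpolants agree. -/
theorem interp_eq (g : Pt d → ℝ) {T : Finset (Pt d)} (hT : T ∈ 𝒯.cells) {x : Pt d}
    (hx : x ∈ hull T) : 𝒯.interp g x = linInterp T g x := by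
  classical
  have h : ∃ T ∈ 𝒯.cells, x ∈ hull T := ⟨T, hT, hx⟩
  rw [interp, dif_pos h]
  obtain ⟨hT', hx'⟩ := h.choose_spec
  refine affineMap_eqOn_hull (S := h.choose ∩ T) ?_ ?_
  · intro v hv
    rw [Finset.mem_inter] at hv
    rw [(𝒯.isSimplex hT').linInterp_vertex g hv.1, (𝒯.isSimplex hT).linInterp_vertex g hv.2]
  · rw [← 𝒯.hull_inter_hull hT' hT]; exact ⟨hx', hx⟩

/-- A boundary point lies on a boundary face, all of whose vertices are boundary points; zero vertex
values there give zero on the face. -/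
theorem interp_eq_zero (hΩ : IsLipschitzDomain Ω) {g : Pt d → ℝ}
    (hg : ∀ v ∈ frontier Ω, g v = 0) {x : Pt d} (hx : x ∉ Ω) : 𝒯.interp g x = 0 := by
  by_cases hc : x ∈ closure Ω
  · have hfr : x ∈ frontier Ω := by rw [frontier, hΩ.isOpen.interior_eq]; exact ⟨hc, hx⟩
    obtain ⟨T, hT, F, hF, hxF, hFfr⟩ := 𝒯.exists_boundary_face hΩ hfr
    have hFT := facet_subset hF
    rw [𝒯.interp_eq g hT (hull_mono hFT hxF)]
    have : (0 : ℝ) = AffineMap.const ℝ (Pt d) (0 : ℝ) x := rfl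
    rw [this]
    refine affineMap_eqOn_hull (fun v hv => ?_) hxF
    rw [(𝒯.isSimplex hT).linInterp_vertex g (hFT hv), hg v (hFfr (mem_hull_of_mem hv))]
    rfl
  · rw [interp, dif_neg]
    rintro ⟨T, hT, hxT⟩
    exact hc (𝒯.hull_subset_closure hT hxT)

/-- Only a pointwise estimate is needed, by `lipschitzWith_of_pointwise`: a point of `closure Ω`
close to `x` lies in a cell which also contains `x`, where the function is affine. -/
theorem interp_lipschitz (hΩ : IsLipschitzDomain Ω) {g : Pt d → ℝ}
    (hg : ∀ v ∈ frontier Ω, g v = 0) : ∃ K : ℝ≥0, LipschitzWith K (𝒯.interp g) := by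
  choose K hK using fun T : Finset (Pt d) => exists_lipschitz_affineMap (linInterp T g)
  refine ⟨∑ T ∈ 𝒯.cells, K T, lipschitzWith_of_pointwise fun x => ?_⟩
  obtain ⟨ε, hε, hav⟩ := exists_ball_avoiding 𝒯.cells x
  have hKle : ∀ T ∈ 𝒯.cells, (K T : ℝ) ≤ (∑ T ∈ 𝒯.cells, K T : ℝ≥0) := fun T hT => by
    exact_mod_cast Finset.single_le_sum (f := K) (fun _ _ => zero_le) hT
  have hnear : ∀ᶠ y in 𝓝 x, x ∈ Ω → y ∈ Ω := by
    by_cases hxΩ : x ∈ Ω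
    · filter_upwards [hΩ.isOpen.mem_nhds hxΩ] with y hy _ using hy
    · exact Eventually.of_forall fun y h => absurd h hxΩ
  filter_upwards [Metric.ball_mem_nhds x hε, hnear] with y hy hxy
  by_cases hyc : y ∈ closure Ω
  · obtain ⟨T, hT, hyT⟩ := 𝒯.exists_cell hyc
    have hxT := hav T hT ⟨y, hy, hyT⟩
    rw [𝒯.interp_eq g hT hyT, 𝒯.interp_eq g hT hxT]
    exact (hK T y x).trans (mul_le_mul_of_nonneg_right (hKle T hT) dist_nonneg)
  · have hyΩ : y ∉ Ω := fun h => hyc (subset_closure h)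
    have hxΩ : x ∉ Ω := fun h => hyΩ (hxy h)
    rw [𝒯.interp_eq_zero hΩ hg hyΩ, 𝒯.interp_eq_zero hΩ hg hxΩ, sub_self, abs_zero]
    positivity

theorem conformingP1_interp (hΩ : IsLipschitzDomain Ω) {g : Pt d → ℝ}
    (hg : ∀ v ∈ frontier Ω, g v = 0) : 𝒯.ConformingP1 (𝒯.interp g) := by
  obtain ⟨K, hK⟩ := 𝒯.interp_lipschitz hΩ hg
  refine ⟨memH10_of_lipschitz hΩ.isBounded hK (fun x hx => 𝒯.interp_eq_zero hΩ hg hx) ?_,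
    fun T hT => ?_⟩
  -- On each cell the function is identically zero or vanishes only on a null set; this is the
  -- alternative required by `memH10_of_lipschitz`.
  · have hnull : ∀ᵐ x ∂(volume : Measure (Pt d)), ∀ T ∈ 𝒯.cells,
        (∃ y, linInterp T g y ≠ 0) → linInterp T g x ≠ 0 := by
      refine (ae_ball_iff 𝒯.cells.countable_toSet).2 fun T _ => ?_
      by_cases h : ∃ y, linInterp T g y ≠ 0
      · have := measure_eq_zero_iff_ae_notMem.1 (volume_zero_affineMap _ h)
        filter_upwards [this] with x hx _ using hx
      · exact Eventually.of_forall fun x h' => absurd h' h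
    filter_upwards [𝒯.ae_mem_interior, ae_restrict_of_ae hnull] with x ⟨T, hT, hxT⟩ hx
    have hev : ∀ᶠ y in 𝓝 x, 𝒯.interp g y = linInterp T g y := by
      filter_upwards [isOpen_interior.mem_nhds hxT] with y hy
      exact 𝒯.interp_eq g hT (interior_subset hy)
    refine ⟨⟨_, hev⟩, ?_⟩
    by_cases h : ∃ y, linInterp T g y ≠ 0
    · exact Or.inl (by rw [hev.self_of_nhds]; exact hx T hT h)
    · push Not at h
      exact Or.inr (hev.mono fun y hy => by rw [hy, h])
  · obtain ⟨P, hP, hPv⟩ := exists_poly_of_affineMap (linInterp T g)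
    exact ⟨P, hP, fun x hx => by rw [𝒯.interp_eq g hT hx, hPv]⟩

/-- Degree one fits into the skeletal space because `1 ≤ p`. The boundary values are a separate
hypothesis, since `MemH10` sees `w` only up to null sets. -/
theorem trace_mem_M {p : ℕ} (hp : 1 ≤ p) {w : Pt d → ℝ} (hw : 𝒯.ConformingP1 w)
    (h0 : ∀ x ∈ frontier Ω, w x = 0) : 𝒯.trace w ∈ 𝒯.M p := by
  refine ⟨fun F hF => ?_, fun F hF hfr => ?_, fun F hF => ?_⟩
  · obtain ⟨T, hT, hFT⟩ := hF
    obtain ⟨P, hP, hPv⟩ := hw.2 T hT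
    refine ⟨P, ?_, ?_⟩
    · rw [MvPolynomial.mem_restrictTotalDegree] at hP ⊢
      exact hP.trans hp
    · rw [trace, if_pos (𝒯.isFace hT hFT)]
      funext x
      by_cases hx : x ∈ hull F
      · rw [Set.indicator_of_mem hx, Set.indicator_of_mem hx, hPv x (hull_mono (facet_subset hFT) hx)]
      · rw [Set.indicator_of_notMem hx, Set.indicator_of_notMem hx]
  · rw [trace, if_pos hF]
    funext x
    by_cases hx : x ∈ hull F
    · rw [Set.indicator_of_mem hx, h0 x (hfr hx)]; rfl
    · rw [Set.indicator_of_notMem hx]; rfl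
  · rw [trace, if_neg hF]

theorem trace_apply (w : Pt d → ℝ) {T F : Finset (Pt d)} (hT : T ∈ 𝒯.cells) (hF : F ∈ facets T)
    {x : Pt d} (hx : x ∈ hull F) : 𝒯.trace w F x = w x := by
  rw [trace, if_pos (𝒯.isFace hT hF), Set.indicator_of_mem hx]

/-- A conforming function on a mesh is conforming on each refinement. -/
theorem ConformingP1.refine {𝒯' : SimplicialMesh d Ω} (h : 𝒯.IsRefinedBy 𝒯') {w : Pt d → ℝ}
    (hw : 𝒯.ConformingP1 w) : 𝒯'.ConformingP1 w := by
  refine ⟨hw.1, fun T' hT' => ?_⟩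
  obtain ⟨x, hx⟩ := (𝒯'.isSimplex hT').interior_nonempty
  obtain ⟨T, hT, hxT⟩ := 𝒯.exists_cell (𝒯'.hull_subset_closure hT' (interior_subset hx))
  obtain ⟨C, hC, hCT⟩ := h T hT
  rw [hCT] at hxT
  simp only [Set.mem_iUnion, exists_prop] at hxT
  obtain ⟨T₁, hT₁, hxT₁⟩ := hxT
  have : T' = T₁ := 𝒯'.eq_of_mem_interior hT' (hC hT₁) hx hxT₁
  have hsub : hull T' ⊆ hull T := by
    rw [hCT, this]; exact Set.subset_biUnion_of_mem (u := fun T => hull T) hT₁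
  obtain ⟨P, hP, hPv⟩ := hw.2 T hT
  exact ⟨P, hP, fun y hy => hPv y (hsub hy)⟩

end SimplicialMesh

/-! ### Uniform meshes -/

namespace SimplicialMesh

variable {Ω : Set (Pt d)} (𝒯 : SimplicialMesh d Ω)

/-- All cells have diameter at most `h` and contain a ball of radius `h / κ`. -/
structure Uniform (κ : ℝ) : Prop where
  κ_pos : 0 < κ
  h_pos : 0 < 𝒯.h
  diam_le : ∀ T ∈ 𝒯.cells, Metric.diam (hull T) ≤ 𝒯.h
  ball : ∀ T ∈ 𝒯.cells, ∃ c, Metric.closedBall c (𝒯.h / κ) ⊆ hull T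

theorem cells_nonempty (hΩ : IsLipschitzDomain Ω) : 𝒯.cells.Nonempty := by
  obtain ⟨x, hx⟩ := hΩ.isConnected.nonempty
  obtain ⟨T, hT, -⟩ := 𝒯.exists_cell (subset_closure hx)
  exact ⟨T, hT⟩

theorem diam_le_h {T : Finset (Pt d)} (hT : T ∈ 𝒯.cells) : Metric.diam (hull T) ≤ 𝒯.h :=
  le_csSup (𝒯.cells.finite_toSet.image _).bddAbove (Set.mem_image_of_mem _ hT)

theorem _root_.HDG.IsSimplex.diam_pos {T : Finset (Pt d)} (hT : IsSimplex T) (hd : 1 ≤ d) :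
    0 < Metric.diam (hull T) := by
  obtain ⟨a, ha, b, hb, hab⟩ := Finset.one_lt_card.1 (by rw [hT.card_eq]; omega : 1 < T.card)
  exact (dist_pos.2 hab).trans_le (Metric.dist_le_diam_of_mem (isCompact_hull T).isBounded
    (mem_hull_of_mem ha) (mem_hull_of_mem hb))

theorem h_pos (hd : 1 ≤ d) (hΩ : IsLipschitzDomain Ω) : 0 < 𝒯.h := by
  obtain ⟨T, hT⟩ := 𝒯.cells_nonempty hΩ
  exact ((𝒯.isSimplex hT).diam_pos hd).trans_le (𝒯.diam_le_h hT)

/-- The constant comes from `h ≤ σ diam T ≤ σ s r`; the maximum with `1` makes it positive whatever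
`σ` and `s` are. -/
theorem uniform_of_regular (hd : 1 ≤ d) (hΩ : IsLipschitzDomain Ω) {s σ : ℝ}
    (hs : 𝒯.ShapeRegular s) (hσ : 𝒯.QuasiUniform σ) : 𝒯.Uniform (max 1 (σ * s)) := by
  have h0 := 𝒯.h_pos hd hΩ
  have hκ : 0 < max 1 (σ * s) := lt_max_of_lt_left one_pos
  refine ⟨hκ, h0, fun T hT => 𝒯.diam_le_h hT, fun T hT => ?_⟩
  obtain ⟨c, r, hr, hb, hsr⟩ := hs T hT
  refine ⟨c, (Metric.closedBall_subset_closedBall ?_).trans hb⟩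
  have h1 := hσ T hT
  have h2 := (𝒯.isSimplex hT).diam_pos hd
  have h3 : 0 < σ := by
    by_contra h
    rw [not_lt] at h
    nlinarith
  rw [div_le_iff₀ hκ]
  calc 𝒯.h ≤ σ * (s * r) := h1.trans (mul_le_mul_of_nonneg_left hsr h3.le)
    _ = r * (σ * s) := by ring
    _ ≤ r * max 1 (σ * s) := mul_le_mul_of_nonneg_left (le_max_right _ _) hr.le

namespace Uniform

variable {𝒯} {κ : ℝ} (hu : 𝒯.Uniform κ)
include hu

theorem r_pos : 0 < 𝒯.h / κ := div_pos hu.h_pos hu.κ_pos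

theorem le_volume {T : Finset (Pt d)} (hT : T ∈ 𝒯.cells) :
    (𝒯.h / κ) ^ d * ballVol d ≤ volume.real (hull T) := by
  obtain ⟨c, hc⟩ := hu.ball T hT
  exact le_volume_real_hull hu.r_pos hc

theorem volume_le {T : Finset (Pt d)} (hT : T ∈ 𝒯.cells) :
    volume.real (hull T) ≤ 𝒯.h ^ d * ballVol d :=
  (volume_real_hull_le T (𝒯.isSimplex hT)).trans (mul_le_mul_of_nonneg_right
    (pow_le_pow_left₀ Metric.diam_nonneg (hu.diam_le T hT) d) (ballVol_pos d).le)

theorem le_surf (hd : 1 ≤ d) {T F : Finset (Pt d)} (hT : T ∈ 𝒯.cells) (hF : F ∈ facets T) :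
    (𝒯.h / κ) ^ (d - 1) * ballVol (d - 1) ≤ (surf d).real (hull F) := by
  obtain ⟨c, hc⟩ := hu.ball T hT
  exact le_surf_real (𝒯.isSimplex hT) hd hF hu.r_pos hc

theorem sum_surf_le (hd : 1 ≤ d) {T : Finset (Pt d)} (hT : T ∈ 𝒯.cells) :
    ∑ F ∈ facets T, (surf d).real (hull F) ≤ (d + 1) * (𝒯.h ^ (d - 1) * ballVol (d - 1)) := by
  have h1 : ∀ F ∈ facets T, (surf d).real (hull F) ≤ 𝒯.h ^ (d - 1) * ballVol (d - 1) :=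
    fun F hF => (surf_real_le (𝒯.isSimplex hT) hd hF).trans (mul_le_mul_of_nonneg_right
      (pow_le_pow_left₀ Metric.diam_nonneg (hu.diam_le T hT) _) (ballVol_pos _).le)
  refine (Finset.sum_le_card_nsmul _ _ _ h1).trans_eq ?_
  rw [(𝒯.isSimplex hT).card_facets, nsmul_eq_mul]; push_cast; ring

/-- `|∂T| ≤ C h⁻¹ |T|`. -/
theorem le_volRatio (hd : 1 ≤ d) {T : Finset (Pt d)} (hT : T ∈ 𝒯.cells) :
    𝒯.h * (ballVol d / ((d + 1) * κ ^ d * ballVol (d - 1))) ≤ volRatio T := by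
  have hκ := hu.κ_pos
  have hh := hu.h_pos
  have hb := ballVol_pos d
  have hb' := ballVol_pos (d - 1)
  rw [volRatio, le_div_iff₀ ((𝒯.isSimplex hT).sum_surf_pos hd)]
  refine le_trans ?_ (hu.le_volume hT)
  refine (mul_le_mul_of_nonneg_left (hu.sum_surf_le hd hT) (by positivity)).trans_eq ?_
  have hdd : 𝒯.h ^ d = 𝒯.h ^ (d - 1) * 𝒯.h := by rw [← pow_succ]; congr 1; omega
  rw [div_pow, hdd]
  field_simp

/-- The number of cells which meet at a point is bounded. -/
theorem card_star_le {v : Pt d} (C : Finset (Finset (Pt d))) (hC : C ⊆ 𝒯.cells)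
    (hv : ∀ T ∈ C, v ∈ hull T) : (C.card : ℝ) ≤ κ ^ d := by
  have hκ := hu.κ_pos
  have hh := hu.h_pos
  have hb := ballVol_pos d
  -- Volume count: these cells have disjoint interiors and lie in the ball of radius `h` about `v`,
  -- while each contains a ball of radius `h / κ`.
  have h1 : ∑ T ∈ C, volume.real (hull T) ≤ 𝒯.h ^ d * ballVol d := by
    rw [← volume_real_closedBall v hh.le]
    have e1 : ∀ T ∈ C, volume.real (hull T) = volume.real (interior (hull T)) := fun T _ =>
      (measureReal_congr (interior_ae_eq_of_null_frontier (volume_frontier_hull T))).symm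
    rw [Finset.sum_congr rfl e1, ← measureReal_biUnion_finset (h := fun T _ =>
      ((measure_mono interior_subset).trans_lt (isCompact_hull T).measure_lt_top).ne)]
    · refine measureReal_mono ?_ measure_closedBall_lt_top.ne
      refine Set.iUnion₂_subset fun T hT x hx => ?_
      exact (Metric.dist_le_diam_of_mem (isCompact_hull T).isBounded (interior_subset hx)
        (hv T hT)).trans (hu.diam_le T (hC hT))
    · intro T hT T' hT' hne
      refine Set.disjoint_left.2 fun x hx hx' => hne ?_
      exact 𝒯.eq_of_mem_interior (hC hT) (hC hT') hx (interior_subset hx')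
    · exact fun T _ => isOpen_interior.measurableSet
  have h2 : C.card • ((𝒯.h / κ) ^ d * ballVol d) ≤ ∑ T ∈ C, volume.real (hull T) :=
    Finset.card_nsmul_le_sum _ _ _ fun T hT => hu.le_volume (hC hT)
  have h3 := h2.trans h1
  rw [nsmul_eq_mul, div_pow] at h3
  have h4 : (C.card : ℝ) * (𝒯.h ^ d / κ ^ d * ballVol d) =
      C.card / κ ^ d * (𝒯.h ^ d * ballVol d) := by ring
  rw [h4] at h3
  have h5 := le_of_mul_le_mul_right (h3.trans_eq (one_mul _).symm) (by positivity)
  rwa [div_le_one (by positivity)] at h5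

end Uniform

/-! ### Chains of cells around a point -/

/-- The cells at `v`, joined when they share a face, form a connected graph by `star_connected`. A
path visits no cell twice, so fewer than `C.card` steps of size `δ` suffice. -/
theorem abs_sub_le_of_star (hΩ : IsLipschitzDomain Ω) {v : Pt d} {C : Finset (Finset (Pt d))}
    (hC : ∀ T, T ∈ C ↔ T ∈ 𝒯.cells ∧ v ∈ hull T) {f : Finset (Pt d) → ℝ} {δ : ℝ} (hδ : 0 ≤ δ)
    (hf : ∀ T ∈ C, ∀ T' ∈ C, T ≠ T' → ∀ F ∈ facets T, F ∈ facets T' → v ∈ hull F →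
      |f T - f T'| ≤ δ) {T T' : Finset (Pt d)} (hT : T ∈ C) (hT' : T' ∈ C) :
    |f T - f T'| ≤ C.card * δ := by
  classical
  let G : SimpleGraph C := SimpleGraph.fromRel fun T T' => (T.1 ∩ T'.1).card = d
  have hstep : ∀ A B : C, G.Adj A B → |f A - f B| ≤ δ := by
    intro A B hAB
    rw [SimpleGraph.fromRel_adj] at hAB
    have hcard : (A.1 ∩ B.1).card = d := by
      rcases hAB.2 with h | h
      · exact h
      · rwa [Finset.inter_comm] at h
    have hA := (hC A).1 A.2
    have hB := (hC B).1 B.2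
    refine hf A A.2 B B.2 (fun h => hAB.1 (Subtype.ext h)) (A.1 ∩ B.1) ?_ ?_ ?_
    · exact Finset.mem_powersetCard.2 ⟨Finset.inter_subset_left, hcard⟩
    · exact Finset.mem_powersetCard.2 ⟨Finset.inter_subset_right, hcard⟩
    · rw [← 𝒯.hull_inter_hull hA.1 hB.1]; exact ⟨hA.2, hB.2⟩
  have hwalk : ∀ {A B : C} (p : G.Walk A B), |f A - f B| ≤ p.length * δ := by
    intro A B p
    induction p with
    | nil => simp
    | cons h p ih =>
      rename_i X Y Z
      rw [SimpleGraph.Walk.length_cons]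
      have h1 := hstep _ _ h
      have h2 := abs_sub_le (f X) (f Y) (f Z)
      push_cast
      linarith
  have hreach : ∃ h : T' ∈ C, G.Reachable ⟨T, hT⟩ ⟨T', h⟩ := by
    refine 𝒯.star_connected hΩ (v := v) (P := fun X => ∃ h : X ∈ C, G.Reachable ⟨T, hT⟩ ⟨X, h⟩) ?_
      ((hC T).1 hT).1 ((hC T).1 hT).2 ⟨hT, SimpleGraph.Reachable.refl _⟩
      ((hC T').1 hT').1 ((hC T').1 hT').2
    rintro A hA B hB hvA hvB hcard ⟨hAC, hr⟩
    have hBC : B ∈ C := (hC B).2 ⟨hB, hvB⟩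
    refine ⟨hBC, hr.trans (SimpleGraph.Adj.reachable ?_)⟩
    rw [SimpleGraph.fromRel_adj]
    refine ⟨fun h => ?_, Or.inl (by convert hcard)⟩
    have : A = B := congrArg Subtype.val h
    rw [this, Finset.inter_self, 𝒯.card_eq B hB] at hcard
    omega
  obtain ⟨_, hr⟩ := hreach
  obtain ⟨p, hp⟩ := hr.exists_isPath
  have h1 := hwalk p
  have h2 := hp.length_lt
  rw [Fintype.card_coe] at h2
  have h3 : (p.length : ℝ) ≤ C.card := by exact_mod_cast h2.le
  exact h1.trans (mul_le_mul_of_nonneg_right h3 hδ)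

end SimplicialMesh

/-! ### Values on a common face -/

/-- The skeletal function, single valued on the face, couples the two sides: two numbers close to
the same `l` in mean square are close to each other. -/
theorem sq_sub_le_of_face {T F : Finset (Pt d)} (hT : IsSimplex T) (hd : 1 ≤ d) (hF : F ∈ facets T)
    {l : Pt d → ℝ} (hl : ContinuousOn l (hull F)) {a b A B : ℝ}
    (ha : ∫ x in hull F, (a - l x) ^ 2 ∂(surf d) ≤ (surf d).real (hull F) * A)
    (hb : ∫ x in hull F, (b - l x) ^ 2 ∂(surf d) ≤ (surf d).real (hull F) * B) :
    (a - b) ^ 2 ≤ 2 * A + 2 * B := by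
  have hpos := hT.surf_pos hd hF
  have ia : IntegrableOn (fun x => (a - l x) ^ 2) (hull F) (surf d) :=
    integrableOn_face hT hd hF ((continuousOn_const.sub hl).pow 2)
  have ib : IntegrableOn (fun x => (b - l x) ^ 2) (hull F) (surf d) :=
    integrableOn_face hT hd hF ((continuousOn_const.sub hl).pow 2)
  have h1 : ∫ _ in hull F, (a - b) ^ 2 ∂(surf d) ≤
      ∫ x in hull F, (2 * (a - l x) ^ 2 + 2 * (b - l x) ^ 2) ∂(surf d) := by
    refine setIntegral_mono_on (integrableOn_face hT hd hF continuousOn_const)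
      ((ia.const_mul 2).add (ib.const_mul 2)) (isClosed_hull F).measurableSet fun x _ => ?_
    nlinarith [sq_nonneg ((a - l x) + (b - l x))]
  rw [setIntegral_const, smul_eq_mul, integral_add (ia.const_mul 2) (ib.const_mul 2),
    integral_const_mul, integral_const_mul] at h1
  have h2 : (surf d).real (hull F) * (a - b) ^ 2 ≤ (surf d).real (hull F) * (2 * A + 2 * B) := by
    linarith
  exact le_of_mul_le_mul_left h2 hpos

namespace Method

variable {Ω : Set (Pt d)} {𝒯 : SimplicialMesh d Ω} {p k : ℕ} (S : Method 𝒯 p k)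

/-- The local error indicator of a cell. -/
def indic (lam : 𝒯.M p) (T : Finset (Pt d)) : ℝ :=
  𝒯.h ^ 2 * (∫ x in hull T, ‖vecVal (polyGrad (S.U lam T)) x‖ ^ 2) +
    volRatio T * bdryIntegral T (fun F x => S.jump lam T F x ^ 2)

theorem indic_nonneg (hd : 1 ≤ d) (lam : 𝒯.M p) {T : Finset (Pt d)} (hT : T ∈ 𝒯.cells) :
    0 ≤ S.indic lam T :=
  add_nonneg (mul_nonneg (sq_nonneg _) (integral_nonneg fun _ => by positivity))
    (𝒯.cell_term_nonneg hd hT _)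

/-- The gradient of `𝒰 λ` is `(𝒬 λ + ∇ 𝒰 λ) - 𝒬 λ`; in (LS3) followed by (LS1) the powers of `h`
cancel. Absolute values appear since the constants carry no sign assumption. -/
theorem sum_indic_le (hd : 1 ≤ d) (hΩ : IsLipschitzDomain Ω) {c1 c3 : ℝ} (h1 : S.LS1 c1)
    (h3 : S.LS3 c3) (lam : 𝒯.M p) :
    ∑ T ∈ 𝒯.cells, S.indic lam T ≤
      ((1 + |c1| * |c3|) ^ 2 + c1 ^ 2) * (𝒯.h * S.normQ lam) ^ 2 := by
  have hh := 𝒯.h_pos hd hΩ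
  have hq := S.normQ_nonneg lam
  have hj0 := 𝒯.skelNorm_nonneg (S.jump lam)
  have hj : 𝒯.skelNorm (S.jump lam) ≤ |c1| * 𝒯.h * S.normQ lam :=
    (h1 lam).trans (by gcongr; exact le_abs_self c1)
  have hg : l2norm Ω (𝒯.vecFn fun T => polyGrad (S.U lam T)) ≤ (1 + |c1| * |c3|) * S.normQ lam := by
    have e1 : 𝒯.vecFn (fun T => polyGrad (S.U lam T)) =ᵐ[volume.restrict Ω]
        𝒯.vecFn (fun T => S.Q lam T + polyGrad (S.U lam T)) - 𝒯.vecFn (S.Q lam) := by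
      filter_upwards [𝒯.ae_mem_interior] with x ⟨T, hT, hx⟩
      rw [Pi.sub_apply, 𝒯.vecFn_eq _ hT hx, 𝒯.vecFn_eq _ hT hx, 𝒯.vecFn_eq _ hT hx, vecVal_add]
      abel
    rw [l2norm_congr e1]
    refine (l2norm_sub_le (𝒯.memLp_vecFn _) (𝒯.memLp_vecFn _)).trans ?_
    have h4 : l2norm Ω (𝒯.vecFn fun T => S.Q lam T + polyGrad (S.U lam T)) ≤
        |c3| * 𝒯.h⁻¹ * (|c1| * 𝒯.h * S.normQ lam) := by
      refine (h3 lam).trans ?_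
      have : 0 < 𝒯.h⁻¹ := inv_pos.2 hh
      gcongr
      exact le_abs_self c3
    have h5 : |c3| * 𝒯.h⁻¹ * (|c1| * 𝒯.h * S.normQ lam) = |c1| * |c3| * S.normQ lam := by
      field_simp
    rw [h5] at h4
    change _ + S.normQ lam ≤ _
    linarith
  have h6 : ∑ T ∈ 𝒯.cells, S.indic lam T =
      𝒯.h ^ 2 * l2norm Ω (𝒯.vecFn fun T => polyGrad (S.U lam T)) ^ 2 +
        𝒯.skelNorm (S.jump lam) ^ 2 := by
    rw [𝒯.l2norm_vecFn_sq hΩ, 𝒯.skelNorm_sq hd, Finset.mul_sum, ← Finset.sum_add_distrib]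
    rfl
  have h7 := pow_le_pow_left₀ (l2norm_nonneg _ _) hg 2
  have h8 := pow_le_pow_left₀ hj0 hj 2
  have h9 : (|c1| * 𝒯.h * S.normQ lam) ^ 2 = c1 ^ 2 * (𝒯.h * S.normQ lam) ^ 2 := by
    rw [mul_assoc, mul_pow, sq_abs]
  rw [h6]
  rw [h9] at h8
  have h10 : 𝒯.h ^ 2 * l2norm Ω (𝒯.vecFn fun T => polyGrad (S.U lam T)) ^ 2 ≤
      𝒯.h ^ 2 * ((1 + |c1| * |c3|) * S.normQ lam) ^ 2 := mul_le_mul_of_nonneg_left h7 (sq_nonneg _)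
  nlinarith

end Method

/-! ### Approximation of skeletal functions by conforming functions -/

/-- The local estimates on uniform meshes: the oscillation of `𝒰 λ` on a cell, and its distance
to `λ` on the faces of the cell. -/
theorem exists_cell_estimate (d k : ℕ) (hd : 1 ≤ d) (κ : ℝ) :
    ∃ C > 0, ∀ (Ω : Set (Pt d)) (𝒯 : SimplicialMesh d Ω), 𝒯.Uniform κ →
      ∀ (p : ℕ) (S : Method 𝒯 p k) (lam : 𝒯.M p), ∀ T ∈ 𝒯.cells, ∀ v ∈ hull T,
        (∀ x ∈ hull T, (val (S.U lam T) v - val (S.U lam T) x) ^ 2 ≤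
          C * (S.indic lam T / 𝒯.h ^ d)) ∧
        ∀ F ∈ facets T, ∫ x in hull F,
          (val (S.U lam T) v - (lam : Finset (Pt d) → Pt d → ℝ) F x) ^ 2 ∂(surf d) ≤
            (surf d).real (hull F) * (C * (S.indic lam T / 𝒯.h ^ d)) := by
  -- No mesh is uniform with `κ ≤ 0`, so any constant serves in that case.
  by_cases hκ : 0 < κ
  swap
  · exact ⟨1, one_pos, fun Ω 𝒯 hu => absurd hu.κ_pos hκ⟩
  obtain ⟨Co, hCo, hosc⟩ := exists_osc_estimate d k κ
  have hb := ballVol_pos d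
  have hb' := ballVol_pos (d - 1)
  set cv := ballVol d / ((d + 1) * κ ^ d * ballVol (d - 1)) with hcv
  have hcv0 : 0 < cv := by positivity
  -- The first summand comes from the oscillation of `𝒰 λ`; the second from the jump, by dividing by
  -- `volRatio T ≥ cv h` and by the lower bound of order `h ^ (d - 1)` for the area of the face.
  refine ⟨2 * (Co * κ ^ d) + 2 * (κ ^ (d - 1) / (ballVol (d - 1) * cv)), by positivity,
    fun Ω 𝒯 hu p S lam T hT v hv => ?_⟩
  have hS := 𝒯.isSimplex hT
  have hh := hu.h_pos
  obtain ⟨c, hc⟩ := hu.ball T hT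
  set D := S.indic lam T with hD
  set G := ∫ x in hull T, ‖vecVal (polyGrad (S.U lam T)) x‖ ^ 2 with hG
  have hG0 : 0 ≤ G := integral_nonneg fun _ => by positivity
  set J := bdryIntegral T (fun F x => S.jump lam T F x ^ 2) with hJ
  have hJ0 : 0 ≤ J := bdryIntegral_nonneg fun _ _ _ _ => sq_nonneg _
  have hr0 : 0 < volRatio T := hS.volRatio_pos hd
  have hDe : D = 𝒯.h ^ 2 * G + volRatio T * J := rfl
  have hD0 : 0 ≤ D := S.indic_nonneg hd lam hT
  have h1 : ∀ x ∈ hull T, (val (S.U lam T) v - val (S.U lam T) x) ^ 2 ≤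
      Co * κ ^ d * (D / 𝒯.h ^ d) := by
    intro x hx
    have hUk : S.U lam T ∈ PolyDeg d k := S.V_le T hT (S.isLocalSolution hT lam).mem_V
    have h2 := hosc _ hUk T c (𝒯.h / κ) hu.r_pos hc
      (by rw [mul_div_cancel₀ _ hκ.ne']; exact hu.diam_le T hT) v hv x hx
    have h3 : Co * Metric.diam (hull T) ^ 2 * G ≤ Co * D := by
      rw [mul_assoc]
      refine mul_le_mul_of_nonneg_left ?_ hCo.le
      rw [hDe]
      have := mul_le_mul_of_nonneg_right
        (pow_le_pow_left₀ Metric.diam_nonneg (hu.diam_le T hT) 2) hG0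
      have := mul_nonneg hr0.le hJ0
      linarith
    have h4 := h2.trans h3
    rw [div_pow, ← le_div_iff₀ (by positivity)] at h4
    refine h4.trans_eq ?_
    field_simp
  have hDh : 0 ≤ D / 𝒯.h ^ d := by positivity
  refine ⟨fun x hx => (h1 x hx).trans ?_, fun F hF => ?_⟩
  · refine mul_le_mul_of_nonneg_right ?_ hDh
    have e1 : 0 ≤ Co * κ ^ d := by positivity
    have e2 : 0 ≤ κ ^ (d - 1) / (ballVol (d - 1) * cv) := by positivity
    linarith
  · have hjc : ContinuousOn (fun x => S.jump lam T F x ^ 2) (hull F) :=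
      (S.jump_continuousOn lam hT hF).pow 2
    have hlc := 𝒯.M_continuousOn lam hT hF
    set A := Co * κ ^ d * (D / 𝒯.h ^ d) with hA
    have h2 : ∫ x in hull F, (val (S.U lam T) v - (lam : Finset (Pt d) → Pt d → ℝ) F x) ^ 2 ∂(surf d)
        ≤ ∫ x in hull F, (2 * A + 2 * S.jump lam T F x ^ 2) ∂(surf d) := by
      refine setIntegral_mono_on
        (integrableOn_face hS hd hF ((continuousOn_const.sub hlc).pow 2))
        (integrableOn_face hS hd hF (continuousOn_const.add (continuousOn_const.mul hjc)))
        (isClosed_hull F).measurableSet fun x hx => ?_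
      have h3 := h1 x (hull_mono (facet_subset hF) hx)
      have h4 : val (S.U lam T) v - (lam : Finset (Pt d) → Pt d → ℝ) F x =
          (val (S.U lam T) v - val (S.U lam T) x) + S.jump lam T F x := by
        rw [Method.jump]; ring
      rw [h4]
      nlinarith [sq_nonneg ((val (S.U lam T) v - val (S.U lam T) x) - S.jump lam T F x)]
    rw [integral_add (integrableOn_face hS hd hF continuousOn_const)
      ((integrableOn_face hS hd hF hjc).const_mul 2), setIntegral_const, integral_const_mul,
      smul_eq_mul] at h2
    have h3 : ∫ x in hull F, S.jump lam T F x ^ 2 ∂(surf d) ≤ J :=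
      Finset.single_le_sum (f := fun F => ∫ x in hull F, S.jump lam T F x ^ 2 ∂(surf d))
        (fun F' _ => integral_nonneg fun _ => sq_nonneg _) hF
    have h4 : J ≤ D / (𝒯.h * cv) := by
      rw [le_div_iff₀ (by positivity), hDe]
      have h5 := mul_le_mul_of_nonneg_right (hu.le_volRatio hd hT) hJ0
      have h6 : 0 ≤ 𝒯.h ^ 2 * G := by positivity
      rw [← hcv] at h5
      linarith
    have h5 : D / (𝒯.h * cv) ≤ (surf d).real (hull F) *
        (κ ^ (d - 1) / (ballVol (d - 1) * cv) * (D / 𝒯.h ^ d)) := by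
      refine le_trans (le_of_eq ?_) (mul_le_mul_of_nonneg_right (hu.le_surf hd hT hF) (by positivity))
      have hdd : 𝒯.h ^ d = 𝒯.h ^ (d - 1) * 𝒯.h := by rw [← pow_succ]; congr 1; omega
      rw [div_pow, hdd]
      field_simp
    refine h2.trans ?_
    have h6 := h3.trans (h4.trans h5)
    rw [hA]
    linarith

namespace Method

variable {Ω : Set (Pt d)} {𝒯 : SimplicialMesh d Ω} {p k : ℕ} (S : Method 𝒯 p k)

open Classical in
/-- The cells which contain `v`. -/
def _root_.HDG.SimplicialMesh.star (𝒯 : SimplicialMesh d Ω) (v : Pt d) : Finset (Finset (Pt d)) :=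
  𝒯.cells.filter fun T => v ∈ hull T

theorem _root_.HDG.SimplicialMesh.mem_star (𝒯 : SimplicialMesh d Ω) {v : Pt d} {T : Finset (Pt d)} :
    T ∈ 𝒯.star v ↔ T ∈ 𝒯.cells ∧ v ∈ hull T := by
  classical
  rw [SimplicialMesh.star, Finset.mem_filter]

open Classical in
/-- Nodal values of a conforming approximation: zero on the boundary, and the value of `𝒰 λ` from
one of the adjacent cells elsewhere. -/
def nodal (lam : 𝒯.M p) (v : Pt d) : ℝ :=
  if h : v ∉ frontier Ω ∧ ∃ T, T ∈ 𝒯.star v then val (S.U lam h.2.choose) v else 0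

theorem nodal_frontier (lam : 𝒯.M p) {v : Pt d} (hv : v ∈ frontier Ω) : S.nodal lam v = 0 := by
  rw [nodal, dif_neg]; exact fun h => h.1 hv

/-- Each crossing of a face at `v` costs at most `√m`, with `m` controlled by the indicators of the
star. At most `κ ^ d` crossings reach any cell at `v`, and one more comparison reaches the value `0`
on a boundary face. -/
theorem sq_sub_nodal_le (hd : 1 ≤ d) (hΩ : IsLipschitzDomain Ω) {κ : ℝ} (hu : 𝒯.Uniform κ) {C : ℝ}
    (hC : 0 < C) (lam : 𝒯.M p)
    (hF : ∀ T ∈ 𝒯.cells, ∀ v ∈ hull T, ∀ F ∈ facets T, ∫ x in hull F,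
      (val (S.U lam T) v - (lam : Finset (Pt d) → Pt d → ℝ) F x) ^ 2 ∂(surf d) ≤
        (surf d).real (hull F) * (C * (S.indic lam T / 𝒯.h ^ d)))
    {T : Finset (Pt d)} {v : Pt d} (hT : T ∈ 𝒯.star v) :
    (val (S.U lam T) v - S.nodal lam v) ^ 2 ≤
      (κ ^ d + 1) ^ 2 * (4 * C * ((∑ T' ∈ 𝒯.star v, S.indic lam T') / 𝒯.h ^ d)) := by
  have hκ := hu.κ_pos
  have hh := hu.h_pos
  have hD0 : ∀ T' ∈ 𝒯.star v, 0 ≤ S.indic lam T' := fun T' hT' =>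
    S.indic_nonneg hd lam (𝒯.mem_star.1 hT').1
  set Z := ∑ T' ∈ 𝒯.star v, S.indic lam T' with hZ
  have hle : ∀ T' ∈ 𝒯.star v, C * (S.indic lam T' / 𝒯.h ^ d) ≤ C * (Z / 𝒯.h ^ d) := by
    intro T' hT'
    have := Finset.single_le_sum (f := S.indic lam) hD0 hT'
    gcongr
  have hZ0 : 0 ≤ Z := Finset.sum_nonneg hD0
  set m := 4 * C * (Z / 𝒯.h ^ d) with hm
  have hm0 : 0 ≤ m := by positivity
  have hstep : ∀ A ∈ 𝒯.star v, ∀ B ∈ 𝒯.star v, A ≠ B → ∀ F ∈ facets A, F ∈ facets B → v ∈ hull F →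
      |val (S.U lam A) v - val (S.U lam B) v| ≤ Real.sqrt m := by
    intro A hA B hB _ F hFA hFB _
    obtain ⟨hA', hvA⟩ := 𝒯.mem_star.1 hA
    obtain ⟨hB', hvB⟩ := 𝒯.mem_star.1 hB
    refine Real.abs_le_sqrt ((sq_sub_le_of_face (𝒯.isSimplex hA') hd hFA
      (𝒯.M_continuousOn lam hA' hFA) (hF A hA' v hvA F hFA) (hF B hB' v hvB F hFB)).trans ?_)
    have := hle A hA
    have := hle B hB
    rw [hm]; linarith
  have hchain : ∀ A ∈ 𝒯.star v, ∀ B ∈ 𝒯.star v,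
      |val (S.U lam A) v - val (S.U lam B) v| ≤ κ ^ d * Real.sqrt m := by
    intro A hA B hB
    refine (𝒯.abs_sub_le_of_star hΩ (v := v) (C := 𝒯.star v) (fun T => 𝒯.mem_star)
      (f := fun T => val (S.U lam T) v) (Real.sqrt_nonneg m) hstep hA hB).trans ?_
    refine mul_le_mul_of_nonneg_right ?_ (Real.sqrt_nonneg _)
    exact hu.card_star_le _ (fun T hT => (𝒯.mem_star.1 hT).1) fun T hT => (𝒯.mem_star.1 hT).2
  have hmain : |val (S.U lam T) v - S.nodal lam v| ≤ (κ ^ d + 1) * Real.sqrt m := by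
    by_cases hfr : v ∈ frontier Ω
    · rw [S.nodal_frontier lam hfr, sub_zero]
      -- At a boundary vertex the chain ends at a cell with a boundary face through `v`; there `λ =
      -- 0` plays the role of the second value.
      obtain ⟨T₁, hT₁, F, hFT, hvF, hFfr⟩ := 𝒯.exists_boundary_face hΩ hfr
      have hv₁ : v ∈ hull T₁ := hull_mono (facet_subset hFT) hvF
      have hs₁ : T₁ ∈ 𝒯.star v := 𝒯.mem_star.2 ⟨hT₁, hv₁⟩
      have h0 : ∫ x in hull F, ((0 : ℝ) - (lam : Finset (Pt d) → Pt d → ℝ) F x) ^ 2 ∂(surf d) ≤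
          (surf d).real (hull F) * 0 := by
        rw [𝒯.M_eq_zero_of_frontier lam (𝒯.isFace hT₁ hFT) hFfr]; simp
      have h1 := sq_sub_le_of_face (𝒯.isSimplex hT₁) hd hFT (𝒯.M_continuousOn lam hT₁ hFT)
        (hF T₁ hT₁ v hv₁ F hFT) h0
      have h2 : |val (S.U lam T₁) v - 0| ≤ Real.sqrt m := by
        refine Real.abs_le_sqrt (h1.trans ?_)
        have := hle T₁ hs₁
        have : 0 ≤ C * (Z / 𝒯.h ^ d) := by positivity
        rw [hm]; linarith
      have h3 := hchain T hT T₁ hs₁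
      rw [sub_zero] at h2
      have h4 := abs_sub_abs_le_abs_sub (val (S.U lam T) v) (val (S.U lam T₁) v)
      linarith
    · have h : v ∉ frontier Ω ∧ ∃ T, T ∈ 𝒯.star v := ⟨hfr, T, hT⟩
      rw [nodal, dif_pos h]
      refine (hchain T hT _ h.2.choose_spec).trans ?_
      have := Real.sqrt_nonneg m
      linarith
  have h5 := pow_le_pow_left₀ (abs_nonneg _) hmain 2
  rwa [sq_abs, mul_pow, Real.sq_sqrt hm0] at h5

end Method

/-- The barycentric coordinates are nonnegative with sum one, so the error is a convex combination
of the differences `u x - g v`. -/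
theorem sq_sub_linInterp_le {T : Finset (Pt d)} (hT : IsSimplex T) {u : Pt d → ℝ} {g : Pt d → ℝ}
    {A : ℝ} (hA : ∀ x ∈ hull T, ∀ v ∈ T, (u x - g v) ^ 2 ≤ A) {x : Pt d} (hx : x ∈ hull T) :
    (u x - linInterp T g x) ^ 2 ≤ A := by
  have h1 : u x - linInterp T g x = ∑ v ∈ T, bary T v x * (u x - g v) := by
    simp_rw [mul_sub]
    rw [Finset.sum_sub_distrib, ← Finset.sum_mul, hT.sum_bary, one_mul, linInterp_apply]
  have hA0 : 0 ≤ A := by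
    have : T.Nonempty := by rw [← Finset.card_pos, hT.card_eq]; omega
    obtain ⟨v, hv⟩ := this
    exact (sq_nonneg _).trans (hA x hx v hv)
  have h2 : |u x - linInterp T g x| ≤ Real.sqrt A := by
    rw [h1]
    refine (Finset.abs_sum_le_sum_abs _ _).trans ?_
    have h3 : ∀ v ∈ T, |bary T v x * (u x - g v)| ≤ bary T v x * Real.sqrt A := by
      intro v hv
      have hb := hT.mem_hull_iff.1 hx v hv
      rw [abs_mul, abs_of_nonneg hb]
      exact mul_le_mul_of_nonneg_left (Real.abs_le_sqrt (hA x hx v hv)) hb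
    refine (Finset.sum_le_sum h3).trans_eq ?_
    rw [← Finset.sum_mul, hT.sum_bary, one_mul]
  have h4 := pow_le_pow_left₀ (abs_nonneg _) h2 2
  rwa [sq_abs, Real.sq_sqrt hA0] at h4

/-- Double counting: `D T'` occurs once for each vertex `v` of `T'` and each cell having `v` as a
vertex, that is, at most `(d + 1) κ ^ d` times. Conformity ensures that a mesh vertex contained in
`T'` is one of its vertices. -/
theorem SimplicialMesh.sum_star_le {Ω : Set (Pt d)} {𝒯 : SimplicialMesh d Ω} {κ : ℝ}
    (hu : 𝒯.Uniform κ) {D : Finset (Pt d) → ℝ} (hD : ∀ T ∈ 𝒯.cells, 0 ≤ D T) :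
    ∑ T ∈ 𝒯.cells, ∑ v ∈ T, ∑ T' ∈ 𝒯.star v, D T' ≤ (d + 1) * κ ^ d * ∑ T ∈ 𝒯.cells, D T := by
  classical
  have e1 : ∀ T ∈ 𝒯.cells, ∑ v ∈ T, ∑ T' ∈ 𝒯.star v, D T' =
      ∑ T' ∈ 𝒯.cells, ((T ∩ T').card : ℝ) * D T' := by
    intro T hT
    have : ∀ v ∈ T, ∑ T' ∈ 𝒯.star v, D T' = ∑ T' ∈ 𝒯.cells, if v ∈ T' then D T' else 0 := by
      intro v hv
      rw [← Finset.sum_filter]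
      refine Finset.sum_congr ?_ fun _ _ => rfl
      ext T'
      rw [𝒯.mem_star, Finset.mem_filter]
      refine and_congr_right fun hT' => ⟨fun h => ?_, mem_hull_of_mem⟩
      have h2 : v ∈ hull (T ∩ T') := by
        rw [← 𝒯.hull_inter_hull hT hT']; exact ⟨mem_hull_of_mem hv, h⟩
      exact (Finset.mem_inter.1
        ((𝒯.isSimplex hT).mem_of_mem_hull Finset.inter_subset_left hv h2)).2
    rw [Finset.sum_congr rfl this, Finset.sum_comm]
    refine Finset.sum_congr rfl fun T' _ => ?_
    rw [← Finset.sum_filter, Finset.sum_const, nsmul_eq_mul, Finset.filter_mem_eq_inter]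
  rw [Finset.sum_congr rfl e1, Finset.sum_comm, Finset.mul_sum]
  refine Finset.sum_le_sum fun T' hT' => ?_
  rw [← Finset.sum_mul]
  refine mul_le_mul_of_nonneg_right ?_ (hD T' hT')
  have e2 : ∀ T ∈ 𝒯.cells, ((T ∩ T').card : ℝ) = ∑ v ∈ T', if v ∈ T then (1 : ℝ) else 0 := by
    intro T _
    rw [Finset.sum_boole, Finset.inter_comm, Finset.filter_mem_eq_inter]
  rw [Finset.sum_congr rfl e2, Finset.sum_comm]
  have e3 : ∀ v ∈ T', (∑ T ∈ 𝒯.cells, if v ∈ T then (1 : ℝ) else 0) ≤ κ ^ d := by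
    intro v _
    rw [Finset.sum_boole]
    exact hu.card_star_le _ (Finset.filter_subset _ _)
      fun T hT => mem_hull_of_mem (Finset.mem_filter.1 hT).2
  refine (Finset.sum_le_card_nsmul _ _ _ e3).trans_eq ?_
  rw [𝒯.card_eq T' hT', nsmul_eq_mul]; push_cast; ring

/-- Skeletal functions are approximated by traces of conforming linear functions. -/
theorem exists_conforming_approximation (d k : ℕ) (hd : 1 ≤ d) (κ c1 c3 : ℝ) :
    ∃ C > 0, ∀ (Ω : Set (Pt d)), IsLipschitzDomain Ω → ∀ 𝒯 : SimplicialMesh d Ω, 𝒯.Uniform κ →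
      ∀ p, 1 ≤ p → ∀ S : Method 𝒯 p k, S.LS1 c1 → S.LS3 c3 → ∀ lam : 𝒯.M p,
        ∃ (w : Pt d → ℝ) (mu : 𝒯.M p), 𝒯.ConformingP1 w ∧ (∀ x ∉ Ω, w x = 0) ∧ Continuous w ∧
          (mu : Finset (Pt d) → Pt d → ℝ) = 𝒯.trace w ∧
          normM (lam - mu) ≤ C * 𝒯.h * S.normQ lam := by
  by_cases hκ : 0 < κ
  swap
  · exact ⟨1, one_pos, fun Ω _ 𝒯 hu => absurd hu.κ_pos hκ⟩
  obtain ⟨C, hC, hest⟩ := exists_cell_estimate d k hd κ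
  have hb := ballVol_pos d
  set N := (κ ^ d + 1) ^ 2 * (4 * C) with hN
  have hN0 : 0 < N := by positivity
  set C₁ := ballVol d * (2 * C + 2 * N * ((d + 1) * κ ^ d)) with hC₁
  have hC₁0 : 0 < C₁ := by positivity
  set C₂ := (1 + |c1| * |c3|) ^ 2 + c1 ^ 2 with hC₂
  have hC₂0 : 0 < C₂ := by positivity
  refine ⟨Real.sqrt ((2 * C₁ + 2) * C₂), Real.sqrt_pos.2 (by positivity),
    fun Ω hΩ 𝒯 hu p hp S h1 h3 lam => ?_⟩
  have hh := hu.h_pos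
  have hg : ∀ v ∈ frontier Ω, S.nodal lam v = 0 := fun v hv => S.nodal_frontier lam hv
  set w := 𝒯.interp (S.nodal lam) with hw
  have hwc : 𝒯.ConformingP1 w := 𝒯.conformingP1_interp hΩ hg
  have hw0 : ∀ x ∉ Ω, w x = 0 := fun x hx => 𝒯.interp_eq_zero hΩ hg hx
  obtain ⟨K, hK⟩ := 𝒯.interp_lipschitz hΩ hg
  have hfrΩ : ∀ x ∈ frontier Ω, x ∉ Ω := fun x hx => by
    rw [frontier, hΩ.isOpen.interior_eq] at hx; exact hx.2
  refine ⟨w, ⟨_, 𝒯.trace_mem_M hp hwc fun x hx => hw0 x (hfrΩ x hx)⟩, hwc, hw0, hK.continuous, rfl, ?_⟩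
  set mu : 𝒯.M p := ⟨_, 𝒯.trace_mem_M hp hwc fun x hx => hw0 x (hfrΩ x hx)⟩ with hmu
  have hD0 : ∀ T ∈ 𝒯.cells, 0 ≤ S.indic lam T := fun T hT => S.indic_nonneg hd lam hT
  set A : Finset (Pt d) → ℝ := fun T =>
    (2 * C * S.indic lam T + 2 * N * ∑ v ∈ T, ∑ T' ∈ 𝒯.star v, S.indic lam T') / 𝒯.h ^ d with hA
  have hs0 : ∀ v, 0 ≤ ∑ T' ∈ 𝒯.star v, S.indic lam T' := fun v =>
    Finset.sum_nonneg fun T' hT' => hD0 T' (𝒯.mem_star.1 hT').1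
  have hA0 : ∀ T ∈ 𝒯.cells, 0 ≤ A T := fun T hT =>
    div_nonneg (add_nonneg (mul_nonneg (by positivity) (hD0 T hT))
      (mul_nonneg (by positivity) (Finset.sum_nonneg fun v _ => hs0 v))) (by positivity)
  have hpt : ∀ T ∈ 𝒯.cells, ∀ x ∈ hull T, (val (S.U lam T) x - w x) ^ 2 ≤ A T := by
    intro T hT x hx
    rw [hw, 𝒯.interp_eq _ hT hx]
    refine sq_sub_linInterp_le (𝒯.isSimplex hT) (u := val (S.U lam T)) (fun y hy v hv => ?_) hx
    have hvT : v ∈ hull T := mem_hull_of_mem hv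
    have e1 := (hest Ω 𝒯 hu p S lam T hT y hy).1 v hvT
    have e2 := S.sq_sub_nodal_le hd hΩ hu hC lam (fun T hT v hv => (hest Ω 𝒯 hu p S lam T hT v hv).2)
      (𝒯.mem_star.2 ⟨hT, hvT⟩)
    have e3 : ∑ T' ∈ 𝒯.star v, S.indic lam T' ≤ ∑ v ∈ T, ∑ T' ∈ 𝒯.star v, S.indic lam T' :=
      Finset.single_le_sum (f := fun v => ∑ T' ∈ 𝒯.star v, S.indic lam T') (fun v _ => hs0 v) hv
    have e4 : (κ ^ d + 1) ^ 2 * (4 * C * ((∑ T' ∈ 𝒯.star v, S.indic lam T') / 𝒯.h ^ d)) ≤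
        N * ((∑ v ∈ T, ∑ T' ∈ 𝒯.star v, S.indic lam T') / 𝒯.h ^ d) := by
      rw [hN, mul_assoc ((κ ^ d + 1) ^ 2)]
      gcongr
    have e5 : A T = 2 * (C * (S.indic lam T / 𝒯.h ^ d)) +
        2 * (N * ((∑ v ∈ T, ∑ T' ∈ 𝒯.star v, S.indic lam T') / 𝒯.h ^ d)) := by
      rw [hA]; ring
    rw [e5]
    nlinarith [sq_nonneg ((val (S.U lam T) y - val (S.U lam T) v) -
      (val (S.U lam T) v - S.nodal lam v))]
  -- Split `λ - w` as `(𝒰 λ - w) - (𝒰 λ - λ)`. The weight `|T| / |∂T|` turns the constant bound `A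
  -- T` on `∂T` into `|T| A T`, and `|T| ≤ ballVol d * h ^ d` cancels the factor `h ^ (-d)` in `A
  -- T`.
  have hcell : ∀ T ∈ 𝒯.cells,
      volRatio T * bdryIntegral T (fun F x => ((lam - mu : 𝒯.M p) : Finset (Pt d) → Pt d → ℝ) F x ^ 2) ≤
        2 * (ballVol d * 𝒯.h ^ d * A T) + 2 * S.indic lam T := by
    intro T hT
    have hS := 𝒯.isSimplex hT
    have hr0 := hS.volRatio_pos hd
    have hjc : BdryCont T (fun F x => S.jump lam T F x ^ 2) :=
      fun F hF => (S.jump_continuousOn lam hT hF).pow 2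
    have hcc : BdryCont T (fun _ _ => A T) := fun F hF => continuousOn_const
    have f1 : bdryIntegral T (fun F x =>
        ((lam - mu : 𝒯.M p) : Finset (Pt d) → Pt d → ℝ) F x ^ 2) ≤
        2 * bdryIntegral T (fun _ _ => A T) + 2 * bdryIntegral T (fun F x => S.jump lam T F x ^ 2) := by
      rw [← bdryIntegral_comb hS hd hcc hjc]
      refine bdryIntegral_mono hS hd (fun F hF => (𝒯.M_continuousOn _ hT hF).pow 2)
        (fun F hF => (continuousOn_const.mul (hcc F hF)).add (continuousOn_const.mul (hjc F hF)))
        fun F hF x hx => ?_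
      have f2 : ((lam - mu : 𝒯.M p) : Finset (Pt d) → Pt d → ℝ) F x =
          (val (S.U lam T) x - w x) - S.jump lam T F x := by
        have : (mu : Finset (Pt d) → Pt d → ℝ) F x = w x := 𝒯.trace_apply w hT hF hx
        rw [Method.jump, Submodule.coe_sub, Pi.sub_apply, Pi.sub_apply, this]; ring
      rw [f2]
      have f3 := hpt T hT x (hull_mono (facet_subset hF) hx)
      nlinarith [sq_nonneg ((val (S.U lam T) x - w x) + S.jump lam T F x)]
    have f4 : bdryIntegral T (fun _ _ => A T) = (∑ F ∈ facets T, (surf d).real (hull F)) * A T := by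
      rw [bdryIntegral, Finset.sum_mul]
      refine Finset.sum_congr rfl fun F _ => ?_
      rw [setIntegral_const, smul_eq_mul]
    have f5 : volRatio T * bdryIntegral T (fun _ _ => A T) = volume.real (hull T) * A T := by
      rw [f4, volRatio]
      have := (hS.sum_surf_pos hd).ne'
      field_simp
    have f6 : volume.real (hull T) * A T ≤ ballVol d * 𝒯.h ^ d * A T := by
      refine mul_le_mul_of_nonneg_right ?_ (hA0 T hT)
      rw [mul_comm]; exact hu.volume_le hT
    have f7 : volRatio T * bdryIntegral T (fun F x => S.jump lam T F x ^ 2) ≤ S.indic lam T :=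
      le_add_of_nonneg_left (mul_nonneg (sq_nonneg _) (integral_nonneg fun _ => by positivity))
    have f8 := mul_le_mul_of_nonneg_left f1 hr0.le
    rw [mul_add, mul_left_comm, f5, mul_left_comm (volRatio T) 2] at f8
    linarith
  have hsumA : ∑ T ∈ 𝒯.cells, ballVol d * 𝒯.h ^ d * A T ≤ C₁ * ∑ T ∈ 𝒯.cells, S.indic lam T := by
    have g1 : ∀ T ∈ 𝒯.cells, ballVol d * 𝒯.h ^ d * A T = ballVol d * (2 * C) * S.indic lam T +
        ballVol d * (2 * N) * ∑ v ∈ T, ∑ T' ∈ 𝒯.star v, S.indic lam T' := by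
      intro T _
      rw [hA]; field_simp
    rw [Finset.sum_congr rfl g1, Finset.sum_add_distrib, ← Finset.mul_sum, ← Finset.mul_sum]
    have g2 := mul_le_mul_of_nonneg_left (SimplicialMesh.sum_star_le hu hD0)
      (by positivity : 0 ≤ ballVol d * (2 * N))
    rw [hC₁]
    linarith
  have hsq : normM (lam - mu) ^ 2 ≤ (2 * C₁ + 2) * C₂ * (𝒯.h * S.normQ lam) ^ 2 := by
    rw [normM, 𝒯.skelNorm_sq hd]
    have g0 : ∑ T ∈ 𝒯.cells, (2 * (ballVol d * 𝒯.h ^ d * A T) + 2 * S.indic lam T) =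
        2 * ∑ T ∈ 𝒯.cells, ballVol d * 𝒯.h ^ d * A T + 2 * ∑ T ∈ 𝒯.cells, S.indic lam T := by
      rw [Finset.sum_add_distrib, Finset.mul_sum, Finset.mul_sum]
    refine (Finset.sum_le_sum hcell).trans ?_
    rw [g0]
    have g3 := S.sum_indic_le hd hΩ h1 h3 lam
    have g4 := mul_le_mul_of_nonneg_left g3 (by positivity : 0 ≤ 2 * C₁ + 2)
    rw [← hC₂] at g4
    linarith
  have hq := S.normQ_nonneg lam
  refine (pow_le_pow_iff_left₀ (normM_nonneg _)
    (mul_nonneg (mul_nonneg (Real.sqrt_nonneg _) hh.le) hq) two_ne_zero).1 ?_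
  rw [mul_assoc, mul_pow, Real.sq_sqrt (by positivity)]
  exact hsq

/-! ### The skeletal space -/

section Skeletal

variable {Ω : Set (Pt d)} {𝒯 : SimplicialMesh d Ω} {p k : ℕ}

theorem eq_zero_of_normM_eq_zero (hd : 1 ≤ d) {lam : 𝒯.M p} (h : normM lam = 0) : lam = 0 := by
  have h0 := 𝒯.skelNorm_sq hd fun _ F x => (lam : Finset (Pt d) → Pt d → ℝ) F x
  rw [normM] at h
  rw [h, zero_pow two_ne_zero, eq_comm,
    Finset.sum_eq_zero_iff_of_nonneg fun T hT => 𝒯.cell_term_nonneg hd hT _] at h0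
  refine Subtype.ext (funext fun F => ?_)
  by_cases hF : 𝒯.IsFace F
  · obtain ⟨T, hT, hFT⟩ := hF
    have hS := 𝒯.isSimplex hT
    have h1 := (mul_eq_zero.1 (h0 T hT)).resolve_left (hS.volRatio_pos hd).ne'
    rw [bdryIntegral, Finset.sum_eq_zero_iff_of_nonneg
      fun F _ => integral_nonneg fun _ => sq_nonneg _] at h1
    obtain ⟨P, -, hP⟩ := lam.2.1 F (𝒯.isFace hT hFT)
    funext x
    by_cases hx : x ∈ hull F
    · exact pow_eq_zero_iff two_ne_zero |>.1 (eq_zero_of_face_integral_eq_zero hS hd hFT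
        ((𝒯.M_continuousOn lam hT hFT).pow 2) (fun _ _ => sq_nonneg _) (h1 F hFT) hx)
    · rw [hP, Set.indicator_of_notMem hx]; rfl
  · exact lam.2.2.2 F hF

/-- A polynomial, as a function on the face `F`. -/
def faceFun (F : Finset (Pt d)) : Poly d →ₗ[ℝ] Pt d → ℝ where
  toFun P := (hull F).indicator (val P)
  map_add' P R := by
    funext x; by_cases hx : x ∈ hull F <;> simp [hx, val]
  map_smul' c P := by
    funext x; by_cases hx : x ∈ hull F <;> simp [hx, val]

/-- Restriction to the finitely many faces embeds `M` into a product of images of polynomial spaces.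
-/
theorem finiteDimensional_M : FiniteDimensional ℝ (𝒯.M p) := by
  classical
  let N : (𝒯.cells.biUnion facets) → Submodule ℝ (Pt d → ℝ) :=
    fun F => (PolyDeg d p).map (faceFun (F : Finset (Pt d)))
  have hface : ∀ F, 𝒯.IsFace F ↔ F ∈ 𝒯.cells.biUnion facets := fun F => by
    rw [Finset.mem_biUnion]; rfl
  let Ψ : 𝒯.M p →ₗ[ℝ] (∀ F, N F) := LinearMap.pi fun F =>
    ((LinearMap.proj (F : Finset (Pt d))).comp (𝒯.M p).subtype).codRestrict (N F) fun lam => by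
      obtain ⟨P, hP, h⟩ := lam.2.1 F ((hface F).2 F.2)
      exact ⟨P, hP, h.symm⟩
  refine FiniteDimensional.of_injective Ψ fun a b hab => Subtype.ext (funext fun F => ?_)
  by_cases hF : 𝒯.IsFace F
  · exact congrArg Subtype.val (congrFun hab ⟨F, (hface F).1 hF⟩)
  · rw [a.2.2.2 F hF, b.2.2.2 F hF]

theorem IsLipschitzDomain.frontier_nonempty (hd : 1 ≤ d) (hΩ : IsLipschitzDomain Ω) :
    (frontier Ω).Nonempty := by
  have : Nonempty (Fin d) := ⟨⟨0, hd⟩⟩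
  rw [Set.nonempty_iff_ne_empty]
  intro h
  rcases frontier_eq_empty_iff.1 h with h1 | h1
  · exact hΩ.isConnected.nonempty.ne_empty h1
  · exact NormedSpace.unbounded_univ ℝ (Pt d) (h1 ▸ hΩ.isBounded)

/-- A continuous function which is constant on every cell and vanishes on the boundary of `Ω`
vanishes on `Ω`. -/
theorem eq_zero_of_cellwise_const (hd : 1 ≤ d) (hΩ : IsLipschitzDomain Ω) {w : Pt d → ℝ}
    (hw : Continuous w) (h0 : ∀ x ∈ frontier Ω, w x = 0)
    (hc : ∀ T ∈ 𝒯.cells, ∃ c, ∀ x ∈ hull T, w x = c) {x : Pt d} (hx : x ∈ closure Ω) : w x = 0 := by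
  -- A connected set of real numbers with finitely many elements, among them `0`, is `{0}`.
  have hfin : (w '' closure Ω).Finite := by
    choose! c hc using hc
    refine (𝒯.cells.finite_toSet.image c).subset ?_
    rintro _ ⟨x, hx, rfl⟩
    obtain ⟨T, hT, hxT⟩ := 𝒯.exists_cell hx
    exact ⟨T, hT, (hc T hT x hxT).symm⟩
  have hpre := hΩ.isConnected.isPreconnected.closure.image w hw.continuousOn
  obtain ⟨y, hy⟩ := hΩ.frontier_nonempty hd
  have hx' : w x ∈ w '' closure Ω := Set.mem_image_of_mem w hx
  have hy' : (0 : ℝ) ∈ w '' closure Ω := ⟨y, frontier_subset_closure hy, h0 y hy⟩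
  rcases lt_trichotomy (w x) 0 with h | h | h
  · exact absurd (hfin.subset (hpre.Icc_subset hx' hy')) (Set.Icc_infinite h)
  · exact h
  · exact absurd (hfin.subset (hpre.Icc_subset hy' hx')) (Set.Icc_infinite h)

namespace Method

variable (S : Method 𝒯 p k)

theorem vecVal_Q_eq_zero (hΩ : IsLipschitzDomain Ω) {lam : 𝒯.M p} (h : S.normQ lam = 0)
    {T : Finset (Pt d)} (hT : T ∈ 𝒯.cells) {x : Pt d} (hx : x ∈ interior (hull T)) :
    vecVal (S.Q lam T) x = 0 := by
  have h0 := S.normQ_sq hΩ lam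
  rw [h, zero_pow two_ne_zero, eq_comm, Finset.sum_eq_zero_iff_of_nonneg
    fun T _ => integral_nonneg fun _ => by positivity] at h0
  have hc : Continuous fun x => ‖vecVal (S.Q lam T) x‖ ^ 2 := (continuous_vecVal _).norm.pow 2
  have h1 := (setIntegral_eq_zero_iff_of_nonneg_ae (Eventually.of_forall fun _ => by positivity)
    (integrableOn_hull hc.continuousOn)).1 (h0 T hT)
  have h2 : (fun x => ‖vecVal (S.Q lam T) x‖ ^ 2) =ᵐ[volume.restrict (interior (hull T))] 0 :=
    ae_mono (Measure.restrict_mono interior_subset le_rfl) h1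
  have h3 := Measure.eqOn_open_of_ae_eq h2 isOpen_interior hc.continuousOn continuousOn_const hx
  simpa using h3

/-- The skeletal data of a conforming function with vanishing `𝒬` vanish. -/
theorem eq_zero_of_conforming (hd : 1 ≤ d) (hΩ : IsLipschitzDomain Ω) (h4 : S.LS4) {w : Pt d → ℝ}
    {mu : 𝒯.M p} (hw : 𝒯.ConformingP1 w) (hw0 : ∀ x ∉ Ω, w x = 0) (hwc : Continuous w)
    (hmu : (mu : Finset (Pt d) → Pt d → ℝ) = 𝒯.trace w) (h : S.normQ mu = 0) : mu = 0 := by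
  have hfr : ∀ x ∈ frontier Ω, w x = 0 := fun x hx => hw0 x fun hx' => by
    rw [frontier, hΩ.isOpen.interior_eq] at hx; exact hx.2 hx'
  have hconst : ∀ T ∈ 𝒯.cells, ∃ c, ∀ x ∈ hull T, w x = c := by
    intro T hT
    obtain ⟨P, hP, hPw⟩ := hw.2 T hT
    obtain ⟨f, hf⟩ := exists_affineMap_of_mem_polyDeg_one hP
    have hdiff : DifferentiableOn ℝ w (interior (hull T)) := by
      let g : Pt d →ᴬ[ℝ] ℝ := ⟨f, f.continuous_of_finiteDimensional⟩
      exact g.differentiable.differentiableOn.congr fun x hx =>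
        (hPw x (interior_subset hx)).trans (hf x)
    have hgrad : (interior (hull T)).EqOn (fderiv ℝ w) 0 := by
      intro x hx
      have h1 := (h4 w hw mu hmu T hT).1 x hx
      rw [S.vecVal_Q_eq_zero hΩ h hT hx, zero_eq_neg, gradient] at h1
      simpa using h1
    have hcv : Convex ℝ (interior (hull T)) := (convex_convexHull ℝ _).interior
    obtain ⟨c, hc⟩ := isOpen_interior.exists_is_const_of_fderiv_eq_zero hcv.isPreconnected hdiff hgrad
    refine ⟨c, fun x hx => ?_⟩
    rw [← (𝒯.isSimplex hT).closure_interior] at hx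
    exact closure_minimal (t := {y | w y = c}) (fun y hy => hc y hy)
      (isClosed_eq hwc continuous_const) hx
  have hz : w = 0 := by
    funext x
    by_cases hx : x ∈ closure Ω
    · exact eq_zero_of_cellwise_const hd hΩ hwc hfr hconst hx
    · exact hw0 x fun h => hx (subset_closure h)
  refine Subtype.ext ?_
  rw [hmu, hz]
  funext F
  simp [SimplicialMesh.trace]

/-- The condensed bilinear form is definite. -/
theorem eq_zero_of_a_self_eq_zero (hd : 1 ≤ d) (hp : 1 ≤ p) (hΩ : IsLipschitzDomain Ω) {κ : ℝ}
    (hu : 𝒯.Uniform κ) {c1 c3 : ℝ} (h1 : S.LS1 c1) (h3 : S.LS3 c3) (h4 : S.LS4) {lam : 𝒯.M p}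
    (h : S.a lam lam = 0) : lam = 0 := by
  obtain ⟨C, -, hC⟩ := exists_conforming_approximation d k hd κ c1 c3
  have hq : S.normQ lam = 0 := by
    have := S.normQ_sq_le_a hΩ lam
    rw [h] at this
    exact pow_eq_zero_iff two_ne_zero |>.1 (le_antisymm this (sq_nonneg _))
  obtain ⟨w, mu, hw, hw0, hwc, hmu, hle⟩ := hC Ω hΩ 𝒯 hu p hp S h1 h3 lam
  -- With `𝒬 λ = 0` the approximation is exact: `λ` is itself the trace of a conforming function.
  rw [hq, mul_zero] at hle
  have he := sub_eq_zero.1 (eq_zero_of_normM_eq_zero hd (le_antisymm hle (normM_nonneg _)))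
  subst he
  exact S.eq_zero_of_conforming hd hΩ h4 hw hw0 hwc hmu hq

/-- Converse of `normQ_sq_le_a`. Since `volRatio T` is at least a multiple of `h`, (LS1) bounds the
unweighted jump integral by `h ‖𝒬 λ‖₀²`, and `τ h ≤ cτ` absorbs the factor. -/
theorem a_self_le (hd : 1 ≤ d) (hΩ : IsLipschitzDomain Ω) {κ : ℝ} (hu : 𝒯.Uniform κ) {c1 cτ : ℝ}
    (h1 : S.LS1 c1) (hτ : S.τ * 𝒯.h ≤ cτ) (lam : 𝒯.M p) :
    S.a lam lam ≤ (1 + |cτ| * c1 ^ 2 * ((d + 1) * κ ^ d * ballVol (d - 1) / ballVol d)) *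
      S.normQ lam ^ 2 := by
  have hκ := hu.κ_pos
  have hh := hu.h_pos
  have hb := ballVol_pos d
  have hb' := ballVol_pos (d - 1)
  set J := ∑ T ∈ 𝒯.cells, bdryIntegral T (fun F x => S.jump lam T F x ^ 2) with hJ
  set R := (d + 1) * κ ^ d * ballVol (d - 1) / ballVol d with hR
  have hR0 : 0 < R := by positivity
  have hJ0 : 0 ≤ J := Finset.sum_nonneg fun T _ => bdryIntegral_nonneg fun _ _ _ _ => sq_nonneg _
  have e1 : 𝒯.h * R⁻¹ * J ≤ 𝒯.skelNorm (S.jump lam) ^ 2 := by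
    rw [𝒯.skelNorm_sq hd, hJ, Finset.mul_sum]
    refine Finset.sum_le_sum fun T hT => mul_le_mul_of_nonneg_right ?_
      (bdryIntegral_nonneg fun _ _ _ _ => sq_nonneg _)
    rw [hR, inv_div]
    exact hu.le_volRatio hd hT
  have e2 := e1.trans (pow_le_pow_left₀ (𝒯.skelNorm_nonneg _) (h1 lam) 2)
  have e3 : J ≤ 𝒯.h * (c1 ^ 2 * R * S.normQ lam ^ 2) := by
    have : J = 𝒯.h⁻¹ * R * (𝒯.h * R⁻¹ * J) := by field_simp
    rw [this]
    refine (mul_le_mul_of_nonneg_left e2 (by positivity)).trans_eq ?_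
    field_simp
  rw [S.a_self hΩ, ← hJ]
  have e4 := mul_le_mul_of_nonneg_left e3 S.τ_nonneg
  have e5 : S.τ * 𝒯.h * (c1 ^ 2 * R * S.normQ lam ^ 2) ≤ |cτ| * (c1 ^ 2 * R * S.normQ lam ^ 2) :=
    mul_le_mul_of_nonneg_right (hτ.trans (le_abs_self _)) (by positivity)
  linarith

end Method

end Skeletal

/-! ### Two levels -/

section TwoLevel

variable {Ω : Set (Pt d)} {𝒯c 𝒯f : SimplicialMesh d Ω} {p k : ℕ}
  (Sc : Method 𝒯c p k) (Sf : Method 𝒯f p k) (I : 𝒯c.M p →ₗ[ℝ] 𝒯f.M p)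

/-- A definite form on a finite dimensional space is an isomorphism `e` onto the dual, and `P λ`
must be the preimage under `e` of the functional `μ ↦ a_ℓ(λ, I μ)`. -/
theorem exists_unique_ritz (hd : 1 ≤ d) (hΩ : IsLipschitzDomain Ω)
    (hdef : ∀ lam : 𝒯c.M p, Sc.a lam lam = 0 → lam = 0) :
    ∃! P : 𝒯f.M p →ₗ[ℝ] 𝒯c.M p, IsRitz Sc Sf I P := by
  have := finiteDimensional_M (𝒯 := 𝒯c) (p := p)
  have hinj : Function.Injective (Sc.aForm hd hΩ) := by
    refine (injective_iff_map_eq_zero _).2 fun lam h => hdef lam ?_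
    exact congrArg (fun g => g lam) h
  let e : 𝒯c.M p ≃ₗ[ℝ] (𝒯c.M p →ₗ[ℝ] ℝ) :=
    (Sc.aForm hd hΩ).linearEquivOfInjective hinj Subspace.dual_finrank_eq.symm
  have he : ∀ l m, e l m = Sc.a l m := fun l m => rfl
  refine ⟨e.symm.toLinearMap.comp ((Sf.aForm hd hΩ).compl₂ I), fun lam mu => ?_, fun P hP => ?_⟩
  · rw [← he, LinearMap.comp_apply]
    change e (e.symm _) mu = _
    rw [e.apply_symm_apply]
    rfl
  · refine LinearMap.ext fun lam => e.injective (LinearMap.ext fun mu => ?_)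
    rw [LinearMap.comp_apply]
    change e _ mu = e (e.symm _) mu
    rw [e.apply_symm_apply, he, hP]
    rfl

variable {Sc Sf I}

theorem vecFn_Q_conforming (h4 : Sc.LS4) {w : Pt d → ℝ} (hw : 𝒯c.ConformingP1 w) {mu : 𝒯c.M p}
    (hmu : (mu : Finset (Pt d) → Pt d → ℝ) = 𝒯c.trace w) :
    𝒯c.vecFn (Sc.Q mu) =ᵐ[volume.restrict Ω] fun x => -∇ w x := by
  filter_upwards [𝒯c.ae_mem_interior] with x ⟨T, hT, hx⟩
  rw [𝒯c.vecFn_eq _ hT hx, (h4 w hw mu hmu T hT).1 x hx]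

theorem fn_U_conforming (h4 : Sc.LS4) {w : Pt d → ℝ} (hw : 𝒯c.ConformingP1 w) {mu : 𝒯c.M p}
    (hmu : (mu : Finset (Pt d) → Pt d → ℝ) = 𝒯c.trace w) :
    𝒯c.fn (Sc.U mu) =ᵐ[volume.restrict Ω] w := by
  filter_upwards [𝒯c.ae_mem_interior] with x ⟨T, hT, hx⟩
  rw [𝒯c.fn_eq _ hT hx, (h4 w hw mu hmu T hT).2 x (interior_subset hx)]

/-- Stability and approximation of the injection operator. -/
theorem exists_injection_estimate (d p k : ℕ) (hd : 1 ≤ d) (hp : 1 ≤ p) (κ cref cI c1 c2 c3 : ℝ)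
    (hcref : 0 < cref) :
    ∃ C > 0, ∀ (Ω : Set (Pt d)), IsLipschitzDomain Ω → ∀ 𝒯c 𝒯f : SimplicialMesh d Ω,
      𝒯c.Uniform κ → 𝒯f.Uniform κ → 𝒯c.IsRefinedBy 𝒯f → cref * 𝒯c.h ≤ 𝒯f.h →
      ∀ (Sc : Method 𝒯c p k) (Sf : Method 𝒯f p k) (I : 𝒯c.M p →ₗ[ℝ] 𝒯f.M p),
        IA1 I cI → IA2 I → Sc.LS1 c1 → Sc.LS2 c2 → Sc.LS3 c3 → Sc.LS4 → Sf.LS2 c2 → Sf.LS4 →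
        ∀ lam : 𝒯c.M p, Sf.normQ (I lam) ≤ C * Sc.normQ lam ∧
          l2norm Ω (fun x => 𝒯c.fn (Sc.U lam) x - 𝒯f.fn (Sf.U (I lam)) x)
            ≤ C * 𝒯c.h * Sc.normQ lam ∧
          l2norm Ω (fun x => 𝒯c.fn (Sc.U lam) x - 𝒯f.fn (Sf.U (I lam)) x)
            ≤ C * 𝒯f.h * Sc.normQ lam := by
  obtain ⟨C₀, hC₀, happ⟩ := exists_conforming_approximation d k hd κ c1 c3
  -- The summands bound `𝒬 λ`, `𝒬 δ` on the coarse level and `𝒬 (I δ)` on the fine level.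
  set CQ := 1 + |c2| * C₀ + |c2| * |cI| * C₀ / cref with hCQ
  set CU := |c2| * (1 + |cI|) * C₀ with hCU
  have hCQ0 : 0 < CQ := by positivity
  have hCU0 : 0 ≤ CU := by positivity
  refine ⟨CQ + CU + CU / cref, by positivity, fun Ω hΩ 𝒯c 𝒯f huc huf hr hcr Sc Sf I hI1 hI2
    h1 h2 h3 h4 h2' h4' lam => ?_⟩
  have hhc := huc.h_pos
  have hhf := huf.h_pos
  obtain ⟨w, mu, hw, -, -, hmu, hle⟩ := happ Ω hΩ 𝒯c huc p hp Sc h1 h3 lam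
  have hw' : 𝒯f.ConformingP1 w := SimplicialMesh.ConformingP1.refine 𝒯c hr hw
  have hmu' := hI2 w hw mu hmu
  set q := Sc.normQ lam with hq
  have hq0 : 0 ≤ q := Sc.normQ_nonneg lam
  set δ := lam - mu with hδ
  have hlam : lam = δ + mu := (sub_add_cancel lam mu).symm
  have hmu_eq : mu = lam + -δ := by rw [hδ]; abel
  set D := normM δ with hD
  have hD0 : 0 ≤ D := normM_nonneg δ
  -- The approximation error is of order `𝒯c.h`, whereas (LS2) on the fine level costs `𝒯f.h⁻¹`;
  -- bounded refinement reconciles the two.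
  have hcr' : 𝒯c.h ≤ 𝒯f.h / cref := by rw [le_div_iff₀ hcref]; linarith
  have hID : normM (I δ) ≤ |cI| * D :=
    (hI1 δ).trans (mul_le_mul_of_nonneg_right (le_abs_self _) hD0)
  have hQc : Sc.normQ δ ≤ |c2| * C₀ * q := by
    refine (h2 δ).1.trans ?_
    calc c2 * 𝒯c.h⁻¹ * D ≤ |c2| * 𝒯c.h⁻¹ * (C₀ * 𝒯c.h * q) := by
          gcongr; exact le_abs_self _
      _ = |c2| * C₀ * q := by field_simp
  have hQf : Sf.normQ (I δ) ≤ |c2| * |cI| * C₀ / cref * q := by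
    refine (h2' (I δ)).1.trans ?_
    calc c2 * 𝒯f.h⁻¹ * normM (I δ) ≤ |c2| * 𝒯f.h⁻¹ * (|cI| * (C₀ * (𝒯f.h / cref) * q)) := by
          have hM := normM_nonneg (I δ)
          gcongr
          · exact le_abs_self _
          · exact hID.trans (by gcongr; exact hle.trans (by gcongr))
      _ = |c2| * |cI| * C₀ / cref * q := by field_simp
  -- On both levels `𝒬` of the trace is `-∇ w` almost everywhere, and this field does not depend on
  -- the mesh.
  have hQeq : Sf.normQ (I mu) = Sc.normQ mu := by
    rw [Method.normQ, Method.normQ, l2norm_congr (vecFn_Q_conforming h4' hw' hmu'),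
      l2norm_congr (vecFn_Q_conforming h4 hw hmu)]
  have hQ : Sf.normQ (I lam) ≤ CQ * q := by
    have e1 : Sf.normQ (I lam) ≤ Sf.normQ (I δ) + Sf.normQ (I mu) := by
      rw [hlam, map_add]; exact Sf.normQ_add_le hd _ _
    have e2 : Sc.normQ mu ≤ q + Sc.normQ δ := by
      have := Sc.normQ_add_le hd lam (-δ)
      rwa [← hmu_eq, Sc.normQ_neg hd] at this
    rw [hCQ]; linarith
  have hU : l2norm Ω (fun x => 𝒯c.fn (Sc.U lam) x - 𝒯f.fn (Sf.U (I lam)) x) ≤ CU * 𝒯c.h * q := by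
    -- The contributions of `mu` are both equal to `w` and cancel.
    have e1 : (fun x => 𝒯c.fn (Sc.U lam) x - 𝒯f.fn (Sf.U (I lam)) x) =ᵐ[volume.restrict Ω]
        𝒯c.fn (Sc.U δ) - 𝒯f.fn (Sf.U (I δ)) := by
      have e2 := Sc.fn_U_add hd δ mu
      have e3 := Sf.fn_U_add hd (I δ) (I mu)
      rw [← hlam] at e2
      rw [← map_add, ← hlam] at e3
      filter_upwards [e2, e3, fn_U_conforming h4 hw hmu, fn_U_conforming h4' hw' hmu']
        with x g1 g2 g3 g4
      simp only [Pi.add_apply, Pi.sub_apply] at *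
      rw [g1, g2, g3, g4]; ring
    rw [l2norm_congr e1]
    refine (l2norm_sub_le (𝒯c.memLp_fn _) (𝒯f.memLp_fn _)).trans ?_
    have e4 : l2norm Ω (𝒯c.fn (Sc.U δ)) ≤ |c2| * D :=
      (h2 δ).2.trans (mul_le_mul_of_nonneg_right (le_abs_self _) hD0)
    have e5 : l2norm Ω (𝒯f.fn (Sf.U (I δ))) ≤ |c2| * (|cI| * D) :=
      (h2' (I δ)).2.trans (mul_le_mul (le_abs_self _) hID (normM_nonneg _) (abs_nonneg _))
    have e6 := mul_le_mul_of_nonneg_left hle (by positivity : 0 ≤ |c2| * (1 + |cI|))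
    rw [hCU]; linarith
  have hCr0 : 0 ≤ CU / cref := by positivity
  clear_value CQ CU q
  refine ⟨hQ.trans ?_, hU.trans ?_, hU.trans ?_⟩
  · gcongr; linarith
  · gcongr; linarith
  · calc CU * 𝒯c.h * q ≤ CU * (𝒯f.h / cref) * q := by gcongr
      _ = CU / cref * 𝒯f.h * q := by ring
      _ ≤ (CQ + CU + CU / cref) * 𝒯f.h * q := by gcongr; linarith

/-- Duality: `a_{ℓ-1}(Pλ, Pλ) = a_ℓ(λ, I P λ)`. Cauchy–Schwarz and the bound for `I` leave one
factor `a_{ℓ-1}(Pλ, Pλ)` to divide out, unless it is zero. -/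
theorem a_ritz_le (hd : 1 ≤ d) (hΩ : IsLipschitzDomain Ω) {C : ℝ}
    (hI : ∀ lam, Sf.a (I lam) (I lam) ≤ C * Sc.a lam lam) {P : 𝒯f.M p →ₗ[ℝ] 𝒯c.M p}
    (hP : IsRitz Sc Sf I P) (hC : 0 ≤ C) (lam : 𝒯f.M p) :
    Sc.a (P lam) (P lam) ≤ C * Sf.a lam lam := by
  have h0 : 0 ≤ Sc.a (P lam) (P lam) := (sq_nonneg _).trans (Sc.normQ_sq_le_a hΩ _)
  have h0' : 0 ≤ Sf.a lam lam := (sq_nonneg _).trans (Sf.normQ_sq_le_a hΩ _)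
  rcases h0.eq_or_lt with h | h
  · rw [← h]; positivity
  have h1 := Sf.a_sq_le hd hΩ lam (I (P lam))
  rw [← hP] at h1
  have h2 := h1.trans (mul_le_mul_of_nonneg_left (hI (P lam)) h0')
  refine le_of_mul_le_mul_right ?_ h
  linarith

end TwoLevel

end HDG
end

/-! ### The main theorem -/

theorem mainTheorem2 (d p k : ℕ) (hd : 1 ≤ d) (hp : 1 ≤ p)
    (cshape cunif cref : ℝ) (hcref : 0 < cref) (cI c1 c2 c3 : ℝ) :
    ∃ C : ℝ, 0 < C ∧ ∀ cτ : ℝ, ∃ C' : ℝ, 0 < C' ∧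
      ∀ (Ω : Set (HDG.Pt d)), HDG.IsLipschitzDomain Ω →
      ∀ (L : ℕ) (H : HDG.MeshHierarchy d Ω L),
        (∀ ℓ, (H.mesh ℓ).ShapeRegular cshape) →
        (∀ ℓ, (H.mesh ℓ).QuasiUniform cunif) →
        (∀ ℓ : Fin L, cref * (H.mesh ℓ.castSucc).h ≤ (H.mesh ℓ.succ).h) →
      ∀ (S : ∀ ℓ, HDG.Method (H.mesh ℓ) p k)
        (I : ∀ ℓ : Fin L, (H.mesh ℓ.castSucc).M p →ₗ[ℝ] (H.mesh ℓ.succ).M p),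
        (∀ ℓ, HDG.IA1 (I ℓ) cI) → (∀ ℓ, HDG.IA2 (I ℓ)) →
        (∀ ℓ, (S ℓ).LS1 c1) → (∀ ℓ, (S ℓ).LS2 c2) → (∀ ℓ, (S ℓ).LS3 c3) → (∀ ℓ, (S ℓ).LS4) →
      ∀ ℓ : Fin L,
        (∀ lam : (H.mesh ℓ.castSucc).M p,
          (S ℓ.succ).normQ (I ℓ lam) ≤ C * (S ℓ.castSucc).normQ lam ∧
          HDG.l2norm Ω (fun x => (H.mesh ℓ.castSucc).fn ((S ℓ.castSucc).U lam) x
              - (H.mesh ℓ.succ).fn ((S ℓ.succ).U (I ℓ lam)) x)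
            ≤ C * (H.mesh ℓ.castSucc).h * (S ℓ.castSucc).normQ lam ∧
          HDG.l2norm Ω (fun x => (H.mesh ℓ.castSucc).fn ((S ℓ.castSucc).U lam) x
              - (H.mesh ℓ.succ).fn ((S ℓ.succ).U (I ℓ lam)) x)
            ≤ C * (H.mesh ℓ.succ).h * (S ℓ.castSucc).normQ lam) ∧
        (∃! P : (H.mesh ℓ.succ).M p →ₗ[ℝ] (H.mesh ℓ.castSucc).M p,
          HDG.IsRitz (S ℓ.castSucc) (S ℓ.succ) (I ℓ) P) ∧
        ((S ℓ.succ).τ * (H.mesh ℓ.succ).h ≤ cτ →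
          (∀ lam : (H.mesh ℓ.castSucc).M p,
            (S ℓ.succ).a (I ℓ lam) (I ℓ lam) ≤ C' * (S ℓ.castSucc).a lam lam) ∧
          ∀ P : (H.mesh ℓ.succ).M p →ₗ[ℝ] (H.mesh ℓ.castSucc).M p,
            HDG.IsRitz (S ℓ.castSucc) (S ℓ.succ) (I ℓ) P →
            ∀ lam : (H.mesh ℓ.succ).M p,
              (S ℓ.castSucc).a (P lam) (P lam) ≤ C' * (S ℓ.succ).a lam lam) := by
  set κ := max 1 (cunif * cshape) with hκ
  obtain ⟨C, hC, hest⟩ := HDG.exists_injection_estimate d p k hd hp κ cref cI c1 c2 c3 hcref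
  have hκ0 : 0 < κ := lt_max_of_lt_left one_pos
  have hb := HDG.ballVol_pos d
  have hb' := HDG.ballVol_pos (d - 1)
  refine ⟨C, hC, fun cτ => ?_⟩
  set A := 1 + |cτ| * c1 ^ 2 * ((d + 1) * κ ^ d * HDG.ballVol (d - 1) / HDG.ballVol d) with hA
  have hA0 : 0 < A := by positivity
  -- `A` bounds the fine energy by the square of the norm of `𝒬`, and `C ^ 2` comes from the
  -- stability of `I` in that norm.
  refine ⟨A * C ^ 2, by positivity, fun Ω hΩ L H hs hσ href S I hI1 hI2 h1 h2 h3 h4 ℓ => ?_⟩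
  have hu : ∀ j, (H.mesh j).Uniform κ := fun j => (H.mesh j).uniform_of_regular hd hΩ (hs j) (hσ j)
  have hbound := hest Ω hΩ (H.mesh ℓ.castSucc) (H.mesh ℓ.succ) (hu _) (hu _) (H.refined ℓ) (href ℓ)
    (S ℓ.castSucc) (S ℓ.succ) (I ℓ) (hI1 ℓ) (hI2 ℓ) (h1 _) (h2 _) (h3 _) (h4 _) (h2 _) (h4 _)
  refine ⟨hbound, HDG.exists_unique_ritz _ _ _ hd hΩ fun lam h =>
    (S ℓ.castSucc).eq_zero_of_a_self_eq_zero hd hp hΩ (hu _) (h1 _) (h3 _) (h4 _) h, fun hτ => ?_⟩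
  have hI : ∀ lam : (H.mesh ℓ.castSucc).M p,
      (S ℓ.succ).a (I ℓ lam) (I ℓ lam) ≤ A * C ^ 2 * (S ℓ.castSucc).a lam lam := by
    intro lam
    refine ((S ℓ.succ).a_self_le hd hΩ (hu _) (h1 _) hτ (I ℓ lam)).trans ?_
    rw [mul_assoc A]
    refine mul_le_mul_of_nonneg_left ?_ hA0.le
    refine (pow_le_pow_left₀ ((S ℓ.succ).normQ_nonneg _) (hbound lam).1 2).trans ?_
    rw [mul_pow]
    exact mul_le_mul_of_nonneg_left ((S ℓ.castSucc).normQ_sq_le_a hΩ lam) (by positivity)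
  exact ⟨hI, fun P hP lam => HDG.a_ritz_le hd hΩ hI hP (by positivity) lam⟩
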